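/- **Setting.** Let $T,\beta,\gamma>0$ and $0<\delta<\min(1,\beta)$. Let $u_0\in L^2(\mathbb R)\cap L^\infty(\mathbb R)$ with $a\le u_0\le b$ a.e., let $k\in L^\infty(\mathbb R)\cap BV_{\rm loc}(\mathbb R)$, let $f\in C^2([a,b])$, and put $f(k,u)=k\,f(u)$. Let $\mu(s)>0$ for $s>0$, with $\mu(s)=O(s^2)$ as $s\downarrow0$. **Scheme.** For a mesh size $\Delta x>0$ and a time step $\Delta t=T/N$ ($N\in\mathbb N$, $N\ge1$) put $x_j=j\Delta x$, $t^n=n\Delta t$, $k_{j+1/2}=\frac1{\Delta x}\int_{x_j}^{x_{j+1}}k\,dx$, $D_\pm v_j=\pm\frac{v_{j\pm1}-v_j}{\Delta x}$, $D^t_+v^n=\frac{v^{n+1}-v^n}{\Delta t}$, and consider grid functions $u^n_j$ with $$D^t_+u^n_j+D_-h^n_{j+1/2}=\beta\,\Delta x\,D_+D_-u^n_j+\gamma\,\mu(\Delta x)\,D^t_+D_+D_-u^n_j\quad(j\in\mathbb Z,\ 0\le n<N),\qquad u^0_j=\frac1{\Delta x}\int_{x_{j-1/2}}^{x_{j+1/2}}u_0\,dx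 .$$ Here $h^n_{j+1/2}=k_{j+1/2}\hat f(u^n_j,u^n_{j+1})$ if $k_{j+1/2}\ge0$ and $h^n_{j+1/2}=k_{j+1/2}\hat f(u^n_{j+1},u^n_j)$ if $k_{j+1/2}<0$, where $\hat f(u,v)=\frac12(f(u)+f(v))-\frac12\int_u^v|f'(s)|\,ds$ is the Engquist–Osher flux. Let $u_{\Delta x}$ be the function on $\mathbb R\times[0,\infty)$ equal to $u^n_j$ on $[x_{j-1/2},x_{j+1/2})\times[t^n,t^{n+1})$. **Hypotheses.** Take a sequence of mesh sizes $\Delta x\downarrow0$ with time steps $\Delta t=T/N$ and corresponding approximations $u_{\Delta x}$ such that * there are constants $a',b'$ with $[a',b']\subseteq[a,b]$, independent of $\Delta x$, with $a'\le u_{\Delta x}\le b'$ a.e. on $\mathbb R\times[0,T]$; * with $\lambda=\Delta t/\Delta x$ and $M=\max\{\sup_{[a',b']}|f|,\ \sup_{[a',b']}|f'|,\ \|k\|_{L^\infty}\}$, the CFL condition $$\max\Big\{2M+\frac\lambda2,\ \frac\lambda2\Big(1+\frac{\beta\,\Delta x^2}{\gamma\,\mu(\Delta x)}\Big)\Big\}\le\min(1-\delta,\beta-\delta)$$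 holds for every $\Delta x$ of the sequence. **Lemma ($H^{-1}_{\rm loc}$ compactness).** Let $c\in[a,b]$ and $$(\eta_1,q_1)(k,u)=\big(u-c,\ f(k,u)-f(k,c)\big),\qquad(\eta_2,q_2)(k,u)=\Big(f(k,u)-f(k,c),\ \int_c^u\big(f_u(k,\theta)\big)^2\,d\theta\Big).$$ Then, for $i=1,2$, the functions $\eta_i(k(x),u_{\Delta x})$ and $q_i(k(x),u_{\Delta x})$ are locally integrable on $\mathbb R\times(0,T)$ and the sequence of distributions $$\eta_i(k(x),u_{\Delta x})_t+q_i(k(x),u_{\Delta x})_x$$ lies in a compact subset of $H^{-1}_{\rm loc}(\mathbb R\times[0,T])$; that is, for each bounded open set $\Omega\subset\mathbb R\times(0,T)$ the restrictions of these distributions to $\Omega$ lie in a common compact subset of $H^{-1}(\Omega)=(H^1_0(\Omega))^*$. -/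

import Mathlib

open Set Filter MeasureTheory TopologicalSpace
open scoped Topology Distributions LineDeriv

noncomputable section

namespace DDScheme

/-! ### Grids, difference operators and the fully discrete scheme

Grid functions are written `v j` (space index `j : ℤ`) or `u n j` (time index `n : ℕ`).
`h` is the spatial mesh size `Δx`, `τ` the time step `Δt`, and points of the plane are
`p = (x, t)`. A quantity living at the half-integer point `j + 1/2` is stored at the index `j`. -/

/-- Forward difference in space, `D₊ v_j = (v_{j+1} - v_j) / Δx`. -/
def dPlus (h : ℝ) (v : ℤ → ℝ) (j : ℤ) : ℝ := (v (j + 1) - v j) / h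

/-- Backward difference in space, `D₋ v_j = (v_j - v_{j-1}) / Δx`. -/
def dMinus (h : ℝ) (v : ℤ → ℝ) (j : ℤ) : ℝ := (v j - v (j - 1)) / h

/-- Forward difference in time, `Dᵗ₊ wⁿ = (wⁿ⁺¹ - wⁿ) / Δt`. -/
def dTime (τ : ℝ) (w : ℕ → ℝ) (n : ℕ) : ℝ := (w (n + 1) - w n) / τ

/-- Cell average of the initial datum over `[x_{j-1/2}, x_{j+1/2})`, where `x_j = j Δx`. -/
def initAvg (u₀ : ℝ → ℝ) (h : ℝ) (j : ℤ) : ℝ :=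
  (1 / h) * ∫ x in (((j : ℝ) - 1 / 2) * h)..(((j : ℝ) + 1 / 2) * h), u₀ x

/-- The staggered average `k_{j+1/2}` of the coefficient over `[x_j, x_{j+1}]`. -/
def coeffAvg (k : ℝ → ℝ) (h : ℝ) (j : ℤ) : ℝ :=
  (1 / h) * ∫ x in ((j : ℝ) * h)..(((j : ℝ) + 1) * h), k x

/-- The Engquist–Osher flux of `f`; the argument `f'` is the derivative of `f`. -/
def engquistOsher (f f' : ℝ → ℝ) (u v : ℝ) : ℝ :=
  (1 / 2) * (f u + f v) - (1 / 2) * ∫ s in u..v, |f' s|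

/-- The numerical flux `h_{j+1/2}` for `k(x) f(u)`; the arguments of the Engquist–Osher flux are
transposed where the averaged coefficient is negative. -/
def numFlux (f f' k : ℝ → ℝ) (h : ℝ) (v : ℤ → ℝ) (j : ℤ) : ℝ :=
  if 0 ≤ coeffAvg k h j then coeffAvg k h j * engquistOsher f f' (v j) (v (j + 1))
  else coeffAvg k h j * engquistOsher f f' (v (j + 1)) (v j)

/-- `u` is generated by the fully discrete scheme, with mesh sizes `h`, `τ`, on the time levels
`0, …, N`; here `μ` is the value `μ(Δx)`. -/
structure IsSchemeSolution (f f' k u₀ : ℝ → ℝ) (β γ μ h τ : ℝ) (N : ℕ) (u : ℕ → ℤ → ℝ) :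
    Prop where
  init : ∀ j, u 0 j = initAvg u₀ h j
  step : ∀ n < N, ∀ j,
    dTime τ (fun n => u n j) n + dMinus h (numFlux f f' k h (u n)) j
      = β * h * dPlus h (dMinus h (u n)) j
        + γ * μ * dTime τ (fun n => dPlus h (dMinus h (u n)) j) n

/-- The piecewise constant function `u_Δx = ∑_{j,n} u^n_j 1_{I^n_j}` with
`I^n_j = [x_{j-1/2}, x_{j+1/2}) × [tⁿ, tⁿ⁺¹)`. -/
def gridFun (h τ : ℝ) (u : ℕ → ℤ → ℝ) (p : ℝ × ℝ) : ℝ :=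
  if 0 ≤ p.2 then u ⌊p.2 / τ⌋₊ ⌊p.1 / h + 1 / 2⌋ else 0

theorem gridFun_eq {h τ : ℝ} (hh : 0 < h) (hτ : 0 < τ) (u : ℕ → ℤ → ℝ) (n : ℕ) (j : ℤ)
    {p : ℝ × ℝ} (hp : p ∈ Ico (((j : ℝ) - 1 / 2) * h) (((j : ℝ) + 1 / 2) * h) ×ˢ
      Ico ((n : ℝ) * τ) (((n : ℝ) + 1) * τ)) :
    gridFun h τ u p = u n j := by
  obtain ⟨⟨h1, h2⟩, h3, h4⟩ := hp
  have ht : 0 ≤ p.2 := le_trans (by positivity) h3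
  have e1 : ⌊p.2 / τ⌋₊ = n := by
    rw [Nat.floor_eq_iff (by positivity)]
    exact ⟨by rwa [le_div_iff₀ hτ], by rwa [div_lt_iff₀ hτ]⟩
  have e2 : ⌊p.1 / h + 1 / 2⌋ = j := by
    rw [Int.floor_eq_iff]
    rw [← le_div_iff₀ hh] at h1
    rw [← div_lt_iff₀ hh] at h2
    constructor <;> linarith
  rw [gridFun, if_pos ht, e1, e2]

/-! ### Norms, the stability condition and the coefficient class -/

/-- Supremum of `|g|` over `[a, b]`. -/
def supAbs (g : ℝ → ℝ) (a b : ℝ) : ℝ := sSup ((fun s => |g s|) '' Icc a b)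

/-- `max {‖f‖_∞, ‖f'‖_∞, ‖k‖_∞}`, where `f` and `f'` are measured on `[a, b]` and the norm of `k`
is the essential supremum on `ℝ`. -/
def dataBound (f f' k : ℝ → ℝ) (a b : ℝ) : ℝ :=
  max (max (supAbs f a b) (supAbs f' a b)) (eLpNorm k ⊤ volume).toReal

/-- The CFL condition, with `M` the bound of the data, `λ = Δt / Δx` and `μ` the value `μ(Δx)`. -/
def CFL (M β γ δ μ h τ : ℝ) : Prop :=
  max (2 * M + (τ / h) / 2) ((τ / h) / 2 * (1 + β * h ^ 2 / (γ * μ))) ≤ min (1 - δ) (β - δ)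

/-- `BV_loc(ℝ)`, for functions determined up to null sets. -/
def IsBVLoc (k : ℝ → ℝ) : Prop :=
  ∃ k' : ℝ → ℝ, LocallyBoundedVariationOn k' univ ∧ k =ᵐ[volume] k'

/-! ### The two entropy pairs for the flux `f(k, u) = k f(u)` -/

/-- `f(k, u) = k f(u)`. -/
def flux (f : ℝ → ℝ) (κ s : ℝ) : ℝ := κ * f s

def entropy₁ (c s : ℝ) : ℝ := s - c

def entropyFlux₁ (f : ℝ → ℝ) (c κ s : ℝ) : ℝ := flux f κ s - flux f κ c

def entropy₂ (f : ℝ → ℝ) (c κ s : ℝ) : ℝ := flux f κ s - flux f κ c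

/-- `∫_c^s (f_s(κ, θ))² dθ`, where `f_s(κ, θ) = κ f'(θ)`. -/
def entropyFlux₂ (f' : ℝ → ℝ) (c κ s : ℝ) : ℝ := ∫ θ in c..s, (κ * f' θ) ^ 2

/-! ### The spaces `H¹₀`, `H⁻¹` and compactness in `H⁻¹_loc` -/

/-- The jet `(φ, φ_x, φ_t)` of a test function. -/
def jetFun {Ω : Opens (ℝ × ℝ)} (φ : 𝓓(Ω, ℝ)) (p : ℝ × ℝ) : EuclideanSpace ℝ (Fin 3) :=
  !₂[φ p, (∂_{((1 : ℝ), (0 : ℝ))} φ : 𝓓(Ω, ℝ)) p, (∂_{((0 : ℝ), (1 : ℝ))} φ : 𝓓(Ω, ℝ)) p]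

theorem memLp_jetFun {Ω : Opens (ℝ × ℝ)} (φ : 𝓓(Ω, ℝ)) :
    MemLp (jetFun φ) 2 (volume : Measure (ℝ × ℝ)) := by
  have hφ : ∀ ψ : 𝓓(Ω, ℝ), MemLp (ψ : ℝ × ℝ → ℝ) 2 (volume : Measure (ℝ × ℝ)) := fun ψ =>
    ψ.continuous.memLp_of_hasCompactSupport ψ.hasCompactSupport
  rw [memLp_piLp_iff]
  intro i
  fin_cases i
  · exact hφ φ
  · exact hφ _
  · exact hφ _

/-- The jet as a linear map into `L²(ℝ²; ℝ³)`; the norm of the image of `φ` is the `H¹` norm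
`(∫ φ² + φ_x² + φ_t²)^{1/2}`. -/
def jet (Ω : Opens (ℝ × ℝ)) :
    𝓓(Ω, ℝ) →ₗ[ℝ] Lp (EuclideanSpace ℝ (Fin 3)) 2 (volume : Measure (ℝ × ℝ)) where
  toFun φ := (memLp_jetFun φ).toLp (jetFun φ)
  map_add' φ ψ := by
    rw [← MemLp.toLp_add]
    congr 1
    funext p
    ext i
    fin_cases i <;> simp [jetFun, LineDeriv.lineDerivOp_add]
  map_smul' r φ := by
    rw [RingHom.id_apply, ← MemLp.toLp_const_smul]
    congr 1
    funext p
    ext i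
    fin_cases i <;> simp [jetFun, LineDeriv.lineDerivOp_smul]

/-- `H¹₀(Ω)`: the closure of the test functions on `Ω` in the `H¹` norm. An element `v` is
represented by the triple `(v, v_x, v_t)`, extended by zero outside `Ω`. -/
def H10 (Ω : Opens (ℝ × ℝ)) :
    Submodule ℝ (Lp (EuclideanSpace ℝ (Fin 3)) 2 (volume : Measure (ℝ × ℝ))) :=
  (LinearMap.range (jet Ω)).topologicalClosure

/-- A test function as an element of `H¹₀(Ω)`. -/
def toH10 {Ω : Opens (ℝ × ℝ)} (φ : 𝓓(Ω, ℝ)) : H10 Ω :=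
  ⟨jet Ω φ, Submodule.le_topologicalClosure _ (LinearMap.mem_range_self _ φ)⟩

/-- `H⁻¹(Ω)`: the dual of `H¹₀(Ω)`, with the dual norm. -/
abbrev HNegOne (Ω : Opens (ℝ × ℝ)) : Type := StrongDual ℝ (H10 Ω)

/-- The family of distributions `L i` on `Ω₀` lies in a compact subset of `H⁻¹(Ω)` for each bounded
open `Ω ⊆ Ω₀`: the restriction of every `L i` to `Ω` extends to an element of a compact subset of
`H⁻¹(Ω)` that does not depend on `i`. (For `Ω₀ = ℝ × (0,T)` the sets `Ω` may touch the lines `t = 0`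
and `t = T`; this is compactness in `H⁻¹_loc(ℝ × [0,T])`.) -/
def IsCompactInHNegOneLoc {ι : Type*} (Ω₀ : Opens (ℝ × ℝ)) (L : ι → 𝓓'(Ω₀, ℝ)) : Prop :=
  ∀ Ω : Opens (ℝ × ℝ), Bornology.IsBounded (Ω : Set (ℝ × ℝ)) → Ω ≤ Ω₀ →
    ∃ K : Set (HNegOne Ω), IsCompact K ∧
      ∀ i, ∃ Λ ∈ K, ∀ φ : 𝓓(Ω, ℝ),
        Λ (toH10 φ) = L i (TestFunction.monoCLM ℝ φ)

/-- The distribution on `Ω` defined by a locally integrable function. -/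
def distOf (Ω : Opens (ℝ × ℝ)) (g : ℝ × ℝ → ℝ) : 𝓓'(Ω, ℝ) :=
  TestFunction.integralAgainstBilinCLM (ContinuousLinearMap.mul ℝ ℝ) volume g

/-- The distribution `η_t + q_x` on `Ω`. -/
def entropyProduction (Ω : Opens (ℝ × ℝ)) (η q : ℝ × ℝ → ℝ) : 𝓓'(Ω, ℝ) :=
  ∂_{((0 : ℝ), (1 : ℝ))} (distOf Ω η) + ∂_{((1 : ℝ), (0 : ℝ))} (distOf Ω q)

theorem entropyProduction_apply {Ω : Opens (ℝ × ℝ)} {η q : ℝ × ℝ → ℝ}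
    (hη : LocallyIntegrableOn η Ω volume) (hq : LocallyIntegrableOn q Ω volume) (φ : 𝓓(Ω, ℝ)) :
    entropyProduction Ω η q φ =
      -∫ p, (η p * (∂_{((0 : ℝ), (1 : ℝ))} φ : 𝓓(Ω, ℝ)) p
        + q p * (∂_{((1 : ℝ), (0 : ℝ))} φ : 𝓓(Ω, ℝ)) p) := by
  have key : ∀ {g : ℝ × ℝ → ℝ}, LocallyIntegrableOn g Ω volume → ∀ ψ : 𝓓(Ω, ℝ),
      distOf Ω g ψ = ∫ p, ψ p * g p := fun hg ψ =>
    TestFunction.integralAgainstBilinCLM_eq_integral hg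
  have int : ∀ {g : ℝ × ℝ → ℝ}, LocallyIntegrableOn g Ω volume → ∀ ψ : 𝓓(Ω, ℝ),
      Integrable (fun p => g p * ψ p) := fun hg ψ => by
    have := TestFunction.integrable_bilin (ContinuousLinearMap.mul ℝ ℝ) hg ψ
    simpa [mul_comm] using this
  rw [integral_add (int hη _) (int hq _)]
  change (∂_{((0 : ℝ), (1 : ℝ))} (distOf Ω η)) φ + (∂_{((1 : ℝ), (0 : ℝ))} (distOf Ω q)) φ = _
  rw [Distribution.lineDerivOp_apply_apply, Distribution.lineDerivOp_apply_apply, map_neg, map_neg,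
    key hη, key hq, neg_add]
  simp only [mul_comm]

/-- The open strip `ℝ × (0, T)`. -/
def strip (T : ℝ) : Opens (ℝ × ℝ) := ⟨univ ×ˢ Ioo 0 T, isOpen_univ.prod isOpen_Ioo⟩

end DDScheme

end

namespace DDScheme

/-! ### Calculus on rectangles -/

/-! The entropy production η_t + q_x of the approximations, tested with φ, is bounded by α_m ‖∇φ‖₂ +
C ‖φ‖_∞ with α_m → 0: one part tends to zero in the dual of H¹₀, the other is bounded as a measure.
Since η and q are also uniformly bounded, an argument in the spirit of Murat's lemma gives
compactness.

Energy. Put r = Δt/Δx, a = γμ/Δx² and w = uⁿ⁺¹ - uⁿ, and let Δ stand for an undivided space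
difference. Testing the scheme with a cutoff times uⁿ controls the growth of ½u² + ½a(Δu)². The
Engquist–Osher flux times the jump of u is at most κ times the jump of a primitive F of f, so the
viscous term -rβ(Δu)² survives. The explicit time step costs ½(w² + a(Δw)²). Testing with w, the
dispersion absorbs its cross term with the viscosity at the price (rβ)²/a, and the CFL condition
leaves the fraction δ of the viscous term. A discrete maximum principle gives |w| ≤ Cr, so
differences that fall on the cutoff cost only O(Δx) per point. The outcome is `energy_estimate`.

Production. On each cell the derivatives of φ integrate to differences of edge integrals. Summation
by parts moves the differences to η and q. Edge integrals are replaced by cell averages of φ, and η,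
q by their first order expansions with slope v, the grid version of the derivative of η in u. The
leading terms cancel by the scheme, up to a flux containing viscosity, dispersion and the defect of
the numerical flux; it is again summed by parts. What is left is either quadratic in the increments,
or linear in the jumps of κ, and paired with φ (the measure part), or linear in the increments and
paired with ∇φ (the part of size √Δx ‖∇φ‖₂). This is `production_density_le` and `production_bound`;
replacing κ by k itself costs another √Δx ‖∇φ‖₂.

Compactness. In a Hilbert space it suffices that the functionals, for large m, are small on the
annihilator of finitely many functionals (`totallyBounded_range_of_small_on_annihilator`). The
finitely many functionals are cell averages: where they vanish, Poincaré's inequality makes ‖φ‖₂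
small against ‖φ‖_{H¹}. Truncating φ to ψ = κ arctan(φ/κ), with κ here a truncation level, makes the
measure term at most 2Cκ, and the error is controlled through |∇(φ - ψ)| ≤ |∇φ| |φ|/κ and the
uniform bound of η and q. Both are small relative to ‖φ‖_{H¹} for a level κ proportional to that
norm. -/

theorem integrableOn_rect {F : ℝ × ℝ → ℝ} (hF : Continuous F) (x₀ x₁ t₀ t₁ : ℝ) :
    IntegrableOn F (Ico x₀ x₁ ×ˢ Ico t₀ t₁) := by
  refine IntegrableOn.mono_set (t := Icc x₀ x₁ ×ˢ Icc t₀ t₁) ?_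
    (prod_mono Ico_subset_Icc_self Ico_subset_Icc_self)
  exact hF.continuousOn.integrableOn_compact (isCompact_Icc.prod isCompact_Icc)

theorem setIntegral_rect {F : ℝ × ℝ → ℝ} (hF : Continuous F) {x₀ x₁ t₀ t₁ : ℝ}
    (hx : x₀ ≤ x₁) (ht : t₀ ≤ t₁) :
    ∫ p in Ico x₀ x₁ ×ˢ Ico t₀ t₁, F p = ∫ x in x₀..x₁, ∫ t in t₀..t₁, F (x, t) := by
  have h := integrableOn_rect hF x₀ x₁ t₀ t₁
  rw [Measure.volume_eq_prod] at h ⊢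
  rw [setIntegral_prod _ h, integral_Ico_eq_integral_Ioc, intervalIntegral.integral_of_le hx]
  refine setIntegral_congr_fun measurableSet_Ioc fun x _ => ?_
  rw [integral_Ico_eq_integral_Ioc, intervalIntegral.integral_of_le ht]

theorem setIntegral_rect_swap (F : ℝ × ℝ → ℝ) (x₀ x₁ t₀ t₁ : ℝ) :
    ∫ p in Ico x₀ x₁ ×ˢ Ico t₀ t₁, F p = ∫ p in Ico t₀ t₁ ×ˢ Ico x₀ x₁, F p.swap := by
  rw [Measure.volume_eq_prod, setIntegral_prod_swap]

theorem setIntegral_rect' {F : ℝ × ℝ → ℝ} (hF : Continuous F) {x₀ x₁ t₀ t₁ : ℝ}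
    (hx : x₀ ≤ x₁) (ht : t₀ ≤ t₁) :
    ∫ p in Ico x₀ x₁ ×ˢ Ico t₀ t₁, F p = ∫ t in t₀..t₁, ∫ x in x₀..x₁, F (x, t) := by
  rw [setIntegral_rect_swap]
  exact setIntegral_rect (hF.comp continuous_swap) ht hx

/-- The partial derivative in the first variable. -/
noncomputable def partialX (φ : ℝ × ℝ → ℝ) (p : ℝ × ℝ) : ℝ := fderiv ℝ φ p (1, 0)

/-- The partial derivative in the second variable. -/
noncomputable def partialT (φ : ℝ × ℝ → ℝ) (p : ℝ × ℝ) : ℝ := fderiv ℝ φ p (0, 1)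

section

variable {φ : ℝ × ℝ → ℝ}

theorem continuous_partialX (hφ : ContDiff ℝ 1 φ) : Continuous (partialX φ) :=
  (hφ.continuous_fderiv one_ne_zero).clm_apply continuous_const

theorem continuous_partialT (hφ : ContDiff ℝ 1 φ) : Continuous (partialT φ) :=
  (hφ.continuous_fderiv one_ne_zero).clm_apply continuous_const

theorem hasDerivAt_partialX (hφ : ContDiff ℝ 1 φ) (x t : ℝ) :
    HasDerivAt (fun y => φ (y, t)) (partialX φ (x, t)) x := by
  have h1 : HasFDerivAt φ (fderiv ℝ φ (x, t)) (x, t) :=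
    (hφ.differentiable one_ne_zero _).hasFDerivAt
  have h2 : HasDerivAt (fun y : ℝ => (y, t)) ((1 : ℝ), (0 : ℝ)) x :=
    (hasDerivAt_id x).prodMk (hasDerivAt_const x t)
  exact h1.comp_hasDerivAt x h2

theorem hasDerivAt_partialT (hφ : ContDiff ℝ 1 φ) (x t : ℝ) :
    HasDerivAt (fun s => φ (x, s)) (partialT φ (x, t)) t := by
  have h1 : HasFDerivAt φ (fderiv ℝ φ (x, t)) (x, t) :=
    (hφ.differentiable one_ne_zero _).hasFDerivAt
  have h2 : HasDerivAt (fun s : ℝ => (x, s)) ((0 : ℝ), (1 : ℝ)) t :=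
    (hasDerivAt_const t x).prodMk (hasDerivAt_id t)
  exact h1.comp_hasDerivAt t h2

theorem integral_partialX (hφ : ContDiff ℝ 1 φ) (x₀ x₁ t : ℝ) :
    ∫ x in x₀..x₁, partialX φ (x, t) = φ (x₁, t) - φ (x₀, t) :=
  intervalIntegral.integral_eq_sub_of_hasDerivAt (fun x _ => hasDerivAt_partialX hφ x t)
    (((continuous_partialX hφ).comp (by fun_prop : Continuous fun x => (x, t))).intervalIntegrable
      _ _)

theorem integral_partialT (hφ : ContDiff ℝ 1 φ) (x t₀ t₁ : ℝ) :
    ∫ t in t₀..t₁, partialT φ (x, t) = φ (x, t₁) - φ (x, t₀) :=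
  intervalIntegral.integral_eq_sub_of_hasDerivAt (fun t _ => hasDerivAt_partialT hφ x t)
    (((continuous_partialT hφ).comp (by fun_prop : Continuous fun t => (x, t))).intervalIntegrable
      _ _)

theorem setIntegral_rect_partialT (hφ : ContDiff ℝ 1 φ) {x₀ x₁ t₀ t₁ : ℝ}
    (hx : x₀ ≤ x₁) (ht : t₀ ≤ t₁) :
    ∫ p in Ico x₀ x₁ ×ˢ Ico t₀ t₁, partialT φ p
      = (∫ x in x₀..x₁, φ (x, t₁)) - ∫ x in x₀..x₁, φ (x, t₀) := by
  have hc := hφ.continuous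
  rw [setIntegral_rect (continuous_partialT hφ) hx ht, ← intervalIntegral.integral_sub]
  · exact intervalIntegral.integral_congr fun x _ => integral_partialT hφ x t₀ t₁
  all_goals exact Continuous.intervalIntegrable (by fun_prop) _ _

theorem setIntegral_rect_partialX (hφ : ContDiff ℝ 1 φ) {x₀ x₁ t₀ t₁ : ℝ}
    (hx : x₀ ≤ x₁) (ht : t₀ ≤ t₁) :
    ∫ p in Ico x₀ x₁ ×ˢ Ico t₀ t₁, partialX φ p
      = (∫ t in t₀..t₁, φ (x₁, t)) - ∫ t in t₀..t₁, φ (x₀, t) := by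
  have hc := hφ.continuous
  rw [setIntegral_rect' (continuous_partialX hφ) hx ht, ← intervalIntegral.integral_sub]
  · exact intervalIntegral.integral_congr fun t _ => integral_partialX hφ x₀ x₁ t
  all_goals exact Continuous.intervalIntegrable (by fun_prop) _ _

/-- The oscillation of a function on an interval is at most the integral of the absolute value of
its derivative. -/
theorem abs_sub_le_integral_abs_deriv {g g' : ℝ → ℝ} (hg : ∀ x, HasDerivAt g (g' x) x)
    (hg' : Continuous g') {p q x y : ℝ} (hx : x ∈ Icc p q) (hy : y ∈ Icc p q) :
    |g x - g y| ≤ ∫ z in p..q, |g' z| := by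
  wlog h : y ≤ x generalizing x y
  · rw [abs_sub_comm]
    exact this hy hx (le_of_not_ge h)
  rw [← intervalIntegral.integral_eq_sub_of_hasDerivAt (fun x _ => hg x)
    (hg'.intervalIntegrable y x)]
  calc |∫ z in y..x, g' z| ≤ ∫ z in y..x, |g' z| :=
        intervalIntegral.abs_integral_le_integral_abs h
    _ ≤ ∫ z in p..q, |g' z| :=
        intervalIntegral.integral_mono_interval hy.1 h hx.2
          (Eventually.of_forall fun _ => abs_nonneg _) (hg'.abs.intervalIntegrable _ _)

/-- The oscillation bound, integrated over the interval. -/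
theorem abs_average_sub_le {g g' : ℝ → ℝ} (hg : ∀ x, HasDerivAt g (g' x) x)
    (hg' : Continuous g') {p q x : ℝ} (hx : x ∈ Icc p q) :
    |(∫ y in p..q, g y) - (q - p) * g x| ≤ (q - p) * ∫ z in p..q, |g' z| := by
  have hpq : p ≤ q := hx.1.trans hx.2
  have hgc : Continuous g := continuous_iff_continuousAt.2 fun x => (hg x).continuousAt
  have e : (∫ y in p..q, g y) - (q - p) * g x = ∫ y in p..q, (g y - g x) := by
    rw [intervalIntegral.integral_sub (hgc.intervalIntegrable _ _) (by simp)]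
    simp
  rw [e]
  have := intervalIntegral.norm_integral_le_of_norm_le_const (a := p) (b := q)
    (f := fun y => g y - g x) (C := ∫ z in p..q, |g' z|) fun y hy => by
      rw [uIoc_of_le hpq] at hy
      exact abs_sub_le_integral_abs_deriv hg hg' (Ioc_subset_Icc_self hy) hx
  rw [abs_of_nonneg (by linarith : 0 ≤ q - p)] at this
  rw [Real.norm_eq_abs] at this
  linarith

/-- Integrating the one-dimensional estimate over t. With x at an end of the interval this compares
an edge integral of a cell with the cell average. -/
theorem abs_rect_sub_slice_x (hφ : ContDiff ℝ 1 φ) {x₀ x₁ t₀ t₁ x : ℝ} (hx : x ∈ Icc x₀ x₁)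
    (ht : t₀ ≤ t₁) :
    |(∫ p in Ico x₀ x₁ ×ˢ Ico t₀ t₁, φ p) - (x₁ - x₀) * ∫ t in t₀..t₁, φ (x, t)|
      ≤ (x₁ - x₀) * ∫ p in Ico x₀ x₁ ×ˢ Ico t₀ t₁, |partialX φ p| := by
  have hx01 : x₀ ≤ x₁ := hx.1.trans hx.2
  have hc := hφ.continuous
  have hc' := continuous_partialX hφ
  rw [setIntegral_rect' hc hx01 ht, setIntegral_rect' hc'.abs hx01 ht,
    ← intervalIntegral.integral_const_mul, ← intervalIntegral.integral_const_mul,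
    ← intervalIntegral.integral_sub]
  · refine (intervalIntegral.abs_integral_le_integral_abs ht).trans
      (intervalIntegral.integral_mono_on ht ?_ ?_ fun t _ => ?_)
    · refine Continuous.intervalIntegrable ?_ _ _
      exact (Continuous.sub (intervalIntegral.continuous_parametric_intervalIntegral_of_continuous'
        (by fun_prop) _ _) (by fun_prop)).abs
    · refine Continuous.intervalIntegrable ?_ _ _
      exact continuous_const.mul
        (intervalIntegral.continuous_parametric_intervalIntegral_of_continuous' (by fun_prop) _ _)
    · exact abs_average_sub_le (fun y => hasDerivAt_partialX hφ y t) (by fun_prop) hx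
  · refine Continuous.intervalIntegrable ?_ _ _
    exact intervalIntegral.continuous_parametric_intervalIntegral_of_continuous' (by fun_prop) _ _
  · exact Continuous.intervalIntegrable (by fun_prop) _ _

theorem abs_rect_sub_slice_t (hφ : ContDiff ℝ 1 φ) {x₀ x₁ t₀ t₁ t : ℝ} (hx : x₀ ≤ x₁)
    (ht : t ∈ Icc t₀ t₁) :
    |(∫ p in Ico x₀ x₁ ×ˢ Ico t₀ t₁, φ p) - (t₁ - t₀) * ∫ x in x₀..x₁, φ (x, t)|
      ≤ (t₁ - t₀) * ∫ p in Ico x₀ x₁ ×ˢ Ico t₀ t₁, |partialT φ p| := by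
  have ht01 : t₀ ≤ t₁ := ht.1.trans ht.2
  have hc := hφ.continuous
  have hc' := continuous_partialT hφ
  rw [setIntegral_rect hc hx ht01, setIntegral_rect hc'.abs hx ht01,
    ← intervalIntegral.integral_const_mul, ← intervalIntegral.integral_const_mul,
    ← intervalIntegral.integral_sub]
  · refine (intervalIntegral.abs_integral_le_integral_abs hx).trans
      (intervalIntegral.integral_mono_on hx ?_ ?_ fun x _ => ?_)
    · refine Continuous.intervalIntegrable ?_ _ _
      exact (Continuous.sub (intervalIntegral.continuous_parametric_intervalIntegral_of_continuous'
        (by fun_prop) _ _) (by fun_prop)).abs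
    · refine Continuous.intervalIntegrable ?_ _ _
      exact continuous_const.mul
        (intervalIntegral.continuous_parametric_intervalIntegral_of_continuous' (by fun_prop) _ _)
    · exact abs_average_sub_le (fun y => hasDerivAt_partialT hφ x y) (by fun_prop) ht
  · refine Continuous.intervalIntegrable ?_ _ _
    exact intervalIntegral.continuous_parametric_intervalIntegral_of_continuous' (by fun_prop) _ _
  · exact Continuous.intervalIntegrable (by fun_prop) _ _

/-- Cauchy–Schwarz against the constant 1, read off from the nonnegativity of the integral of (g -
m)² with m the mean of g. -/
theorem sq_setIntegral_le {α : Type*} [MeasurableSpace α] {ν : Measure α} {s : Set α} {g : α → ℝ}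
    (hs : ν s ≠ ⊤) (hg : IntegrableOn g s ν) (hg2 : IntegrableOn (fun x => g x ^ 2) s ν) :
    (∫ x in s, g x ∂ν) ^ 2 ≤ ν.real s * ∫ x in s, g x ^ 2 ∂ν := by
  by_cases h0 : ν.real s = 0
  · have : ν.restrict s = 0 := by
      rw [Measure.restrict_eq_zero]
      exact (measureReal_eq_zero_iff hs).1 h0
    simp [this]
  have hpos : 0 < ν.real s := lt_of_le_of_ne measureReal_nonneg (Ne.symm h0)
  set m := (∫ x in s, g x ∂ν) / ν.real s with hm
  have hc : IntegrableOn (fun _ : α => m ^ 2) s ν := integrableOn_const hs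
  have key : 0 ≤ ∫ x in s, (g x ^ 2 - 2 * m * g x + m ^ 2) ∂ν :=
    integral_nonneg fun x => by
      have := sq_nonneg (g x - m)
      simp only [Pi.zero_apply]
      nlinarith
  have hg3 : IntegrableOn (fun x => g x ^ 2 - 2 * m * g x) s ν := hg2.sub (hg.const_mul (2 * m))
  rw [integral_add hg3 hc, integral_sub hg2 (hg.const_mul (2 * m)),
    integral_const_mul, setIntegral_const, smul_eq_mul] at key
  have e : (∫ x in s, g x ∂ν) = m * ν.real s := by rw [hm]; field_simp
  rw [e] at key ⊢
  nlinarith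

theorem measureReal_rect {x₀ x₁ t₀ t₁ : ℝ} (hx : x₀ ≤ x₁) (ht : t₀ ≤ t₁) :
    (volume : Measure (ℝ × ℝ)).real (Ico x₀ x₁ ×ˢ Ico t₀ t₁) = (x₁ - x₀) * (t₁ - t₀) := by
  rw [Measure.volume_eq_prod, measureReal_prod_prod, Real.volume_real_Ico_of_le hx,
    Real.volume_real_Ico_of_le ht]

theorem sq_setIntegral_rect_le {g : ℝ × ℝ → ℝ} (hg : Continuous g) {x₀ x₁ t₀ t₁ : ℝ}
    (hx : x₀ ≤ x₁) (ht : t₀ ≤ t₁) :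
    (∫ p in Ico x₀ x₁ ×ˢ Ico t₀ t₁, |g p|) ^ 2
      ≤ (x₁ - x₀) * (t₁ - t₀) * ∫ p in Ico x₀ x₁ ×ˢ Ico t₀ t₁, g p ^ 2 := by
  have h := sq_setIntegral_le (ν := volume) (s := Ico x₀ x₁ ×ˢ Ico t₀ t₁) (g := fun p => |g p|)
    ?_ (integrableOn_rect hg.abs _ _ _ _) (integrableOn_rect (hg.abs.pow 2) _ _ _ _)
  · simpa only [sq_abs, measureReal_rect hx ht] using h
  · rw [Measure.volume_eq_prod, Measure.prod_prod]
    simp [ENNReal.mul_eq_top]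

/-- A Poincaré inequality on rectangles. -/
theorem poincare_rect (hφ : ContDiff ℝ 1 φ) {x₀ x₁ t₀ t₁ : ℝ} (hx : x₀ < x₁) (ht : t₀ < t₁) :
    ∫ p in Ico x₀ x₁ ×ˢ Ico t₀ t₁, φ p ^ 2
      ≤ 3 * ((x₁ - x₀) ^ 2 * (∫ p in Ico x₀ x₁ ×ˢ Ico t₀ t₁, partialX φ p ^ 2)
        + (t₁ - t₀) ^ 2 * (∫ p in Ico x₀ x₁ ×ˢ Ico t₀ t₁, partialT φ p ^ 2)
        + (∫ p in Ico x₀ x₁ ×ˢ Ico t₀ t₁, φ p) ^ 2 / ((x₁ - x₀) * (t₁ - t₀))) := by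
  have hc := hφ.continuous
  have hcX := continuous_partialX hφ
  have hcT := continuous_partialT hφ
  set Φ := ∫ p in Ico x₀ x₁ ×ˢ Ico t₀ t₁, φ p with hΦ
  set Y := ∫ p in Ico x₀ x₁ ×ˢ Ico t₀ t₁, |partialT φ p| with hY
  set a := x₁ - x₀ with ha
  set b := t₁ - t₀ with hb
  have ha0 : 0 < a := sub_pos.2 hx
  have hb0 : 0 < b := sub_pos.2 ht
  set W : ℝ → ℝ := fun t => ∫ x in x₀..x₁, partialX φ (x, t) ^ 2 with hW
  have hWc : Continuous W :=
    intervalIntegral.continuous_parametric_intervalIntegral_of_continuous' (by fun_prop) _ _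
  have hWi : ∫ t in t₀..t₁, W t = ∫ p in Ico x₀ x₁ ×ˢ Ico t₀ t₁, partialX φ p ^ 2 :=
    (setIntegral_rect' (hcX.pow 2) hx.le ht.le).symm
  -- Write φ(x,t) as its deviation from the mean in x at time t, plus the deviation of that mean
  -- from the mean over the rectangle, plus the latter. The first is bounded through φ_x on the
  -- slice, the second through φ_t on the rectangle.
  have pt : ∀ t ∈ Icc t₀ t₁, ∀ x ∈ Icc x₀ x₁,
      φ (x, t) ^ 2 ≤ 3 * (a * W t + Y ^ 2 / a ^ 2 + Φ ^ 2 / (a * b) ^ 2) := by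
    intro t htm x hxm
    have h1 := abs_average_sub_le (fun y => hasDerivAt_partialX hφ y t) (by fun_prop) hxm
    have h2 := abs_rect_sub_slice_t hφ hx.le htm
    rw [← hΦ, ← hY, ← hb] at h2
    rw [← ha] at h1
    set S := ∫ y in x₀..x₁, φ (y, t)
    set X := ∫ z in x₀..x₁, |partialX φ (z, t)|
    have hX2 : X ^ 2 ≤ a * W t := by
      have := sq_setIntegral_le (ν := volume) (s := Ioc x₀ x₁)
        (g := fun z => |partialX φ (z, t)|) (by simp)
        (Continuous.integrableOn_Ioc (by fun_prop)) (Continuous.integrableOn_Ioc (by fun_prop))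
      simp only [sq_abs, Real.volume_real_Ioc_of_le hx.le] at this
      rwa [← intervalIntegral.integral_of_le hx.le, ← intervalIntegral.integral_of_le hx.le] at this
    have e : φ (x, t) = (-(S - a * φ (x, t)) / a) + (-(Φ - b * S) / (a * b)) + Φ / (a * b) := by
      field_simp
      ring
    have b1 : (-(S - a * φ (x, t)) / a) ^ 2 ≤ X ^ 2 := by
      rw [div_pow, neg_sq, div_le_iff₀ (by positivity), ← sq_abs (S - _), ← mul_pow]
      exact pow_le_pow_left₀ (abs_nonneg _) (by linarith) 2
    have b2 : (-(Φ - b * S) / (a * b)) ^ 2 ≤ Y ^ 2 / a ^ 2 := by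
      rw [div_pow, neg_sq, div_le_div_iff₀ (by positivity) (by positivity), ← sq_abs (Φ - _),
        ← mul_pow, ← mul_pow]
      refine pow_le_pow_left₀ (by positivity) ?_ 2
      nlinarith
    rw [← div_pow Φ]
    generalize -(S - a * φ (x, t)) / a = A at e b1
    generalize -(Φ - b * S) / (a * b) = B at e b2
    rw [e]
    nlinarith [sq_nonneg (A - B), sq_nonneg (A - Φ / (a * b)), sq_nonneg (B - Φ / (a * b))]
  have hY2 : Y ^ 2 ≤ a * b * ∫ p in Ico x₀ x₁ ×ˢ Ico t₀ t₁, partialT φ p ^ 2 :=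
    sq_setIntegral_rect_le hcT hx.le ht.le
  calc ∫ p in Ico x₀ x₁ ×ˢ Ico t₀ t₁, φ p ^ 2
      = ∫ t in t₀..t₁, ∫ x in x₀..x₁, φ (x, t) ^ 2 := setIntegral_rect' (hc.pow 2) hx.le ht.le
    _ ≤ ∫ t in t₀..t₁, ∫ _x in x₀..x₁, 3 * (a * W t + Y ^ 2 / a ^ 2 + Φ ^ 2 / (a * b) ^ 2) := by
        refine intervalIntegral.integral_mono_on ht.le ?_ ?_ fun t htm => ?_
        · exact (intervalIntegral.continuous_parametric_intervalIntegral_of_continuous'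
            (by fun_prop) _ _).intervalIntegrable _ _
        · simp only [intervalIntegral.integral_const, smul_eq_mul]
          exact Continuous.intervalIntegrable (by fun_prop) _ _
        · exact intervalIntegral.integral_mono_on hx.le
            (Continuous.intervalIntegrable (by fun_prop) _ _) (by simp) (pt t htm)
    _ = a * (3 * (a * (∫ t in t₀..t₁, W t) + b * (Y ^ 2 / a ^ 2 + Φ ^ 2 / (a * b) ^ 2))) := by
        simp only [intervalIntegral.integral_const, smul_eq_mul]
        have : ∀ t, (x₁ - x₀) * (3 * (a * W t + Y ^ 2 / a ^ 2 + Φ ^ 2 / (a * b) ^ 2))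
            = 3 * a ^ 2 * W t + 3 * a * (Y ^ 2 / a ^ 2 + Φ ^ 2 / (a * b) ^ 2) := fun t => by
          rw [← ha]; ring
        simp only [this]
        rw [intervalIntegral.integral_add (Continuous.intervalIntegrable (by fun_prop) _ _)
          (by simp), intervalIntegral.integral_const_mul, intervalIntegral.integral_const,
          smul_eq_mul, ← hb]
        ring
    _ ≤ _ := by
        rw [hWi]
        have e1 : a * (b * (Y ^ 2 / a ^ 2)) ≤
            b ^ 2 * ∫ p in Ico x₀ x₁ ×ˢ Ico t₀ t₁, partialT φ p ^ 2 := by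
          have : a * (b * (Y ^ 2 / a ^ 2)) = (b / a) * Y ^ 2 := by field_simp
          rw [this]
          refine (mul_le_mul_of_nonneg_left hY2 (by positivity)).trans_eq ?_
          field_simp
        have e2 : a * (b * (Φ ^ 2 / (a * b) ^ 2)) = Φ ^ 2 / (a * b) := by field_simp
        nlinarith
end

/-! ### The grid and the discretization of a test function -/

/-- The cell `[x_{j-1/2}, x_{j+1/2}) × [tⁿ, tⁿ⁺¹)`. -/
def cell (h τ : ℝ) (n : ℕ) (j : ℤ) : Set (ℝ × ℝ) :=
  Ico (((j : ℝ) - 1 / 2) * h) (((j : ℝ) + 1 / 2) * h) ×ˢ Ico ((n : ℝ) * τ) (((n : ℝ) + 1) * τ)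

theorem measurableSet_cell (h τ : ℝ) (n : ℕ) (j : ℤ) : MeasurableSet (cell h τ n j) :=
  measurableSet_Ico.prod measurableSet_Ico

section

variable {h τ : ℝ}

theorem cell_left_le (hh : 0 < h) (j : ℤ) : ((j : ℝ) - 1 / 2) * h ≤ ((j : ℝ) + 1 / 2) * h := by
  nlinarith

theorem cell_bot_le (hτ : 0 < τ) (n : ℕ) : (n : ℝ) * τ ≤ ((n : ℝ) + 1) * τ := by
  nlinarith

theorem floor_eq_of_mem_cell (hh : 0 < h) (hτ : 0 < τ) {n : ℕ} {j : ℤ} {p : ℝ × ℝ}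
    (hp : p ∈ cell h τ n j) : ⌊p.2 / τ⌋₊ = n ∧ ⌊p.1 / h + 1 / 2⌋ = j := by
  obtain ⟨⟨h1, h2⟩, h3, h4⟩ := hp
  have ht : 0 ≤ p.2 := le_trans (by positivity) h3
  constructor
  · rw [Nat.floor_eq_iff (by positivity)]
    exact ⟨by rwa [le_div_iff₀ hτ], by rwa [div_lt_iff₀ hτ]⟩
  · rw [Int.floor_eq_iff]
    rw [← le_div_iff₀ hh] at h1
    rw [← div_lt_iff₀ hh] at h2
    constructor <;> linarith

theorem mem_cell_floor (hh : 0 < h) (hτ : 0 < τ) {p : ℝ × ℝ} (hp : 0 ≤ p.2) :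
    p ∈ cell h τ ⌊p.2 / τ⌋₊ ⌊p.1 / h + 1 / 2⌋ := by
  have h1 := Int.floor_le (p.1 / h + 1 / 2)
  have h2 := Int.lt_floor_add_one (p.1 / h + 1 / 2)
  have h3 := Nat.floor_le (div_nonneg hp hτ.le)
  have h4 := Nat.lt_floor_add_one (p.2 / τ)
  refine ⟨⟨?_, ?_⟩, ?_, ?_⟩
  · rw [← le_div_iff₀ hh]; linarith
  · rw [← div_lt_iff₀ hh]; linarith
  · rwa [← le_div_iff₀ hτ]
  · rwa [← div_lt_iff₀ hτ]

theorem pairwise_disjoint_cell (hh : 0 < h) (hτ : 0 < τ) (s : Set (ℕ × ℤ)) :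
    s.Pairwise (Function.onFun Disjoint fun i : ℕ × ℤ => cell h τ i.1 i.2) := by
  intro i _ i' _ hne
  refine Set.disjoint_left.2 fun p hp hp' => hne ?_
  have h1 := floor_eq_of_mem_cell hh hτ hp
  have h2 := floor_eq_of_mem_cell hh hτ hp'
  exact Prod.ext (h1.1.symm.trans h2.1) (h1.2.symm.trans h2.2)

theorem measureReal_cell (hh : 0 < h) (hτ : 0 < τ) (n : ℕ) (j : ℤ) :
    (volume : Measure (ℝ × ℝ)).real (cell h τ n j) = h * τ := by
  rw [cell, measureReal_rect (cell_left_le hh j) (cell_bot_le hτ n)]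
  ring

theorem integrableOn_cell {F : ℝ × ℝ → ℝ} (hF : Continuous F) (n : ℕ) (j : ℤ) :
    IntegrableOn F (cell h τ n j) :=
  integrableOn_rect hF _ _ _ _

/-- Splitting an integral into integrals over the cells of the grid. -/
theorem integral_eq_sum_cell (hh : 0 < h) (hτ : 0 < τ) {N : ℕ} {A : Finset ℤ} {g : ℝ × ℝ → ℝ}
    (hg : ∀ n j, IntegrableOn g (cell h τ n j))
    (hsupp : ∀ p, g p ≠ 0 → ∃ n < N, ∃ j ∈ A, p ∈ cell h τ n j) :
    ∫ p, g p = ∑ n ∈ Finset.range N, ∑ j ∈ A, ∫ p in cell h τ n j, g p := by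
  rw [← Finset.sum_product' (f := fun n j => ∫ p in cell h τ n j, g p),
    ← integral_biUnion_finset (s := fun i : ℕ × ℤ => cell h τ i.1 i.2) _
      (fun i _ => measurableSet_cell _ _ _ _) (pairwise_disjoint_cell hh hτ _)
      (fun i _ => hg _ _)]
  symm
  refine setIntegral_eq_integral_of_forall_compl_eq_zero fun p hp => ?_
  by_contra h0
  obtain ⟨n, hn, j, hj, hpj⟩ := hsupp p h0
  exact hp (mem_iUnion₂.2 ⟨(n, j), by simp [hn, hj], hpj⟩)

theorem sum_cell_le_integral (hh : 0 < h) (hτ : 0 < τ) (N : ℕ) (A : Finset ℤ) {g : ℝ × ℝ → ℝ}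
    (hg : Integrable g) (hg0 : ∀ p, 0 ≤ g p) :
    ∑ n ∈ Finset.range N, ∑ j ∈ A, ∫ p in cell h τ n j, g p ≤ ∫ p, g p := by
  rw [← Finset.sum_product' (f := fun n j => ∫ p in cell h τ n j, g p),
    ← integral_biUnion_finset (s := fun i : ℕ × ℤ => cell h τ i.1 i.2) _
      (fun i _ => measurableSet_cell _ _ _ _) (pairwise_disjoint_cell hh hτ _)
      (fun i _ => hg.integrableOn)]
  exact setIntegral_le_integral hg (Eventually.of_forall hg0)

end

/-- Discrete data that come from a test function on the strip `0 < t < N τ` with `|φ| ≤ S` and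
`‖φ_x‖₂, ‖φ_t‖₂ ≤ D`: the integrals `a`, `b` over the horizontal and the vertical edges of the
cells, the cell averages `ψ`, and the integrals `α`, `ξ` of `|φ_t|`, `|φ_x|` over the cells. -/
structure IsGridTest (h τ D S : ℝ) (N : ℕ) (J : ℤ) (a b ψ α ξ : ℕ → ℤ → ℝ) : Prop where
  bot : ∀ j, a 0 j = 0
  top : ∀ j, a N j = 0
  edge_t : ∀ n j, |a (n + 1) j - h * ψ n j| ≤ α n j
  edge_left : ∀ n j, |b n j - τ * ψ n j| ≤ ξ n j
  edge_right : ∀ n j, |b n (j + 1) - τ * ψ n j| ≤ ξ n j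
  supp_b : ∀ n j, J ≤ |j| → b n j = 0
  supp_b_succ : ∀ n, b n (J + 1) = 0
  supp_ψ : ∀ n j, J ≤ |j| → ψ n j = 0
  bound : ∀ n j, |ψ n j| ≤ S
  sum_t : ∀ A : Finset ℤ, ∑ n ∈ Finset.range N, ∑ j ∈ A, α n j ^ 2 ≤ h * τ * D ^ 2
  sum_x : ∀ A : Finset ℤ, ∑ n ∈ Finset.range N, ∑ j ∈ A, ξ n j ^ 2 ≤ h * τ * D ^ 2

section

variable {h τ : ℝ} {φ : ℝ × ℝ → ℝ}

/-- The integral of `φ` over the lower edge of a cell. -/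
noncomputable def edgeT (h τ : ℝ) (φ : ℝ × ℝ → ℝ) (n : ℕ) (j : ℤ) : ℝ :=
  ∫ x in (((j : ℝ) - 1 / 2) * h)..(((j : ℝ) + 1 / 2) * h), φ (x, (n : ℝ) * τ)

/-- The integral of `φ` over the left edge of a cell. -/
noncomputable def edgeX (h τ : ℝ) (φ : ℝ × ℝ → ℝ) (n : ℕ) (j : ℤ) : ℝ :=
  ∫ t in ((n : ℝ) * τ)..(((n : ℝ) + 1) * τ), φ (((j : ℝ) - 1 / 2) * h, t)

theorem setIntegral_cell_partialT (hφ : ContDiff ℝ 1 φ) (hh : 0 < h) (hτ : 0 < τ) (n : ℕ) (j : ℤ) :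
    ∫ p in cell h τ n j, partialT φ p = edgeT h τ φ (n + 1) j - edgeT h τ φ n j := by
  rw [cell, setIntegral_rect_partialT hφ (cell_left_le hh j) (cell_bot_le hτ n), edgeT, edgeT]
  push_cast
  rfl

theorem setIntegral_cell_partialX (hφ : ContDiff ℝ 1 φ) (hh : 0 < h) (hτ : 0 < τ) (n : ℕ) (j : ℤ) :
    ∫ p in cell h τ n j, partialX φ p = edgeX h τ φ n (j + 1) - edgeX h τ φ n j := by
  rw [cell, setIntegral_rect_partialX hφ (cell_left_le hh j) (cell_bot_le hτ n), edgeX, edgeX]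
  push_cast
  congr 4
  ext t
  congr 2
  ring

theorem sq_integral_abs_cell_le {g : ℝ × ℝ → ℝ} (hg : Continuous g) (hh : 0 < h) (hτ : 0 < τ)
    (n : ℕ) (j : ℤ) :
    (∫ p in cell h τ n j, |g p|) ^ 2 ≤ h * τ * ∫ p in cell h τ n j, g p ^ 2 := by
  have := sq_setIntegral_rect_le hg (cell_left_le hh j) (cell_bot_le hτ n)
  rwa [show (((j : ℝ) + 1 / 2) * h - ((j : ℝ) - 1 / 2) * h) * (((n : ℝ) + 1) * τ - n * τ) = h * τ by
    ring] at this

theorem sum_sq_cell_le {g : ℝ × ℝ → ℝ} (hg : Continuous g)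
    (hgs : HasCompactSupport g) (hh : 0 < h) (hτ : 0 < τ) {D : ℝ} (hD : ∫ p, g p ^ 2 ≤ D ^ 2)
    (N : ℕ) (A : Finset ℤ) :
    ∑ n ∈ Finset.range N, ∑ j ∈ A, (∫ p in cell h τ n j, |g p|) ^ 2 ≤ h * τ * D ^ 2 := by
  have hint : Integrable fun p => g p ^ 2 :=
    (hg.pow 2).integrable_of_hasCompactSupport (hgs.mono fun p hp h0 => hp (by simp [h0]))
  calc ∑ n ∈ Finset.range N, ∑ j ∈ A, (∫ p in cell h τ n j, |g p|) ^ 2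
      ≤ ∑ n ∈ Finset.range N, ∑ j ∈ A, h * τ * ∫ p in cell h τ n j, g p ^ 2 :=
        Finset.sum_le_sum fun n _ => Finset.sum_le_sum fun j _ => sq_integral_abs_cell_le hg hh hτ n j
    _ = h * τ * ∑ n ∈ Finset.range N, ∑ j ∈ A, ∫ p in cell h τ n j, g p ^ 2 := by
        simp only [Finset.mul_sum]
    _ ≤ h * τ * D ^ 2 := by
        refine mul_le_mul_of_nonneg_left ?_ (by positivity)
        exact (sum_cell_le_integral hh hτ N A hint fun p => sq_nonneg _).trans hD

theorem hasCompactSupport_partialX (hφs : HasCompactSupport φ) :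
    HasCompactSupport (partialX φ) :=
  (hφs.fderiv ℝ).comp_left (g := fun L : ℝ × ℝ →L[ℝ] ℝ => L (1, 0)) (by simp)

theorem hasCompactSupport_partialT (hφs : HasCompactSupport φ) :
    HasCompactSupport (partialT φ) :=
  (hφs.fderiv ℝ).comp_left (g := fun L : ℝ × ℝ →L[ℝ] ℝ => L (0, 1)) (by simp)

/-- All estimates compare an edge integral with the cell average on an adjacent cell. The offset 1/2
in `hJ` places every cell with |j| ≥ J, together with its edges, outside |x| < R. -/
theorem isGridTest (hφ : ContDiff ℝ 1 φ) (hφs : HasCompactSupport φ) (hh : 0 < h) (hτ : 0 < τ)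
    {N : ℕ} {J : ℤ} {R D S : ℝ}
    (hsupp : ∀ p, φ p ≠ 0 → |p.1| < R ∧ 0 < p.2 ∧ p.2 < N * τ) (hJ : R ≤ ((J : ℝ) - 1 / 2) * h)
    (hX : ∫ p, partialX φ p ^ 2 ≤ D ^ 2) (hT : ∫ p, partialT φ p ^ 2 ≤ D ^ 2)
    (hS : ∀ p, |φ p| ≤ S) :
    IsGridTest h τ D S N J (edgeT h τ φ) (edgeX h τ φ)
      (fun n j => (∫ p in cell h τ n j, φ p) / (h * τ))
      (fun n j => ∫ p in cell h τ n j, |partialT φ p|)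
      (fun n j => ∫ p in cell h τ n j, |partialX φ p|) := by
  have hx0 : ∀ x t, R ≤ |x| → φ (x, t) = 0 := fun x t hx => by
    by_contra h0
    exact absurd (hsupp _ h0).1 (not_lt.2 hx)
  have hJ1 : ∀ j : ℤ, J ≤ |j| → (J : ℝ) ≤ j ∨ (j : ℝ) ≤ -J := fun j hj => by
    rcases le_abs.1 hj with h1 | h1
    · left; exact_mod_cast h1
    · right; exact_mod_cast (by lia : j ≤ -J)
  refine ⟨fun j => ?_, fun j => ?_, fun n j => ?_, fun n j => ?_, fun n j => ?_, fun n j hj => ?_,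
    fun n => ?_, fun n j hj => ?_, fun n j => ?_, ?_, ?_⟩
  · rw [edgeT]
    refine (intervalIntegral.integral_congr fun x _ => ?_).trans intervalIntegral.integral_zero
    by_contra h0
    have := (hsupp _ h0).2.1
    simp at this
  · rw [edgeT]
    refine (intervalIntegral.integral_congr fun x _ => ?_).trans intervalIntegral.integral_zero
    by_contra h0
    have := (hsupp _ h0).2.2
    simp at this
  · have := abs_rect_sub_slice_t hφ (t := ((n : ℝ) + 1) * τ) (cell_left_le hh j)
      (right_mem_Icc.2 (cell_bot_le hτ n))
    have e : ((n : ℝ) + 1) * τ - n * τ = τ := by ring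
    rw [e, abs_sub_comm] at this
    rw [edgeT]
    push_cast
    refine le_of_mul_le_mul_left ?_ hτ
    refine le_trans (le_of_eq ?_) this
    rw [← abs_of_pos hτ, ← abs_mul, abs_of_pos hτ, cell]
    congr 1
    field_simp
  · have := abs_rect_sub_slice_x hφ (x := ((j : ℝ) - 1 / 2) * h) (left_mem_Icc.2 (cell_left_le hh j))
      (cell_bot_le hτ n)
    have e : ((j : ℝ) + 1 / 2) * h - ((j : ℝ) - 1 / 2) * h = h := by ring
    rw [e, abs_sub_comm] at this
    rw [edgeX]
    refine le_of_mul_le_mul_left ?_ hh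
    refine le_trans (le_of_eq ?_) this
    rw [← abs_of_pos hh, ← abs_mul, abs_of_pos hh, cell]
    congr 1
    field_simp
  · have := abs_rect_sub_slice_x hφ (x := ((j : ℝ) + 1 / 2) * h)
      (right_mem_Icc.2 (cell_left_le hh j)) (cell_bot_le hτ n)
    have e : ((j : ℝ) + 1 / 2) * h - ((j : ℝ) - 1 / 2) * h = h := by ring
    rw [e, abs_sub_comm] at this
    rw [edgeX]
    refine le_of_mul_le_mul_left ?_ hh
    refine le_trans (le_of_eq ?_) this
    rw [← abs_of_pos hh, ← abs_mul, abs_of_pos hh, cell]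
    have e2 : (((j + 1 : ℤ) : ℝ) - 1 / 2) * h = ((j : ℝ) + 1 / 2) * h := by push_cast; ring
    rw [e2]
    congr 1
    field_simp
  · rw [edgeX]
    refine (intervalIntegral.integral_congr fun t _ => ?_).trans intervalIntegral.integral_zero
    refine hx0 _ _ ?_
    rcases hJ1 j hj with h1 | h1
    · exact le_trans (by nlinarith) (le_abs_self _)
    · exact le_trans (by nlinarith) (neg_le_abs _)
  · rw [edgeX]
    refine (intervalIntegral.integral_congr fun t _ => ?_).trans intervalIntegral.integral_zero
    refine hx0 _ _ (le_trans ?_ (le_abs_self _))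
    push_cast
    nlinarith
  · have : ∫ p in cell h τ n j, φ p = 0 := by
      refine setIntegral_eq_zero_of_forall_eq_zero fun p hp => ?_
      obtain ⟨⟨h1, h2⟩, -⟩ := hp
      refine hx0 p.1 p.2 ?_
      rcases hJ1 j hj with h3 | h3
      · exact le_trans (by nlinarith) (le_abs_self _)
      · exact le_trans (by nlinarith) (neg_le_abs _)
    simp [this]
  · rw [abs_div, abs_of_pos (mul_pos hh hτ), div_le_iff₀ (mul_pos hh hτ),
      ← measureReal_cell hh hτ n j]
    refine norm_setIntegral_le_of_norm_le_const (f := φ) (s := cell h τ n j) ?_ fun p _ => hS p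
    rw [cell, Measure.volume_eq_prod, Measure.prod_prod]
    simp [ENNReal.mul_lt_top]
  · exact fun A => sum_sq_cell_le (continuous_partialT hφ) (hasCompactSupport_partialT hφs) hh hτ hT N A
  · exact fun A => sum_sq_cell_le (continuous_partialX hφ) (hasCompactSupport_partialX hφs) hh hτ hX N A

end

/-! ### Summation over the grid -/

theorem sum_Icc_telescope (G : ℤ → ℝ) {m n : ℤ} (hmn : m ≤ n) :
    ∑ j ∈ Finset.Icc m n, (G (j + 1) - G j) = G (n + 1) - G m := by
  induction n, hmn using Int.leInduction with
  | base => simp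
  | succ n hn ih =>
    have : Finset.Icc m (n + 1) = insert (n + 1) (Finset.Icc m n) := by
      ext j; simp only [Finset.mem_Icc, Finset.mem_insert]; lia
    rw [this, Finset.sum_insert (by simp), ih]
    ring

/-- Summation by parts as used in the energy estimates: an inequality that holds pointwise up to a
discrete divergence can be summed without boundary terms when the flux G vanishes at both ends. -/
theorem sum_le_sum_of_telescope {X Y G : ℤ → ℝ} {J : ℤ} (hJ : 0 ≤ J)
    (hXY : ∀ j, X j ≤ Y j + (G (j + 1) - G j)) (h1 : G (J + 1) = 0) (h0 : G (-J) = 0) :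
    ∑ j ∈ Finset.Icc (-J) J, X j ≤ ∑ j ∈ Finset.Icc (-J) J, Y j := by
  refine (Finset.sum_le_sum fun j _ => hXY j).trans ?_
  rw [Finset.sum_add_distrib, sum_Icc_telescope G (by lia), h1, h0]
  simp

/-- Solving for the centre value gives (1 + 2a) w_j = r_j + a (w_{j+1} + w_{j-1}), hence (1 + 2a) S
≤ R + 2aS for S = sup |w|. The a priori bound B only makes S finite. The conclusion does not depend
on a. -/
theorem discrete_max_principle {w r : ℤ → ℝ} {a R B : ℝ} (ha : 0 ≤ a) (hB : ∀ j, |w j| ≤ B)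
    (hr : ∀ j, |r j| ≤ R)
    (hw : ∀ j, w j = r j + a * ((w (j + 1) - w j) - (w j - w (j - 1)))) (j : ℤ) : |w j| ≤ R := by
  have hbdd : BddAbove (range fun j => |w j|) := ⟨B, by rintro _ ⟨j, rfl⟩; exact hB j⟩
  set S := ⨆ j, |w j| with hS
  have hle : ∀ j, |w j| ≤ S := fun j => le_ciSup hbdd j
  have key : ∀ j, |w j| ≤ (R + 2 * a * S) / (1 + 2 * a) := by
    intro j
    rw [le_div_iff₀ (by linarith)]
    have e : w j * (1 + 2 * a) = r j + a * (w (j + 1) + w (j - 1)) := by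
      have := hw j
      linarith
    have h1 : |w j| * (1 + 2 * a) = |r j + a * (w (j + 1) + w (j - 1))| := by
      rw [← e, abs_mul, abs_of_pos (by linarith : 0 < 1 + 2 * a)]
    rw [h1]
    have h2 : |w (j + 1) + w (j - 1)| ≤ 2 * S :=
      (abs_add_le _ _).trans (by linarith [hle (j + 1), hle (j - 1)])
    calc |r j + a * (w (j + 1) + w (j - 1))| ≤ |r j| + |a * (w (j + 1) + w (j - 1))| :=
          abs_add_le _ _
      _ ≤ R + a * (2 * S) := by
          rw [abs_mul, abs_of_nonneg ha]
          exact add_le_add (hr j) (mul_le_mul_of_nonneg_left h2 ha)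
      _ = _ := by ring
  have hSle : S ≤ (R + 2 * a * S) / (1 + 2 * a) := ciSup_le key
  rw [le_div_iff₀ (by linarith)] at hSle
  exact (hle j).trans (by linarith)

/-! ### The scheme in undivided differences -/

/-- Bounds for the flux function `f` on `[lo, hi]`; `V` is the total variation function and `F` a
primitive of `f`. -/
structure FluxBounds (f V F : ℝ → ℝ) (M B lo hi : ℝ) : Prop where
  abs_f : ∀ s ∈ Icc lo hi, |f s| ≤ M
  f_sub : ∀ s ∈ Icc lo hi, ∀ t ∈ Icc lo hi, |f s - f t| ≤ M * |s - t|
  V_sub : ∀ s ∈ Icc lo hi, ∀ t ∈ Icc lo hi, |V s - V t| ≤ M * |s - t|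
  dissipation : ∀ s ∈ Icc lo hi, ∀ t ∈ Icc lo hi, ∀ c : ℝ,
    (1 / 2 * c * (f s + f t) - 1 / 2 * |c| * (V t - V s)) * (t - s) ≤ c * (F t - F s)
  abs_id : ∀ s ∈ Icc lo hi, |s| ≤ B
  abs_F : ∀ s ∈ Icc lo hi, |F s| ≤ B

/-- The Engquist–Osher flux for `κ f(u)`, written with the total variation function `V` of `f`. -/
noncomputable def eoFlux (f V : ℝ → ℝ) (κ v : ℤ → ℝ) (j : ℤ) : ℝ :=
  1 / 2 * κ j * (f (v j) + f (v (j + 1))) - 1 / 2 * |κ j| * (V (v (j + 1)) - V (v j))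

/-- The scheme in undivided differences; `r = Δt / Δx` and `a = γ μ / Δx²`. Only the first `N`
time levels are constrained. -/
structure IsFlow (f V : ℝ → ℝ) (M β δ A lo hi : ℝ) (κ : ℤ → ℝ) (h r a : ℝ) (N : ℕ)
    (u : ℕ → ℤ → ℝ) : Prop where
  h_pos : 0 < h
  r_pos : 0 < r
  a_pos : 0 < a
  a_le : a ≤ A
  κ_le : ∀ j, |κ j| ≤ M
  mem : ∀ n < N, ∀ j, u n j ∈ Icc lo hi
  step : ∀ n, n + 1 < N → ∀ j,
    (u (n + 1) j - u n j) + r * (eoFlux f V κ (u n) j - eoFlux f V κ (u n) (j - 1))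
      = β * r * ((u n (j + 1) - u n j) - (u n j - u n (j - 1)))
        + a * (((u (n + 1) (j + 1) - u n (j + 1)) - (u (n + 1) j - u n j))
          - ((u (n + 1) j - u n j) - (u (n + 1) (j - 1) - u n (j - 1))))
  cfl : r / 2 * (1 + β / a) ≤ 1 - δ
  r_le : r ≤ 2
  M_le : 2 * M ≤ 1
  M_le' : 2 * M ≤ β

section

variable {f V F : ℝ → ℝ} {M B β δ A lo hi : ℝ}

theorem FluxBounds.M_nonneg (hf : FluxBounds f V F M B lo hi) {s : ℝ} (hs : s ∈ Icc lo hi) :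
    0 ≤ M := (abs_nonneg _).trans (hf.abs_f s hs)

theorem FluxBounds.B_nonneg (hf : FluxBounds f V F M B lo hi) {s : ℝ} (hs : s ∈ Icc lo hi) :
    0 ≤ B := (abs_nonneg _).trans (hf.abs_id s hs)

theorem abs_sub_le_two_mul {x y B : ℝ} (hx : |x| ≤ B) (hy : |y| ≤ B) : |x - y| ≤ 2 * B :=
  (abs_sub _ _).trans (by linarith)

theorem abs_eoFlux_sub_le (hf : FluxBounds f V F M B lo hi) {κ v : ℤ → ℝ} (hκ : ∀ j, |κ j| ≤ M)
    (hv : ∀ j, v j ∈ Icc lo hi) (j : ℤ) :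
    |eoFlux f V κ v j - κ j * f (v j)| ≤ M ^ 2 * |v (j + 1) - v j| := by
  have h1 := hf.f_sub _ (hv (j + 1)) _ (hv j)
  have h2 := hf.V_sub _ (hv (j + 1)) _ (hv j)
  have hM := hf.M_nonneg (hv j)
  have e : eoFlux f V κ v j - κ j * f (v j)
      = 1 / 2 * (κ j * (f (v (j + 1)) - f (v j))) - 1 / 2 * (|κ j| * (V (v (j + 1)) - V (v j))) := by
    rw [eoFlux]; ring
  have b1 : |κ j * (f (v (j + 1)) - f (v j))| ≤ M * (M * |v (j + 1) - v j|) := by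
    rw [abs_mul]
    exact mul_le_mul (hκ j) h1 (abs_nonneg _) hM
  have b2 : |(|κ j| * (V (v (j + 1)) - V (v j)))| ≤ M * (M * |v (j + 1) - v j|) := by
    rw [abs_mul, abs_abs]
    exact mul_le_mul (hκ j) h2 (abs_nonneg _) hM
  rw [e]
  rw [abs_le] at b1 b2 ⊢
  constructor <;> linarith [b1.1, b1.2, b2.1, b2.2]

theorem abs_eoFlux_le (hf : FluxBounds f V F M B lo hi) {κ v : ℤ → ℝ} (hκ : ∀ j, |κ j| ≤ M)
    (hv : ∀ j, v j ∈ Icc lo hi) (j : ℤ) : |eoFlux f V κ v j| ≤ M ^ 2 * (1 + 2 * B) := by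
  have h1 := abs_eoFlux_sub_le hf hκ hv j
  have h2 := abs_sub_le_two_mul (hf.abs_id _ (hv (j + 1))) (hf.abs_id _ (hv j))
  have hM := hf.M_nonneg (hv j)
  have h3 : |κ j * f (v j)| ≤ M * M := by
    rw [abs_mul]
    exact mul_le_mul (hκ j) (hf.abs_f _ (hv j)) (abs_nonneg _) hM
  have h4 : M ^ 2 * |v (j + 1) - v j| ≤ M ^ 2 * (2 * B) := by gcongr
  calc |eoFlux f V κ v j| = |(eoFlux f V κ v j - κ j * f (v j)) + κ j * f (v j)| := by ring_nf
    _ ≤ _ := (abs_add_le _ _).trans (by linarith)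

theorem abs_eoFlux_diff_le (hf : FluxBounds f V F M B lo hi) {κ v : ℤ → ℝ} (hκ : ∀ j, |κ j| ≤ M)
    (hv : ∀ j, v j ∈ Icc lo hi) (j : ℤ) :
    |eoFlux f V κ v j - eoFlux f V κ v (j - 1)|
      ≤ M * |κ j - κ (j - 1)| + M ^ 2 * (|v (j + 1) - v j| + |v j - v (j - 1)|) := by
  have hM := hf.M_nonneg (hv j)
  have f1 := hf.f_sub _ (hv (j + 1)) _ (hv j)
  have f2 := hf.f_sub _ (hv j) _ (hv (j - 1))
  have v1 := hf.V_sub _ (hv (j + 1)) _ (hv j)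
  have v2 := hf.V_sub _ (hv j) _ (hv (j - 1))
  have f3 : |f (v j) + f (v (j + 1))| ≤ 2 * M :=
    (abs_add_le _ _).trans (by linarith [hf.abs_f _ (hv j), hf.abs_f _ (hv (j + 1))])
  have e : eoFlux f V κ v j - eoFlux f V κ v (j - 1)
      = 1 / 2 * ((κ j - κ (j - 1)) * (f (v j) + f (v (j + 1))))
        + 1 / 2 * (κ (j - 1) * ((f (v (j + 1)) - f (v j)) + (f (v j) - f (v (j - 1)))))
        - 1 / 2 * (|κ j| * (V (v (j + 1)) - V (v j)))
        + 1 / 2 * (|κ (j - 1)| * (V (v j) - V (v (j - 1)))) := by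
    simp only [eoFlux, sub_add_cancel]; ring
  have b1 : |(κ j - κ (j - 1)) * (f (v j) + f (v (j + 1)))| ≤ |κ j - κ (j - 1)| * (2 * M) := by
    rw [abs_mul]
    exact mul_le_mul_of_nonneg_left f3 (abs_nonneg _)
  have b2 : |κ (j - 1) * ((f (v (j + 1)) - f (v j)) + (f (v j) - f (v (j - 1))))|
      ≤ M * (M * |v (j + 1) - v j| + M * |v j - v (j - 1)|) := by
    rw [abs_mul]
    exact mul_le_mul (hκ _) ((abs_add_le _ _).trans (add_le_add f1 f2)) (abs_nonneg _) hM
  have b3 : |(|κ j| * (V (v (j + 1)) - V (v j)))| ≤ M * (M * |v (j + 1) - v j|) := by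
    rw [abs_mul, abs_abs]
    exact mul_le_mul (hκ j) v1 (abs_nonneg _) hM
  have b4 : |(|κ (j - 1)| * (V (v j) - V (v (j - 1))))| ≤ M * (M * |v j - v (j - 1)|) := by
    rw [abs_mul, abs_abs]
    exact mul_le_mul (hκ _) v2 (abs_nonneg _) hM
  rw [e]
  rw [abs_le] at b1 b2 b3 b4 ⊢
  constructor <;> linarith [b1.1, b1.2, b2.1, b2.2, b3.1, b3.2, b4.1, b4.2]

/-- The time increments are of the order `Δt / Δx`. -/
theorem IsFlow.abs_increment_le (hf : FluxBounds f V F M B lo hi) {κ : ℤ → ℝ} {h r a : ℝ} {N : ℕ}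
    {u : ℕ → ℤ → ℝ} (hu : IsFlow f V M β δ A lo hi κ h r a N u) (hβ : 0 ≤ β) {n : ℕ}
    (hn : n + 1 < N) (j : ℤ) :
    |u (n + 1) j - u n j| ≤ r * (4 * β * B + 2 * (M ^ 2 * (1 + 2 * B))) := by
  have hm := hu.mem n (by lia)
  have hm' := hu.mem (n + 1) hn
  have hH := abs_eoFlux_le hf hu.κ_le hm
  have hs : ∀ i, |u n (i + 1) - u n i| ≤ 2 * B := fun i =>
    abs_sub_le_two_mul (hf.abs_id _ (hm _)) (hf.abs_id _ (hm _))
  -- The increment w solves w - a Δ²w = r (β Δ²u - ΔH). Here Δ²u is at most 4B, and ΔH is twice the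
  -- bound of the numerical flux.
  refine discrete_max_principle (w := fun j => u (n + 1) j - u n j)
    (r := fun j => r * (β * ((u n (j + 1) - u n j) - (u n j - u n (j - 1)))
      - (eoFlux f V κ (u n) j - eoFlux f V κ (u n) (j - 1)))) hu.a_pos.le
    (fun j => abs_sub_le_two_mul (hf.abs_id _ (hm' j)) (hf.abs_id _ (hm j))) (fun j => ?_)
    (fun j => ?_) j
  · rw [abs_mul, abs_of_pos hu.r_pos]
    refine mul_le_mul_of_nonneg_left ?_ hu.r_pos.le
    have h1 := hs j
    have h2 := hs (j - 1)
    rw [sub_add_cancel] at h2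
    have h3 := abs_sub_le_two_mul (hH j) (hH (j - 1))
    have h4 := abs_sub_le_two_mul h1 h2
    refine (abs_sub _ _).trans ?_
    rw [abs_mul, abs_of_nonneg hβ]
    nlinarith
  · have := hu.step n hn j
    linarith

end

/-! ### The local energy estimate -/

/-- A cutoff weight on the grid. -/
structure IsCutoff (h : ℝ) (J : ℤ) (φ : ℤ → ℝ) : Prop where
  J_nonneg : 0 ≤ J
  nonneg : ∀ j, 0 ≤ φ j
  le_one : ∀ j, φ j ≤ 1
  lip : ∀ j, |φ (j + 1) - φ j| ≤ h
  supp : ∀ j, J ≤ |j| → φ j = 0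

theorem neg_mul_mul_le {x y z X Y Z : ℝ} (hx : |x| ≤ X) (hy : |y| ≤ Y) (hz : |z| ≤ Z) :
    -(x * y * z) ≤ X * Y * Z := by
  refine (neg_le_abs _).trans ?_
  rw [abs_mul, abs_mul]
  have hX := (abs_nonneg _).trans hx
  have hY := (abs_nonneg _).trans hy
  gcongr

section

variable {J : ℤ} {h : ℝ} {φ : ℤ → ℝ}

theorem IsCutoff.supp_right (hφ : IsCutoff h J φ) : φ (J + 1) = 0 :=
  hφ.supp _ ((by lia : J ≤ J + 1).trans (le_abs_self _))

theorem IsCutoff.supp_J (hφ : IsCutoff h J φ) : φ J = 0 :=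
  hφ.supp _ (le_abs_self _)

theorem IsCutoff.supp_left (hφ : IsCutoff h J φ) : φ (-J) = 0 :=
  hφ.supp _ (by rw [abs_neg]; exact le_abs_self _)

theorem IsCutoff.supp_left' (hφ : IsCutoff h J φ) : φ (-J - 1) = 0 :=
  hφ.supp _ ((by lia : J ≤ -(-J - 1)).trans (neg_le_abs _))

variable {f V F : ℝ → ℝ} {M B β δ A lo hi r a : ℝ} {κ : ℤ → ℝ} {N : ℕ} {u : ℕ → ℤ → ℝ}

/-- The weighted inner product of the scheme with `uⁿ`. -/
theorem sum_energy_inner_le (hf : FluxBounds f V F M B lo hi) (hβ : 0 ≤ β) (hφ : IsCutoff h J φ)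
    (hu : IsFlow f V M β δ A lo hi κ h r a N u) {n : ℕ} (hn : n + 1 < N) {c : ℝ}
    (hc : ∀ j, |u (n + 1) j - u n j| ≤ r * c) :
    ∑ j ∈ Finset.Icc (-J) J, φ j * (u n j * (u (n + 1) j - u n j)
        + a * (u n (j + 1) - u n j)
          * ((u (n + 1) (j + 1) - u n (j + 1)) - (u (n + 1) j - u n j)))
      ≤ ∑ j ∈ Finset.Icc (-J) J, (-(r * β) * (φ j * (u n (j + 1) - u n j) ^ 2)
        + r * ((2 * A * c * B + (2 * β * B + M ^ 2 * (1 + 2 * B)) * B + B * M) * h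
          + B * |κ (j + 1) - κ j|)) := by
  have hm := hu.mem n (by lia)
  set H := eoFlux f V κ (u n) with hH
  set s : ℤ → ℝ := fun j => u n (j + 1) - u n j with hs
  set w : ℤ → ℝ := fun j => u (n + 1) j - u n j with hw
  have hr := hu.r_pos
  -- The three summands of G come from the dispersion, from viscosity minus numerical flux, and from
  -- the jumps of κF(u). The differences that land on the cutoff or on κ are the error terms `t1`,
  -- `t2`, `t4`.
  refine sum_le_sum_of_telescope (G := fun j => a * φ j * u n j * (w j - w (j - 1))
    + r * φ j * u n j * (β * (u n j - u n (j - 1)) - H (j - 1)) + r * φ j * κ j * F (u n j))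
    hφ.J_nonneg (fun j => ?_) (by simp [hφ.supp_right]) (by simp [hφ.supp_left])
  have hstep := hu.step n hn j
  have hB := hf.abs_id _ (hm (j + 1))
  have hsB : |u n (j + 1) - u n j| ≤ 2 * B := abs_sub_le_two_mul hB (hf.abs_id _ (hm j))
  have hz : |w (j + 1) - w j| ≤ 2 * (r * c) := abs_sub_le_two_mul (hc _) (hc _)
  have hHB : |H j| ≤ M ^ 2 * (1 + 2 * B) := abs_eoFlux_le hf hu.κ_le hm j
  have hg : |β * (u n (j + 1) - u n j) - H j| ≤ 2 * β * B + M ^ 2 * (1 + 2 * B) := by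
    refine (abs_sub _ _).trans ?_
    rw [abs_mul, abs_of_nonneg hβ]
    nlinarith
  have t1 : -(a * (w (j + 1) - w j) * u n (j + 1) * (φ (j + 1) - φ j))
      ≤ A * (2 * (r * c)) * B * h :=
    neg_mul_mul_le (by
      rw [abs_mul, abs_of_pos hu.a_pos]
      exact mul_le_mul hu.a_le hz (abs_nonneg _) (hu.a_pos.le.trans hu.a_le)) hB (hφ.lip j)
  have t2 : -((β * (u n (j + 1) - u n j) - H j) * u n (j + 1) * (φ (j + 1) - φ j))
      ≤ (2 * β * B + M ^ 2 * (1 + 2 * B)) * B * h := neg_mul_mul_le hg hB (hφ.lip j)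
  -- Dissipativity of the flux: numerical flux times jump is bounded by a difference, which
  -- telescopes up to the variation of φκ.
  have t3 : φ j * (H j * (u n (j + 1) - u n j)) ≤ φ j * (κ j * (F (u n (j + 1)) - F (u n j))) :=
    mul_le_mul_of_nonneg_left (hf.dissipation _ (hm j) _ (hm (j + 1)) (κ j)) (hφ.nonneg j)
  have t4 : -(F (u n (j + 1)) * (φ (j + 1) * κ (j + 1) - φ j * κ j))
      ≤ B * (|κ (j + 1) - κ j| + M * h) := by
    refine (neg_le_abs _).trans ?_
    rw [abs_mul]
    refine mul_le_mul (hf.abs_F _ (hm _)) ?_ (abs_nonneg _) ((abs_nonneg _).trans hB)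
    have e : φ (j + 1) * κ (j + 1) - φ j * κ j
        = φ j * (κ (j + 1) - κ j) + κ (j + 1) * (φ (j + 1) - φ j) := by ring
    rw [e]
    refine (abs_add_le _ _).trans (add_le_add ?_ ?_)
    · rw [abs_mul, abs_of_nonneg (hφ.nonneg j)]
      exact mul_le_of_le_one_left (abs_nonneg _) (hφ.le_one j)
    · rw [abs_mul]
      exact mul_le_mul (hu.κ_le _) (hφ.lip j) (abs_nonneg _) ((abs_nonneg _).trans (hu.κ_le j))
  have t2' := mul_le_mul_of_nonneg_left t2 hr.le
  have t3' := mul_le_mul_of_nonneg_left t3 hr.le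
  have t4' := mul_le_mul_of_nonneg_left t4 hr.le
  simp only [hw, hs, add_sub_cancel_right] at *
  linear_combination t1 + t2' + t3' + t4' + φ j * u n j * hstep

/-- Bounded variation controls only the sum of |Δκ|, so one factor of |Δκ|² is spent on the trivial
bound 2M. -/
theorem IsFlow.sq_eoFlux_diff_le (hf : FluxBounds f V F M B lo hi)
    (hu : IsFlow f V M β δ A lo hi κ h r a N u) {n : ℕ} (hn : n < N) (j : ℤ) :
    (eoFlux f V κ (u n) j - eoFlux f V κ (u n) (j - 1)) ^ 2
      ≤ 4 * M ^ 3 * |κ j - κ (j - 1)|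
        + 4 * M ^ 4 * ((u n (j + 1) - u n j) ^ 2 + (u n j - u n (j - 1)) ^ 2) := by
  have hm := hu.mem n hn
  have hM := hf.M_nonneg (hm 0)
  have h1 := abs_eoFlux_diff_le hf hu.κ_le hm j
  have h2 := abs_sub_le_two_mul (hu.κ_le j) (hu.κ_le (j - 1))
  rw [← sq_abs, ← sq_abs (u n (j + 1) - u n j), ← sq_abs (u n j - u n (j - 1))]
  set X := |κ j - κ (j - 1)|
  set Y := |u n (j + 1) - u n j|
  set Z := |u n j - u n (j - 1)|
  have hX : 0 ≤ X := abs_nonneg _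
  calc _ ≤ (M * X + M ^ 2 * (Y + Z)) ^ 2 := pow_le_pow_left₀ (abs_nonneg _) h1 2
    _ ≤ 2 * M ^ 2 * (X * X) + 4 * M ^ 4 * (Y ^ 2 + Z ^ 2) := by
        nlinarith [sq_nonneg (M * X - M ^ 2 * (Y + Z)), sq_nonneg (M ^ 2 * (Y - Z))]
    _ ≤ 2 * M ^ 2 * (2 * M * X) + 4 * M ^ 4 * (Y ^ 2 + Z ^ 2) := by gcongr
    _ = _ := by ring

/-- Moves a squared difference from the left neighbour to the right one: with x, y consecutive
differences of u the last bracket telescopes, and the mismatch of the weights is at most h. -/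
theorem IsCutoff.mul_prev_le (hφ : IsCutoff h J φ) {x y B : ℝ} (hx : |x| ≤ 2 * B) (j : ℤ) :
    φ j * x ^ 2 ≤ φ j * y ^ 2 + 4 * B ^ 2 * h + (-(φ j * y ^ 2) + φ (j - 1) * x ^ 2) := by
  have h1 := hφ.lip (j - 1)
  rw [sub_add_cancel] at h1
  have h2 : x ^ 2 ≤ 4 * B ^ 2 := by
    rw [← sq_abs]
    nlinarith [abs_nonneg x]
  have h3 : (φ j - φ (j - 1)) * x ^ 2 ≤ h * (4 * B ^ 2) :=
    mul_le_mul ((le_abs_self _).trans h1) h2 (sq_nonneg _) ((abs_nonneg _).trans h1)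
  linarith

/-- The quadratic terms of the time increment, controlled with the help of the dispersion. -/
theorem sum_increment_energy_le (hf : FluxBounds f V F M B lo hi) (hβ : 0 ≤ β)
    (hφ : IsCutoff h J φ) (hu : IsFlow f V M β δ A lo hi κ h r a N u) {n : ℕ} (hn : n + 1 < N)
    {c : ℝ} (hc : ∀ j, |u (n + 1) j - u n j| ≤ r * c) :
    ∑ j ∈ Finset.Icc (-J) J, φ j * ((u (n + 1) j - u n j) ^ 2
        + a * ((u (n + 1) (j + 1) - u n (j + 1)) - (u (n + 1) j - u n j)) ^ 2)
      ≤ ∑ j ∈ Finset.Icc (-J) J, (((r * β) ^ 2 / a + 8 * M ^ 4 * r ^ 2)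
          * (φ j * (u n (j + 1) - u n j) ^ 2)
        + r ^ 2 * ((4 * A * c ^ 2 + 4 * β * B * c + 16 * M ^ 4 * B ^ 2) * h
          + 4 * M ^ 3 * |κ j - κ (j - 1)|)) := by
  have hm := hu.mem n (by lia)
  set H := eoFlux f V κ (u n) with hH
  set w : ℤ → ℝ := fun j => u (n + 1) j - u n j with hw
  have hr := hu.r_pos
  have ha := hu.a_pos
  refine sum_le_sum_of_telescope (G := fun j => 2 * a * φ j * w j * (w j - w (j - 1))
    + 2 * r * β * φ j * w j * (u n j - u n (j - 1))
    - r ^ 2 * (4 * M ^ 4) * (φ (j - 1) * (u n j - u n (j - 1)) ^ 2))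
    hφ.J_nonneg (fun j => ?_) (by simp [hφ.supp_right, hφ.supp_J])
      (by simp [hφ.supp_left, hφ.supp_left'])
  have hstep := hu.step n hn j
  have hsB : ∀ j, |u n (j + 1) - u n j| ≤ 2 * B := fun j =>
    abs_sub_le_two_mul (hf.abs_id _ (hm _)) (hf.abs_id _ (hm j))
  have hsB' := hsB (j - 1)
  rw [sub_add_cancel] at hsB'
  have hz : |w (j + 1) - w j| ≤ 2 * (r * c) := abs_sub_le_two_mul (hc _) (hc _)
  have t1 : -(a * (w (j + 1) - w j) * w (j + 1) * (φ (j + 1) - φ j))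
      ≤ A * (2 * (r * c)) * (r * c) * h :=
    neg_mul_mul_le (by
      rw [abs_mul, abs_of_pos hu.a_pos]
      exact mul_le_mul hu.a_le hz (abs_nonneg _) (hu.a_pos.le.trans hu.a_le)) (hc _) (hφ.lip j)
  have t2 : -((β * (u n (j + 1) - u n j)) * w (j + 1) * (φ (j + 1) - φ j))
      ≤ (β * (2 * B)) * (r * c) * h :=
    neg_mul_mul_le (by
      rw [abs_mul, abs_of_nonneg hβ]
      exact mul_le_mul_of_nonneg_left (hsB j) hβ) (hc _) (hφ.lip j)
  -- The mixed term of viscosity and time increment is absorbed by the dispersive energy a(Δw)².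
  -- This produces the (rβ)²/a that the second half of the CFL condition controls.
  have t3 : -(2 * (r * β) * ((u n (j + 1) - u n j) * (w (j + 1) - w j)))
      ≤ a * (w (j + 1) - w j) ^ 2 + (r * β) ^ 2 / a * (u n (j + 1) - u n j) ^ 2 := by
    have e : (r * β) ^ 2 / a * (u n (j + 1) - u n j) ^ 2 = a * (r * β / a * (u n (j + 1) - u n j)) ^ 2 := by
      field_simp
    have e2 : (r * β) * ((u n (j + 1) - u n j) * (w (j + 1) - w j))
      = a * ((r * β / a * (u n (j + 1) - u n j)) * (w (j + 1) - w j)) := by field_simp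
    have := mul_nonneg ha.le (sq_nonneg (r * β / a * (u n (j + 1) - u n j) + (w (j + 1) - w j)))
    rw [e]
    linear_combination this - 2 * e2
  have t4 : -(2 * r * (w j * (H j - H (j - 1)))) ≤ w j ^ 2 + r ^ 2 * (H j - H (j - 1)) ^ 2 := by
    linear_combination sq_nonneg (w j + r * (H j - H (j - 1)))
  have t5 := hu.sq_eoFlux_diff_le hf (by lia : n < N) j
  have t6 := hφ.mul_prev_le (y := u n (j + 1) - u n j) hsB' j
  have t2' := mul_le_mul_of_nonneg_left t2 (by positivity : 0 ≤ 2 * r)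
  have t3' := mul_le_mul_of_nonneg_left t3 (hφ.nonneg j)
  have t4' := mul_le_mul_of_nonneg_left t4 (hφ.nonneg j)
  have t5' := mul_le_mul_of_nonneg_left t5 (mul_nonneg (sq_nonneg r) (hφ.nonneg j))
  have t6' := mul_le_mul_of_nonneg_left t6 (by positivity : 0 ≤ r ^ 2 * (4 * M ^ 4))
  have hM := hf.M_nonneg (hm 0)
  have t7 : r ^ 2 * (φ j * (4 * M ^ 3 * |κ j - κ (j - 1)|)) ≤ r ^ 2 * (4 * M ^ 3 * |κ j - κ (j - 1)|) :=
    mul_le_mul_of_nonneg_left (mul_le_of_le_one_left (by positivity) (hφ.le_one j)) (sq_nonneg r)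
  simp only [hw, add_sub_cancel_right] at *
  linear_combination 2 * t1 + t2' + t3' + t4' + t5' + t6' + t7
    + 2 * φ j * (u (n + 1) j - u n j) * hstep

/-- The time increments, controlled by the spatial increments. -/
theorem sum_sq_increment_le (hf : FluxBounds f V F M B lo hi)
    (hφ : IsCutoff h J φ) (hu : IsFlow f V M β δ A lo hi κ h r a N u) {n : ℕ} (hn : n + 1 < N)
    {c : ℝ} (hc : ∀ j, |u (n + 1) j - u n j| ≤ r * c) :
    ∑ j ∈ Finset.Icc (-J) J, φ j * (u (n + 1) j - u n j) ^ 2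
      ≤ ∑ j ∈ Finset.Icc (-J) J, r ^ 2 * ((8 * β ^ 2 + 16 * M ^ 4)
          * (φ j * (u n (j + 1) - u n j) ^ 2)
        + (4 * A * c ^ 2 + 4 * B ^ 2 * (4 * β ^ 2 + 8 * M ^ 4)) * h
          + 8 * M ^ 3 * |κ j - κ (j - 1)|) := by
  have hm := hu.mem n (by lia)
  set H := eoFlux f V κ (u n) with hH
  set w : ℤ → ℝ := fun j => u (n + 1) j - u n j with hw
  have hr := hu.r_pos
  have ha := hu.a_pos
  refine sum_le_sum_of_telescope (G := fun j => 2 * a * φ j * w j * (w j - w (j - 1))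
    - r ^ 2 * (4 * β ^ 2 + 8 * M ^ 4) * (φ (j - 1) * (u n j - u n (j - 1)) ^ 2))
    hφ.J_nonneg (fun j => ?_) (by simp [hφ.supp_right, hφ.supp_J])
      (by simp [hφ.supp_left, hφ.supp_left'])
  have hstep := hu.step n hn j
  have hsB : ∀ j, |u n (j + 1) - u n j| ≤ 2 * B := fun j =>
    abs_sub_le_two_mul (hf.abs_id _ (hm _)) (hf.abs_id _ (hm j))
  have hsB' := hsB (j - 1)
  rw [sub_add_cancel] at hsB'
  have hz : |w (j + 1) - w j| ≤ 2 * (r * c) := abs_sub_le_two_mul (hc _) (hc _)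
  have t1 : -(a * (w (j + 1) - w j) * w (j + 1) * (φ (j + 1) - φ j))
      ≤ A * (2 * (r * c)) * (r * c) * h :=
    neg_mul_mul_le (by
      rw [abs_mul, abs_of_pos hu.a_pos]
      exact mul_le_mul hu.a_le hz (abs_nonneg _) (hu.a_pos.le.trans hu.a_le)) (hc _) (hφ.lip j)
  set p := β * ((u n (j + 1) - u n j) - (u n j - u n (j - 1))) with hp
  -- Here the second difference is absorbed by w² and the dispersive energy is discarded. No 1/a
  -- appears, and the right side is of order r², which the rate in r of the energy estimate
  -- requires.
  have t4 : 2 * r * (w j * (p - (H j - H (j - 1))))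
      ≤ w j ^ 2 + r ^ 2 * (2 * p ^ 2 + 2 * (H j - H (j - 1)) ^ 2) := by
    linear_combination sq_nonneg (w j - r * (p - (H j - H (j - 1))))
      + r ^ 2 * sq_nonneg (p + (H j - H (j - 1)))
  have t4b : p ^ 2 ≤ 2 * β ^ 2 * ((u n (j + 1) - u n j) ^ 2 + (u n j - u n (j - 1)) ^ 2) := by
    rw [hp]
    linear_combination β ^ 2 * sq_nonneg ((u n (j + 1) - u n j) + (u n j - u n (j - 1)))
  have t5 := hu.sq_eoFlux_diff_le hf (by lia : n < N) j
  have t6 := hφ.mul_prev_le (y := u n (j + 1) - u n j) hsB' j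
  have t4' := mul_le_mul_of_nonneg_left t4 (hφ.nonneg j)
  have hr2 : 0 ≤ 2 * r ^ 2 * φ j := mul_nonneg (by positivity) (hφ.nonneg j)
  have t4b' := mul_le_mul_of_nonneg_left t4b hr2
  have t5' := mul_le_mul_of_nonneg_left t5 hr2
  have t6' := mul_le_mul_of_nonneg_left t6 (by positivity : 0 ≤ r ^ 2 * (4 * β ^ 2 + 8 * M ^ 4))
  have hM := hf.M_nonneg (hm 0)
  have t7 : r ^ 2 * (φ j * (8 * M ^ 3 * |κ j - κ (j - 1)|))
      ≤ r ^ 2 * (8 * M ^ 3 * |κ j - κ (j - 1)|) :=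
    mul_le_mul_of_nonneg_left (mul_le_of_le_one_left (by positivity) (hφ.le_one j)) (sq_nonneg r)
  have t8 : 0 ≤ φ j * (a * (w (j + 1) - w j) ^ 2) :=
    mul_nonneg (hφ.nonneg j) (by positivity)
  simp only [hw, add_sub_cancel_right] at *
  rw [hp] at t4' t4b'
  linear_combination 2 * t1 + t4' + t4b' + t5' + t6' + t7 + 2 * t8
    + 2 * φ j * (u (n + 1) j - u n j) * hstep

end

/-! ### Summing the energy inequality in time -/

section

variable {J : ℤ} {h : ℝ} {φ : ℤ → ℝ}
variable {f V F : ℝ → ℝ} {M B β δ A lo hi r a : ℝ} {κ : ℤ → ℝ} {N : ℕ} {u : ℕ → ℤ → ℝ}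

theorem sum_Icc_const (hJ : 0 ≤ J) (x : ℝ) :
    ∑ _j ∈ Finset.Icc (-J) J, x = (2 * J + 1) * x := by
  rw [Finset.sum_const, Int.card_Icc, nsmul_eq_mul]
  congr 1
  have : (((J + 1 - -J).toNat : ℤ) : ℝ) = ((2 * J + 1 : ℤ) : ℝ) := by
    congr 1
    lia
  push_cast at this
  exact this

/-- The CFL condition makes the numerical diffusion dominate. -/
theorem IsFlow.cfl_energy (hβ : 0 < β)
    (hu : IsFlow f V M β δ A lo hi κ h r a N u) (hM : 0 ≤ M) :
    ((r * β) ^ 2 / a + 8 * M ^ 4 * r ^ 2) ≤ 2 * (r * β * (1 - δ)) := by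
  have hr := hu.r_pos
  have h1 : 8 * M ^ 4 ≤ β := by
    have h2 : M ^ 3 ≤ (1 / 2) ^ 3 := pow_le_pow_left₀ hM (by linarith [hu.M_le]) 3
    have h3 := mul_le_mul h2 hu.M_le' (by positivity) (by positivity)
    nlinarith
  calc (r * β) ^ 2 / a + 8 * M ^ 4 * r ^ 2 ≤ (r * β) ^ 2 / a + β * r ^ 2 := by gcongr
    -- The bracket is the left side of the second CFL bound.
    _ = 2 * (r * β) * (r / 2 * (1 + β / a)) := by field_simp; ring
    _ ≤ 2 * (r * β) * (1 - δ) := mul_le_mul_of_nonneg_left hu.cfl (by positivity)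
    _ = _ := by ring

/-- The discrete energy. -/
noncomputable def energy (a : ℝ) (J : ℤ) (φ v : ℤ → ℝ) : ℝ :=
  ∑ j ∈ Finset.Icc (-J) J, φ j * (1 / 2 * v j ^ 2 + 1 / 2 * a * (v (j + 1) - v j) ^ 2)

/-- Since ½(v + w)² - ½v² = vw + ½w², the increment of the energy is exactly the inner product term
plus half the quadratic term. The viscous gain rβ and the loss rβ(1 - δ) leave rβδ. -/
theorem energy_step (hf : FluxBounds f V F M B lo hi) (hβ : 0 < β)
    (hφ : IsCutoff h J φ) (hu : IsFlow f V M β δ A lo hi κ h r a N u) {n : ℕ} (hn : n + 1 < N)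
    {c R K : ℝ} (hc0 : 0 ≤ c) (hc : ∀ j, |u (n + 1) j - u n j| ≤ r * c)
    (hR : (2 * J + 1) * h ≤ R)
    (hK : ∑ j ∈ Finset.Icc (-J) J, |κ (j + 1) - κ j| ≤ K)
    (hK' : ∑ j ∈ Finset.Icc (-J) J, |κ j - κ (j - 1)| ≤ K) :
    energy a J φ (u (n + 1)) - energy a J φ (u n)
      ≤ -(r * β * δ) * (∑ j ∈ Finset.Icc (-J) J, φ j * (u n (j + 1) - u n j) ^ 2)
        + r * ((2 * A * c * B + (2 * β * B + M ^ 2 * (1 + 2 * B)) * B + B * M) * R + B * K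
          + ((4 * A * c ^ 2 + 4 * β * B * c + 16 * M ^ 4 * B ^ 2) * R + 4 * M ^ 3 * K)) := by
  have hm := hu.mem n (by lia)
  have hM := hf.M_nonneg (hm 0)
  have hB := hf.B_nonneg (hm 0)
  have hA := hu.a_pos.le.trans hu.a_le
  have hr := hu.r_pos
  have h1 := sum_energy_inner_le hf hβ.le hφ hu hn hc
  have h2 := sum_increment_energy_le hf hβ.le hφ hu hn hc
  have h3 := hu.cfl_energy hβ hM
  set P := ∑ j ∈ Finset.Icc (-J) J, φ j * (u n (j + 1) - u n j) ^ 2 with hP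
  have hP0 : 0 ≤ P := Finset.sum_nonneg fun j _ => mul_nonneg (hφ.nonneg j) (sq_nonneg _)
  have e : energy a J φ (u (n + 1)) - energy a J φ (u n)
      = (∑ j ∈ Finset.Icc (-J) J, φ j * (u n j * (u (n + 1) j - u n j)
        + a * (u n (j + 1) - u n j)
          * ((u (n + 1) (j + 1) - u n (j + 1)) - (u (n + 1) j - u n j))))
        + 1 / 2 * ∑ j ∈ Finset.Icc (-J) J, φ j * ((u (n + 1) j - u n j) ^ 2
        + a * ((u (n + 1) (j + 1) - u n (j + 1)) - (u (n + 1) j - u n j)) ^ 2) := by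
    rw [energy, energy, ← Finset.sum_sub_distrib, Finset.mul_sum, ← Finset.sum_add_distrib]
    refine Finset.sum_congr rfl fun j _ => ?_
    ring
  rw [Finset.sum_add_distrib, ← Finset.mul_sum, ← Finset.mul_sum, Finset.sum_add_distrib,
    sum_Icc_const hφ.J_nonneg, ← Finset.mul_sum] at h1 h2
  rw [← hP] at h1 h2
  rw [e]
  set C1 := 2 * A * c * B + (2 * β * B + M ^ 2 * (1 + 2 * B)) * B + B * M with hC1
  set C2 := 4 * A * c ^ 2 + 4 * β * B * c + 16 * M ^ 4 * B ^ 2 with hC2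
  have hC1' : 0 ≤ C1 := by positivity
  have hC2' : 0 ≤ C2 := by positivity
  have b1 : (2 * J + 1) * (C1 * h) ≤ C1 * R := by
    linear_combination mul_le_mul_of_nonneg_left hR hC1'
  have b2 : (2 * J + 1) * (C2 * h) ≤ C2 * R := by
    linear_combination mul_le_mul_of_nonneg_left hR hC2'
  have b3 : B * ∑ j ∈ Finset.Icc (-J) J, |κ (j + 1) - κ j| ≤ B * K :=
    mul_le_mul_of_nonneg_left hK hB
  have b4 : 4 * M ^ 3 * ∑ j ∈ Finset.Icc (-J) J, |κ j - κ (j - 1)| ≤ 4 * M ^ 3 * K :=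
    mul_le_mul_of_nonneg_left hK' (by positivity)
  have b5 := mul_le_mul_of_nonneg_right h3 hP0
  have hR0 : 0 ≤ R := le_trans (mul_nonneg (by exact_mod_cast (by linarith [hφ.J_nonneg] :
    (0 : ℤ) ≤ 2 * J + 1)) hu.h_pos.le) hR
  have hK0 : 0 ≤ K := (Finset.sum_nonneg fun j _ => abs_nonneg _).trans hK
  have b6 : r ^ 2 * (C2 * R + 4 * M ^ 3 * K) ≤ 2 * r * (C2 * R + 4 * M ^ 3 * K) := by
    refine mul_le_mul_of_nonneg_right ?_ (by positivity)
    rw [sq]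
    exact mul_le_mul_of_nonneg_right hu.r_le hr.le
  have b13 := mul_le_mul_of_nonneg_left (add_le_add b1 b3) hr.le
  have b24 := mul_le_mul_of_nonneg_left (add_le_add b2 b4) (sq_nonneg r)
  linear_combination h1 + 1 / 2 * h2 + b13 + 1 / 2 * b24 + 1 / 2 * b5 + 1 / 2 * b6

theorem energy_nonneg (ha : 0 ≤ a) (hφ : ∀ j, 0 ≤ φ j) (v : ℤ → ℝ) : 0 ≤ energy a J φ v :=
  Finset.sum_nonneg fun j _ => mul_nonneg (hφ j) (by positivity)

end

/-- The local energy estimate: `Δt ∑ |u_{j+1} - u_j|² ≤ C` and `Δx ∑ |uⁿ⁺¹ - uⁿ|² ≤ C Δt / Δx`. -/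
theorem energy_estimate {f V F : ℝ → ℝ} {M B β δ A lo hi : ℝ} (hf : FluxBounds f V F M B lo hi)
    (hβ : 0 < β) (hδ : 0 < δ) (hlo : lo ≤ hi) (hA : 0 ≤ A) {R K T : ℝ} (hR0 : 0 ≤ R)
    (hK0 : 0 ≤ K) (hT0 : 0 ≤ T) :
    ∃ C, 0 ≤ C ∧ ∀ (J : ℤ) (h r a : ℝ) (φ κ : ℤ → ℝ) (N : ℕ) (u : ℕ → ℤ → ℝ),
      IsCutoff h J φ → IsFlow f V M β δ A lo hi κ h r a N u → (2 * J + 1) * h ≤ R →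
      r * h * N ≤ T →
      ∑ j ∈ Finset.Icc (-J) J, |κ (j + 1) - κ j| ≤ K →
      ∑ j ∈ Finset.Icc (-J) J, |κ j - κ (j - 1)| ≤ K →
      r * h * ∑ n ∈ Finset.range (N - 1), ∑ j ∈ Finset.Icc (-J) J,
          φ j * (u n (j + 1) - u n j) ^ 2 ≤ C ∧
        h * ∑ n ∈ Finset.range (N - 1), ∑ j ∈ Finset.Icc (-J) J,
          φ j * (u (n + 1) j - u n j) ^ 2 ≤ C * r := by
  have hmem : lo ∈ Icc lo hi := left_mem_Icc.2 hlo
  have hM := hf.M_nonneg hmem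
  have hB := hf.B_nonneg hmem
  set c := 4 * β * B + 2 * (M ^ 2 * (1 + 2 * B)) with hc
  have hc0 : 0 ≤ c := by positivity
  set C3 := (2 * A * c * B + (2 * β * B + M ^ 2 * (1 + 2 * B)) * B + B * M) * R + B * K
    + ((4 * A * c ^ 2 + 4 * β * B * c + 16 * M ^ 4 * B ^ 2) * R + 4 * M ^ 3 * K) with hC3
  have hC30 : 0 ≤ C3 := by positivity
  -- The initial energy plus the accumulated source, divided by the coefficient βδ of the remaining
  -- dissipation.
  set C1 := ((1 / 2 * B ^ 2 + 2 * A * B ^ 2) * R + C3 * T) / (β * δ) with hC1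
  have hC10 : 0 ≤ C1 := by positivity
  set C2 := (4 * A * c ^ 2 + 4 * B ^ 2 * (4 * β ^ 2 + 8 * M ^ 4)) * R + 8 * M ^ 3 * K with hC2
  have hC20 : 0 ≤ C2 := by positivity
  refine ⟨C1 + ((8 * β ^ 2 + 16 * M ^ 4) * C1 + C2 * T), by positivity, ?_⟩
  intro J h r a φ κ N u hφ hu hR hT hK hK'
  have hr := hu.r_pos
  have hh := hu.h_pos
  have hw : ∀ n, n + 1 < N → ∀ j, |u (n + 1) j - u n j| ≤ r * c := fun n hn j =>
    hu.abs_increment_le hf hβ.le hn j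
  set P : ℕ → ℝ := fun n => ∑ j ∈ Finset.Icc (-J) J, φ j * (u n (j + 1) - u n j) ^ 2 with hP
  have hcount : ∀ x, 0 ≤ x → r * h * ∑ _n ∈ Finset.range (N - 1), x ≤ x * T := by
    intro x hx
    rw [Finset.sum_const, Finset.card_range, nsmul_eq_mul]
    have : ((N - 1 : ℕ) : ℝ) ≤ N := by exact_mod_cast Nat.sub_le _ _
    calc r * h * (((N - 1 : ℕ) : ℝ) * x) ≤ r * h * (N * x) := by gcongr
      _ = x * (r * h * N) := by ring
      _ ≤ x * T := by gcongr
  have hJ1 : (0 : ℝ) ≤ 2 * J + 1 := by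
    exact_mod_cast (by linarith [hφ.J_nonneg] : (0 : ℤ) ≤ 2 * J + 1)
  have first : r * h * ∑ n ∈ Finset.range (N - 1), P n ≤ C1 := by
    rcases Nat.eq_zero_or_pos N with hN0 | hN
    · simp [hN0, hC10]
    have hE0 : h * energy a J φ (u 0) ≤ (1 / 2 * B ^ 2 + 2 * A * B ^ 2) * R := by
      have : energy a J φ (u 0) ≤ ∑ _j ∈ Finset.Icc (-J) J, (1 / 2 * B ^ 2 + 2 * A * B ^ 2) := by
        refine Finset.sum_le_sum fun j _ => ?_
        have m0 := hf.abs_id _ (hu.mem 0 hN j)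
        have m1 := abs_sub_le_two_mul (hf.abs_id _ (hu.mem 0 hN (j + 1))) m0
        have q0 := pow_le_pow_left₀ (abs_nonneg _) m0 2
        have q1 := pow_le_pow_left₀ (abs_nonneg _) m1 2
        rw [sq_abs] at q0 q1
        refine (mul_le_of_le_one_left ?_ (hφ.le_one j)).trans ?_
        · have := hu.a_pos
          positivity
        · have := mul_le_mul hu.a_le q1 (sq_nonneg _) hA
          linarith
      rw [sum_Icc_const hφ.J_nonneg] at this
      calc h * energy a J φ (u 0) ≤ h * _ := mul_le_mul_of_nonneg_left this hh.le
        _ = (1 / 2 * B ^ 2 + 2 * A * B ^ 2) * ((2 * J + 1) * h) := by ring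
        _ ≤ _ := by gcongr
    have hsum : ∑ n ∈ Finset.range (N - 1), (energy a J φ (u (n + 1)) - energy a J φ (u n))
        ≤ ∑ n ∈ Finset.range (N - 1), (-(r * β * δ) * P n + r * C3) := by
      refine Finset.sum_le_sum fun n hn => ?_
      have hn' : n + 1 < N := by have := Finset.mem_range.1 hn; lia
      exact energy_step hf hβ hφ hu hn' hc0 (hw n hn') hR hK hK'
    rw [Finset.sum_range_sub (fun n => energy a J φ (u n)), Finset.sum_add_distrib,
      ← Finset.mul_sum] at hsum
    have hEN := energy_nonneg (J := J) hu.a_pos.le hφ.nonneg (u (N - 1))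
    have hc3 := hcount C3 hC30
    rw [hC1, le_div_iff₀ (by positivity)]
    have e3 : ∑ _n ∈ Finset.range (N - 1), r * C3 = r * ∑ _n ∈ Finset.range (N - 1), C3 := by
      rw [Finset.mul_sum]
    rw [e3] at hsum
    have := mul_le_mul_of_nonneg_left hsum hh.le
    have hEN' := mul_nonneg hh.le hEN
    linear_combination this + hE0 + hc3 + hEN'
  have second : h * ∑ n ∈ Finset.range (N - 1), ∑ j ∈ Finset.Icc (-J) J,
      φ j * (u (n + 1) j - u n j) ^ 2 ≤ ((8 * β ^ 2 + 16 * M ^ 4) * C1 + C2 * T) * r := by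
    have hsum : ∑ n ∈ Finset.range (N - 1), ∑ j ∈ Finset.Icc (-J) J,
        φ j * (u (n + 1) j - u n j) ^ 2
        ≤ ∑ n ∈ Finset.range (N - 1), (r ^ 2 * (8 * β ^ 2 + 16 * M ^ 4) * P n + r ^ 2 * C2) := by
      refine Finset.sum_le_sum fun n hn => ?_
      have hn' : n + 1 < N := by have := Finset.mem_range.1 hn; lia
      have := sum_sq_increment_le hf hφ hu hn' (hw n hn')
      rw [← Finset.mul_sum, Finset.sum_add_distrib, Finset.sum_add_distrib, ← Finset.mul_sum,
        sum_Icc_const hφ.J_nonneg, ← Finset.mul_sum] at this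
      refine this.trans ?_
      have b1 : (2 * J + 1) * ((4 * A * c ^ 2 + 4 * B ^ 2 * (4 * β ^ 2 + 8 * M ^ 4)) * h)
          ≤ (4 * A * c ^ 2 + 4 * B ^ 2 * (4 * β ^ 2 + 8 * M ^ 4)) * R := by
        calc _ = (4 * A * c ^ 2 + 4 * B ^ 2 * (4 * β ^ 2 + 8 * M ^ 4)) * ((2 * J + 1) * h) := by ring
          _ ≤ _ := by gcongr
      have b2 : 8 * M ^ 3 * ∑ j ∈ Finset.Icc (-J) J, |κ j - κ (j - 1)| ≤ 8 * M ^ 3 * K := by gcongr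
      have b3 := mul_le_mul_of_nonneg_left (add_le_add b1 b2) (sq_nonneg r)
      linear_combination b3
    rw [Finset.sum_add_distrib, ← Finset.mul_sum] at hsum
    have e2 : ∑ _n ∈ Finset.range (N - 1), r ^ 2 * C2
        = r ^ 2 * ∑ _n ∈ Finset.range (N - 1), C2 := by rw [Finset.mul_sum]
    rw [e2] at hsum
    have h1 := mul_le_mul_of_nonneg_left hsum hh.le
    have h2 := mul_le_mul_of_nonneg_left first (by positivity : 0 ≤ r * (8 * β ^ 2 + 16 * M ^ 4))
    have h3 := mul_le_mul_of_nonneg_left (hcount C2 hC20) hr.le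
    linear_combination h1 + h2 + h3
  constructor
  · have : 0 ≤ (8 * β ^ 2 + 16 * M ^ 4) * C1 + C2 * T := by positivity
    linarith
  · refine second.trans (mul_le_mul_of_nonneg_right ?_ hr.le)
    linarith

/-! ### The entropy production of the scheme -/

/-- Grid functions `η`, `q` which behave like an entropy pair for the flux `κ f(u)` along the grid
function `u`, where `v` plays the part of `η'(u)`. -/
structure IsEntropyPair (f : ℝ → ℝ) (C : ℝ) (κ : ℤ → ℝ) (N : ℕ) (u v η q : ℕ → ℤ → ℝ) : Prop where
  v_le : ∀ n < N, ∀ j, |v n j| ≤ C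
  v_sub : ∀ n < N, ∀ j,
    |v n (j + 1) - v n j| ≤ C * (|u n (j + 1) - u n j| + |κ (j + 1) - κ j|)
  η_sub : ∀ n, n + 1 < N → ∀ j, |η (n + 1) j - η n j| ≤ C * |u (n + 1) j - u n j|
  η_taylor : ∀ n, n + 1 < N → ∀ j,
    |η (n + 1) j - η n j - v n j * (u (n + 1) j - u n j)| ≤ C * (u (n + 1) j - u n j) ^ 2
  q_le : ∀ n < N, ∀ j, |q n j| ≤ C
  q_sub : ∀ n < N, ∀ j,
    |q n j - q n (j - 1)| ≤ C * (|u n j - u n (j - 1)| + |κ j - κ (j - 1)|)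
  q_taylor : ∀ n < N, ∀ j,
    |q n j - q n (j - 1) - v n j * (κ j * f (u n j) - κ (j - 1) * f (u n (j - 1)))|
      ≤ C * ((u n j - u n (j - 1)) ^ 2 + |κ j - κ (j - 1)|)

/-- The flux of the regularizing terms of the scheme and of the flux defect. -/
noncomputable def defectFlux (f V : ℝ → ℝ) (β h r a : ℝ) (κ v w : ℤ → ℝ) (j : ℤ) : ℝ :=
  h * (r * (β * (v (j + 1) - v j) - (eoFlux f V κ v j - κ j * f (v j))) + a * (w (j + 1) - w j))

/-- The density of the entropy production that is controlled as a measure. -/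
noncomputable def measureDensity (r : ℝ) (κ v w : ℤ → ℝ) (j : ℤ) : ℝ :=
  (w j ^ 2 + w (j + 1) ^ 2) / r
    + r * (|κ j - κ (j - 1)| + |κ (j + 1) - κ j| + (v (j + 1) - v j) ^ 2 + (v j - v (j - 1)) ^ 2)

/-- The density of the entropy production that is controlled in `H⁻¹`. -/
noncomputable def dualDensity (r : ℝ) (κ v w : ℤ → ℝ) (j : ℤ) : ℝ :=
  |v (j + 1) - v j| + |v j - v (j - 1)| + |κ j - κ (j - 1)| + (|w j| + |w (j + 1)|) / r

section

variable {f V F : ℝ → ℝ} {M B β δ A lo hi : ℝ} {κ : ℤ → ℝ} {h r a : ℝ} {N : ℕ} {u : ℕ → ℤ → ℝ}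

theorem abs_defectFlux_le (hf : FluxBounds f V F M B lo hi) (hβ : 0 ≤ β)
    (hu : IsFlow f V M β δ A lo hi κ h r a N u) {n : ℕ} (hn : n < N) (w : ℤ → ℝ) (j : ℤ) :
    |defectFlux f V β h r a κ (u n) w j|
      ≤ (β + M ^ 2 + A) * (h * (r * |u n (j + 1) - u n j| + (|w j| + |w (j + 1)|))) := by
  have h1 := abs_eoFlux_sub_le hf hu.κ_le (hu.mem n hn) j
  have hh := hu.h_pos
  have hr := hu.r_pos
  have ha := hu.a_pos
  have hA := ha.le.trans hu.a_le
  have h2 : |w (j + 1) - w j| ≤ |w j| + |w (j + 1)| := (abs_sub _ _).trans (by rw [add_comm])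
  rw [defectFlux, abs_mul, abs_of_pos hh]
  set s := |u n (j + 1) - u n j| with hs
  have hs0 : 0 ≤ s := abs_nonneg _
  have hW : 0 ≤ |w j| + |w (j + 1)| := by positivity
  set W := |w j| + |w (j + 1)|
  have h3 : |r * (β * (u n (j + 1) - u n j) - (eoFlux f V κ (u n) j - κ j * f (u n j)))
      + a * (w (j + 1) - w j)| ≤ r * (β * s + M ^ 2 * s) + A * W := by
    refine (abs_add_le _ _).trans (add_le_add ?_ ?_)
    · rw [abs_mul, abs_of_pos hr]
      refine mul_le_mul_of_nonneg_left ((abs_sub _ _).trans (add_le_add ?_ h1)) hr.le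
      rw [abs_mul, abs_of_nonneg hβ]
    · rw [abs_mul, abs_of_pos ha]
      exact mul_le_mul hu.a_le h2 (abs_nonneg _) hA
  calc h * _ ≤ h * (r * (β * s + M ^ 2 * s) + A * W) := mul_le_mul_of_nonneg_left h3 hh.le
    _ ≤ _ := by
      have e1 : 0 ≤ h * (A * (r * s)) := by positivity
      have e2 : 0 ≤ h * (β * W) := by positivity
      have e3 : 0 ≤ h * (M ^ 2 * W) := by positivity
      linear_combination e1 + e2 + e3

/-- Bookkeeping for the next estimate. Writing w = r y removes the division by r. Products of
increments are bounded by squares. A product of y with a jump of κ is bounded by ι times the jump,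
and the square of a jump by the jump itself, so jumps enter to the first power only. -/
theorem density_arith {C S P h r ι s s' w w' k k' α ξ ξ' : ℝ} (hC : 0 ≤ C) (hS : 0 ≤ S)
    (hP : 0 ≤ P) (hh : 0 < h) (hr : 0 < r) (hr2 : r ≤ 2) (hι : 0 ≤ ι) (hs : 0 ≤ s) (hs' : 0 ≤ s')
    (hw : 0 ≤ w) (hw' : 0 ≤ w') (hk : 0 ≤ k) (hk' : 0 ≤ k') (hα : 0 ≤ α) (hξ : 0 ≤ ξ) (hξ' : 0 ≤ ξ')
    (hwι : w ≤ r * ι) (hwι' : w' ≤ r * ι) (hk1 : k' ≤ 1) :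
    C * w * α + C * (s' + k) * ξ + h * (S * (C * w ^ 2)) + r * h * (S * (C * (s' ^ 2 + k)))
        + (P * (h * (r * s + (w + w'))) * ((ξ + ξ') / (r * h) * C)
          + P * (h * (r * s + (w + w'))) * (S * (C * (s + k'))))
      ≤ C * (3 + 4 * P * (1 + ι)) * (S * (h * ((w ^ 2 + w' ^ 2) / r
          + r * (k + k' + s ^ 2 + s' ^ 2)))
        + (s + s' + k + (w + w') / r) * (α + ξ + ξ')) := by
  obtain ⟨y, rfl⟩ : ∃ y, w = r * y := ⟨w / r, by field_simp⟩
  obtain ⟨y', rfl⟩ : ∃ y, w' = r * y := ⟨w' / r, by field_simp⟩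
  have hy : 0 ≤ y := nonneg_of_mul_nonneg_right hw hr
  have hy' : 0 ≤ y' := nonneg_of_mul_nonneg_right hw' hr
  have hyι : y ≤ ι := le_of_mul_le_mul_left hwι hr
  have hyι' : y' ≤ ι := le_of_mul_le_mul_left hwι' hr
  have e1 : P * (h * (r * s + (r * y + r * y'))) * ((ξ + ξ') / (r * h) * C)
      = C * (P * (s + y + y') * (ξ + ξ')) := by field_simp; ring
  have e2 : ((r * y) ^ 2 + (r * y') ^ 2) / r = r * (y ^ 2 + y' ^ 2) := by field_simp
  have e3 : (r * y + r * y') / r = y + y' := by field_simp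
  rw [e1, e2, e3]
  have d1 : r * y * α + (s' + k) * ξ + P * (s + y + y') * (ξ + ξ')
      ≤ (3 + 4 * P * (1 + ι)) * ((s + s' + k + (y + y')) * (α + ξ + ξ')) := by
    have h1 : r * y * α ≤ 2 * (y * α) := by
      have := mul_le_mul_of_nonneg_right hr2 (mul_nonneg hy hα)
      linarith
    have h2 : y * α ≤ (s + s' + k + (y + y')) * (α + ξ + ξ') :=
      mul_le_mul (by linarith) (by linarith) hα (by positivity)
    have h3 : (s' + k) * ξ ≤ (s + s' + k + (y + y')) * (α + ξ + ξ') :=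
      mul_le_mul (by linarith) (by linarith) hξ (by positivity)
    have h4 : (s + y + y') * (ξ + ξ') ≤ (s + s' + k + (y + y')) * (α + ξ + ξ') :=
      mul_le_mul (by linarith) (by linarith) (by positivity) (by positivity)
    have h5 := mul_le_mul_of_nonneg_left h4 hP
    have h6 : 0 ≤ P * (3 + 4 * ι) * ((s + s' + k + (y + y')) * (α + ξ + ξ')) := by positivity
    linarith
  have d2 : r * y ^ 2 + (s' ^ 2 + k) + P * ((s + (y + y')) * (s + k'))
      ≤ (3 + 4 * P * (1 + ι)) * ((y ^ 2 + y' ^ 2) + (k + k' + s ^ 2 + s' ^ 2)) := by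
    have h1 : r * y ^ 2 ≤ 2 * y ^ 2 := mul_le_mul_of_nonneg_right hr2 (sq_nonneg y)
    have h2 : (s + (y + y')) * (s + k') ≤ 4 * (1 + ι) * ((y ^ 2 + y' ^ 2) + (k + k' + s ^ 2 + s' ^ 2)) := by
      have g1 : k' ^ 2 ≤ k' := by nlinarith
      have g2 : y * k' ≤ ι * k' := mul_le_mul_of_nonneg_right hyι hk'
      have g3 : y' * k' ≤ ι * k' := mul_le_mul_of_nonneg_right hyι' hk'
      have g4 : 0 ≤ ι * ((y ^ 2 + y' ^ 2) + (k + s ^ 2 + s' ^ 2)) := by positivity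
      have g5 : 0 ≤ ι * k' := by positivity
      linarith [sq_nonneg (s - k'), sq_nonneg (s - y), sq_nonneg (s - y'), sq_nonneg y,
        sq_nonneg y', sq_nonneg s, sq_nonneg s']
    have h3 := mul_le_mul_of_nonneg_left h2 hP
    linarith [sq_nonneg y', sq_nonneg y, sq_nonneg s, sq_nonneg s']
  have d1' := mul_le_mul_of_nonneg_left d1 hC
  have d2' := mul_le_mul_of_nonneg_left d2 (by positivity : 0 ≤ C * (S * (h * r)))
  linear_combination d1' + d2'

/-- The added term in ψ v times the defect flux is a discrete divergence. Expanding it cancels,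
through the scheme, the first order parts of the increments of η and q once the edge integrals are
replaced by hψ and rhψ. The errors are: edge against cell average, Taylor remainders, and the defect
flux times the increment of ψ v. -/
theorem production_density_le {ι : ℝ} (hf : FluxBounds f V F M B lo hi) (hβ : 0 ≤ β)
    (hu : IsFlow f V M β δ A lo hi κ h r a N u) {C : ℝ} {v η q : ℕ → ℤ → ℝ}
    (hη : IsEntropyPair f C κ N u v η q) {D S : ℝ} {L : ℕ} {J : ℤ} {ea eb ψ α ξ : ℕ → ℤ → ℝ}
    (hφ : IsGridTest h (r * h) D S L J ea eb ψ α ξ) {n : ℕ} (hn : n + 1 < N) (hι0 : 0 ≤ ι)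
    (hι : ∀ j, |u (n + 1) j - u n j| ≤ r * ι) (j : ℤ) :
    |-(η (n + 1) j - η n j) * ea (n + 1) j - (q n j - q n (j - 1)) * eb n j
        + (ψ n (j + 1) * v n (j + 1)
            * defectFlux f V β h r a κ (u n) (fun i => u (n + 1) i - u n i) j
          - ψ n j * v n j
            * defectFlux f V β h r a κ (u n) (fun i => u (n + 1) i - u n i) (j - 1))|
      ≤ C * (3 + 4 * (β + M ^ 2 + A) * (1 + ι))
          * (S * (h * measureDensity r κ (u n) (fun i => u (n + 1) i - u n i) j)
            + dualDensity r κ (u n) (fun i => u (n + 1) i - u n i) j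
              * (α n j + ξ n j + ξ n (j + 1))) := by
  have hn' : n < N := by lia
  have hh := hu.h_pos
  have hr := hu.r_pos
  have ha := hu.a_pos
  have hA := ha.le.trans hu.a_le
  have hp := abs_defectFlux_le hf hβ hu hn' (fun i => u (n + 1) i - u n i) j
  set p := defectFlux f V β h r a κ (u n) (fun i => u (n + 1) i - u n i) with hpdef
  have hC : 0 ≤ C := (abs_nonneg _).trans (hη.v_le n hn' j)
  have hS : 0 ≤ S := (abs_nonneg _).trans (hφ.bound n j)
  -- The scheme in conservation form: the difference of the defect flux is h times the residual of
  -- the unregularized equation with flux κ f(u).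
  have hpp : p j - p (j - 1) = h * ((u (n + 1) j - u n j)
      + r * (κ j * f (u n j) - κ (j - 1) * f (u n (j - 1)))) := by
    have := hu.step n hn j
    simp only [hpdef, defectFlux, sub_add_cancel]
    linear_combination (-h) * this
  have hκ2 : |κ (j + 1) - κ j| ≤ 1 := (abs_sub_le_two_mul (hu.κ_le _) (hu.κ_le _)).trans hu.M_le
  have e1 := hφ.edge_t n j
  have e2 := hφ.edge_left n j
  have e3 := hφ.edge_right n j
  have e4 := hφ.edge_left n (j + 1)
  -- Neighbouring averages are compared through the integral over their common edge.
  have hψ : |ψ n (j + 1) - ψ n j| ≤ (ξ n j + ξ n (j + 1)) / (r * h) := by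
    rw [le_div_iff₀ (by positivity)]
    refine le_trans (le_of_eq ?_) (?_ : |r * h * (ψ n (j + 1) - ψ n j)| ≤ _)
    · rw [abs_mul, abs_of_pos (by positivity : 0 < r * h), mul_comm]
    have : r * h * (ψ n (j + 1) - ψ n j)
      = (eb n (j + 1) - r * h * ψ n j) - (eb n (j + 1) - r * h * ψ n (j + 1)) := by ring
    rw [this]
    exact (abs_sub _ _).trans (add_le_add e3 e4)
  have hα0 := (abs_nonneg _).trans e1
  have hξ0 := (abs_nonneg _).trans e2
  have hξ1 := (abs_nonneg _).trans e4
  have g1 := hη.η_sub n hn j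
  have g2 := hη.η_taylor n hn j
  have g3 := hη.q_sub n hn' j
  have g4 := hη.q_taylor n hn' j
  have g5 := hη.v_sub n hn' j
  have g6 := hη.v_le n hn' (j + 1)
  have hwι := hι j
  have hwι' := hι (j + 1)
  -- the decomposition
  have dec : -(η (n + 1) j - η n j) * ea (n + 1) j - (q n j - q n (j - 1)) * eb n j
        + (ψ n (j + 1) * v n (j + 1) * p j - ψ n j * v n j * p (j - 1))
      = -((η (n + 1) j - η n j) * (ea (n + 1) j - h * ψ n j))
        - (q n j - q n (j - 1)) * (eb n j - r * h * ψ n j)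
        - h * (ψ n j * (η (n + 1) j - η n j - v n j * (u (n + 1) j - u n j)))
        - r * h * (ψ n j * (q n j - q n (j - 1)
          - v n j * (κ j * f (u n j) - κ (j - 1) * f (u n (j - 1)))))
        + (p j * ((ψ n (j + 1) - ψ n j) * v n (j + 1)) + p j * (ψ n j * (v n (j + 1) - v n j))) := by
    linear_combination ψ n j * v n j * hpp
  rw [dec, measureDensity, dualDensity]
  rw [← sq_abs (u n (j + 1) - u n j), ← sq_abs (u n j - u n (j - 1)),
    ← sq_abs (u (n + 1) j - u n j), ← sq_abs (u (n + 1) (j + 1) - u n (j + 1))]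
  rw [← sq_abs (u (n + 1) j - u n j)] at g2
  rw [← sq_abs (u n j - u n (j - 1))] at g4
  have b1 : |(η (n + 1) j - η n j) * (ea (n + 1) j - h * ψ n j)|
      ≤ C * |u (n + 1) j - u n j| * α n j := by
    rw [abs_mul]; exact mul_le_mul g1 e1 (abs_nonneg _) (by positivity)
  have b2 : |(q n j - q n (j - 1)) * (eb n j - r * h * ψ n j)|
      ≤ C * (|u n j - u n (j - 1)| + |κ j - κ (j - 1)|) * ξ n j := by
    rw [abs_mul]; exact mul_le_mul g3 e2 (abs_nonneg _) (by positivity)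
  have b3 : |ψ n j * (η (n + 1) j - η n j - v n j * (u (n + 1) j - u n j))|
      ≤ S * (C * |u (n + 1) j - u n j| ^ 2) := by
    rw [abs_mul]; exact mul_le_mul (hφ.bound n j) g2 (abs_nonneg _) hS
  have b4 : |ψ n j * (q n j - q n (j - 1)
      - v n j * (κ j * f (u n j) - κ (j - 1) * f (u n (j - 1))))|
      ≤ S * (C * (|u n j - u n (j - 1)| ^ 2 + |κ j - κ (j - 1)|)) := by
    rw [abs_mul]; exact mul_le_mul (hφ.bound n j) g4 (abs_nonneg _) hS
  have b5 : |p j * ((ψ n (j + 1) - ψ n j) * v n (j + 1))| ≤ (β + M ^ 2 + A)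
      * (h * (r * |u n (j + 1) - u n j| + (|u (n + 1) j - u n j|
        + |u (n + 1) (j + 1) - u n (j + 1)|))) * ((ξ n j + ξ n (j + 1)) / (r * h) * C) := by
    rw [abs_mul, abs_mul]
    exact mul_le_mul hp (mul_le_mul hψ g6 (abs_nonneg _) (by positivity)) (by positivity)
      (by positivity)
  have b6 : |p j * (ψ n j * (v n (j + 1) - v n j))| ≤ (β + M ^ 2 + A)
      * (h * (r * |u n (j + 1) - u n j| + (|u (n + 1) j - u n j|
        + |u (n + 1) (j + 1) - u n (j + 1)|)))
        * (S * (C * (|u n (j + 1) - u n j| + |κ (j + 1) - κ j|))) := by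
    rw [abs_mul, abs_mul]
    exact mul_le_mul hp (mul_le_mul (hφ.bound n j) g5 (abs_nonneg _) hS) (by positivity)
      (by positivity)
  have key := density_arith (P := β + M ^ 2 + A) hC hS (by positivity) hh hr hu.r_le hι0
    (abs_nonneg (u n (j + 1) - u n j)) (abs_nonneg (u n j - u n (j - 1)))
    (abs_nonneg (u (n + 1) j - u n j)) (abs_nonneg (u (n + 1) (j + 1) - u n (j + 1)))
    (abs_nonneg (κ j - κ (j - 1))) (abs_nonneg (κ (j + 1) - κ j)) hα0 hξ0 hξ1 hwι hwι' hκ2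
  refine le_trans ?_ key
  have t1 := abs_add_le (-((η (n + 1) j - η n j) * (ea (n + 1) j - h * ψ n j))
        - (q n j - q n (j - 1)) * (eb n j - r * h * ψ n j)
        - h * (ψ n j * (η (n + 1) j - η n j - v n j * (u (n + 1) j - u n j)))
        - r * h * (ψ n j * (q n j - q n (j - 1)
          - v n j * (κ j * f (u n j) - κ (j - 1) * f (u n (j - 1))))))
    (p j * ((ψ n (j + 1) - ψ n j) * v n (j + 1)) + p j * (ψ n j * (v n (j + 1) - v n j)))
  refine t1.trans (add_le_add ((abs_sub _ _).trans (add_le_add ((abs_sub _ _).trans (add_le_add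
    ((abs_sub _ _).trans (add_le_add (by rwa [abs_neg]) b2)) ?_)) ?_))
    ((abs_add_le _ _).trans (add_le_add b5 b6)))
  · rw [abs_mul, abs_of_pos hh]
    exact mul_le_mul_of_nonneg_left b3 hh.le
  · rw [abs_mul, abs_of_pos (by positivity : 0 < r * h)]
    exact mul_le_mul_of_nonneg_left b4 (by positivity)

end

/-! ### Summing the entropy production over the grid -/

theorem sum_range_mul_sub (x y : ℕ → ℝ) (L : ℕ) :
    ∑ n ∈ Finset.range (L + 1), x n * (y (n + 1) - y n)
      = x L * y (L + 1) - x 0 * y 0 - ∑ n ∈ Finset.range L, (x (n + 1) - x n) * y (n + 1) := by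
  induction L with
  | zero => simp; ring
  | succ L ih => rw [Finset.sum_range_succ, ih, Finset.sum_range_succ _ L]; ring

theorem sum_sum_mul_le_sqrt {L : ℕ} {A : Finset ℤ} {x y : ℕ → ℤ → ℝ} {X Y : ℝ}
    (hX : ∑ n ∈ Finset.range L, ∑ j ∈ A, x n j ^ 2 ≤ X)
    (hY : ∑ n ∈ Finset.range L, ∑ j ∈ A, y n j ^ 2 ≤ Y) :
    ∑ n ∈ Finset.range L, ∑ j ∈ A, x n j * y n j ≤ √(X * Y) := by
  rw [← Finset.sum_product'] at hX hY ⊢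
  have hX0 : 0 ≤ X := (Finset.sum_nonneg fun i _ => sq_nonneg _).trans hX
  refine (Real.sum_mul_le_sqrt_mul_sqrt _ (fun i : ℕ × ℤ => x i.1 i.2)
    (fun i : ℕ × ℤ => y i.1 i.2)).trans ?_
  rw [Real.sqrt_mul hX0]
  exact mul_le_mul (Real.sqrt_le_sqrt hX) (Real.sqrt_le_sqrt hY) (Real.sqrt_nonneg _)
    (Real.sqrt_nonneg _)

theorem sum_sum_mono_range {L : ℕ} {A : Finset ℤ} {x : ℕ → ℤ → ℝ} (hx : ∀ n j, 0 ≤ x n j) :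
    ∑ n ∈ Finset.range L, ∑ j ∈ A, x n j ≤ ∑ n ∈ Finset.range (L + 1), ∑ j ∈ A, x n j :=
  Finset.sum_le_sum_of_subset_of_nonneg (Finset.range_mono (Nat.le_succ L))
    fun n _ _ => Finset.sum_nonneg fun j _ => hx n j

section

variable {f V F : ℝ → ℝ} {M B β δ A lo hi : ℝ} {κ : ℤ → ℝ} {h r a : ℝ} {L : ℕ} {u : ℕ → ℤ → ℝ}

/-- Each of the four quadratic terms contributes E by the energy estimate, and each of the two
variation terms contributes K per unit of time. -/
theorem sum_measureDensity_le {J : ℤ} (hr : 0 < r) (hh : 0 < h) {E K T : ℝ}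
    (hT : r * h * L ≤ T)
    (hK : ∑ j ∈ Finset.Icc (-J) J, |κ (j + 1) - κ j| ≤ K)
    (hK' : ∑ j ∈ Finset.Icc (-J) J, |κ j - κ (j - 1)| ≤ K)
    (hs : r * h * ∑ n ∈ Finset.range L, ∑ j ∈ Finset.Icc (-J) J,
      (u n (j + 1) - u n j) ^ 2 ≤ E)
    (hs' : r * h * ∑ n ∈ Finset.range L, ∑ j ∈ Finset.Icc (-J) J,
      (u n j - u n (j - 1)) ^ 2 ≤ E)
    (hw : h * ∑ n ∈ Finset.range L, ∑ j ∈ Finset.Icc (-J) J,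
      (u (n + 1) j - u n j) ^ 2 ≤ E * r)
    (hw' : h * ∑ n ∈ Finset.range L, ∑ j ∈ Finset.Icc (-J) J,
      (u (n + 1) (j + 1) - u n (j + 1)) ^ 2 ≤ E * r) :
    h * ∑ n ∈ Finset.range L, ∑ j ∈ Finset.Icc (-J) J,
      measureDensity r κ (u n) (fun i => u (n + 1) i - u n i) j ≤ 4 * E + 2 * (K * T) := by
  have e : ∀ n j, measureDensity r κ (u n) (fun i => u (n + 1) i - u n i) j
      = 1 / r * (u (n + 1) j - u n j) ^ 2 + 1 / r * (u (n + 1) (j + 1) - u n (j + 1)) ^ 2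
        + (r * |κ j - κ (j - 1)| + r * |κ (j + 1) - κ j|
        + r * (u n (j + 1) - u n j) ^ 2 + r * (u n j - u n (j - 1)) ^ 2) := fun n j => by
    rw [measureDensity]; ring
  simp only [e, Finset.sum_add_distrib, ← Finset.mul_sum]
  rw [Finset.sum_const, Finset.sum_const, Finset.card_range, nsmul_eq_mul, nsmul_eq_mul]
  have k1 : r * h * L * (∑ j ∈ Finset.Icc (-J) J, |κ j - κ (j - 1)|) ≤ T * K :=
    mul_le_mul hT hK' (Finset.sum_nonneg fun j _ => abs_nonneg _)
      ((by positivity : 0 ≤ r * h * L).trans hT)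
  have k2 : r * h * L * (∑ j ∈ Finset.Icc (-J) J, |κ (j + 1) - κ j|) ≤ T * K :=
    mul_le_mul hT hK (Finset.sum_nonneg fun j _ => abs_nonneg _)
      ((by positivity : 0 ≤ r * h * L).trans hT)
  have w1 := mul_le_mul_of_nonneg_left hw (by positivity : 0 ≤ 1 / r)
  have w2 := mul_le_mul_of_nonneg_left hw' (by positivity : 0 ≤ 1 / r)
  have e1 : 1 / r * (E * r) = E := by field_simp
  rw [e1] at w1 w2
  linear_combination k1 + k2 + w1 + w2 + hs + hs'

/-- The square of a sum of five terms is at most five times the sum of the squares. After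
multiplication by rh, each of the four increments contributes E. The jumps of κ are at most 1, so
their squares are bounded by the variation. -/
theorem sum_sq_dualDensity_le {J : ℤ} (hr : 0 < r) (hh : 0 < h) {E K T : ℝ}
    (hT : r * h * L ≤ T) (hκ : ∀ j, |κ j - κ (j - 1)| ≤ 1)
    (hK' : ∑ j ∈ Finset.Icc (-J) J, |κ j - κ (j - 1)| ≤ K)
    (hs : r * h * ∑ n ∈ Finset.range L, ∑ j ∈ Finset.Icc (-J) J,
      (u n (j + 1) - u n j) ^ 2 ≤ E)
    (hs' : r * h * ∑ n ∈ Finset.range L, ∑ j ∈ Finset.Icc (-J) J,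
      (u n j - u n (j - 1)) ^ 2 ≤ E)
    (hw : h * ∑ n ∈ Finset.range L, ∑ j ∈ Finset.Icc (-J) J,
      (u (n + 1) j - u n j) ^ 2 ≤ E * r)
    (hw' : h * ∑ n ∈ Finset.range L, ∑ j ∈ Finset.Icc (-J) J,
      (u (n + 1) (j + 1) - u n (j + 1)) ^ 2 ≤ E * r) :
    ∑ n ∈ Finset.range L, ∑ j ∈ Finset.Icc (-J) J,
      dualDensity r κ (u n) (fun i => u (n + 1) i - u n i) j ^ 2
        ≤ 5 * (4 * E + K * T) / (r * h) := by
  have e : ∀ n j, dualDensity r κ (u n) (fun i => u (n + 1) i - u n i) j ^ 2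
      ≤ 5 * (u n (j + 1) - u n j) ^ 2 + 5 * (u n j - u n (j - 1)) ^ 2 + 5 * |κ j - κ (j - 1)|
        + (5 / r ^ 2 * (u (n + 1) j - u n j) ^ 2
          + 5 / r ^ 2 * (u (n + 1) (j + 1) - u n (j + 1)) ^ 2) := fun n j => by
    rw [dualDensity]
    have h1 := hκ j
    rw [← sq_abs (u n (j + 1) - u n j), ← sq_abs (u n j - u n (j - 1)),
      ← sq_abs (u (n + 1) j - u n j), ← sq_abs (u (n + 1) (j + 1) - u n (j + 1))]
    have e1 : ∀ x : ℝ, 5 / r ^ 2 * x ^ 2 = 5 * (x / r) ^ 2 := fun x => by field_simp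
    rw [e1, e1, add_div]
    generalize |u n (j + 1) - u n j| = x1
    generalize |u n j - u n (j - 1)| = x2
    generalize |u (n + 1) j - u n j| / r = x4
    generalize |u (n + 1) (j + 1) - u n (j + 1)| / r = x5
    have h2 : |κ j - κ (j - 1)| ^ 2 ≤ |κ j - κ (j - 1)| := by
      rw [sq]; exact mul_le_of_le_one_left (abs_nonneg _) h1
    generalize |κ j - κ (j - 1)| = x3 at h2 ⊢
    linarith [sq_nonneg (x1 - x2), sq_nonneg (x1 - x3), sq_nonneg (x1 - x4), sq_nonneg (x1 - x5),
      sq_nonneg (x2 - x3), sq_nonneg (x2 - x4), sq_nonneg (x2 - x5), sq_nonneg (x3 - x4),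
      sq_nonneg (x3 - x5), sq_nonneg (x4 - x5)]
  refine (Finset.sum_le_sum fun n _ => Finset.sum_le_sum fun j _ => e n j).trans ?_
  simp only [Finset.sum_add_distrib, ← Finset.mul_sum]
  rw [Finset.sum_const, Finset.card_range, nsmul_eq_mul, le_div_iff₀ (by positivity)]
  have k1 : r * h * L * (∑ j ∈ Finset.Icc (-J) J, |κ j - κ (j - 1)|) ≤ T * K :=
    mul_le_mul hT hK' (Finset.sum_nonneg fun j _ => abs_nonneg _)
      ((by positivity : 0 ≤ r * h * L).trans hT)
  have w1 := mul_le_mul_of_nonneg_left hw (by positivity : 0 ≤ 5 / r)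
  have w2 := mul_le_mul_of_nonneg_left hw' (by positivity : 0 ≤ 5 / r)
  have e1 : 5 / r * (E * r) = 5 * E := by field_simp
  have e2 : 5 / r ^ 2 * r = 5 / r := by field_simp
  rw [e1] at w1 w2
  generalize ∑ n ∈ Finset.range L, ∑ j ∈ Finset.Icc (-J) J, (u (n + 1) j - u n j) ^ 2 = W1 at *
  generalize ∑ n ∈ Finset.range L, ∑ j ∈ Finset.Icc (-J) J,
    (u (n + 1) (j + 1) - u n (j + 1)) ^ 2 = W2 at *
  linear_combination 5 * k1 + w1 + w2 + 5 * hs + 5 * hs' + h * (W1 + W2) * e2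

/-- The entropy production of the scheme tested with a test function: a part that is bounded by the
supremum norm of the test function, and a part that is small in `H⁻¹`. -/
theorem production_bound {ι : ℝ} (hf : FluxBounds f V F M B lo hi) (hβ : 0 ≤ β)
    (hu : IsFlow f V M β δ A lo hi κ h r a (L + 1) u) {C : ℝ} {v η q : ℕ → ℤ → ℝ}
    (hη : IsEntropyPair f C κ (L + 1) u v η q) {D S : ℝ} {J : ℤ} {ea eb ψ α ξ : ℕ → ℤ → ℝ}
    (hφ : IsGridTest h (r * h) D S (L + 1) J ea eb ψ α ξ) (hι0 : 0 ≤ ι)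
    (hι : ∀ n < L, ∀ j, |u (n + 1) j - u n j| ≤ r * ι) (hJ : 0 ≤ J) (hD : 0 ≤ D)
    {E K T R : ℝ} (hK0 : 0 ≤ K) (hT : r * h * L ≤ T) (hR : (2 * J + 1) * h ≤ R)
    (hK : ∑ j ∈ Finset.Icc (-J) J, |κ (j + 1) - κ j| ≤ K)
    (hK' : ∑ j ∈ Finset.Icc (-J) J, |κ j - κ (j - 1)| ≤ K)
    (hs : r * h * ∑ n ∈ Finset.range L, ∑ j ∈ Finset.Icc (-J) J,
      (u n (j + 1) - u n j) ^ 2 ≤ E)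
    (hs' : r * h * ∑ n ∈ Finset.range L, ∑ j ∈ Finset.Icc (-J) J,
      (u n j - u n (j - 1)) ^ 2 ≤ E)
    (hw : h * ∑ n ∈ Finset.range L, ∑ j ∈ Finset.Icc (-J) J,
      (u (n + 1) j - u n j) ^ 2 ≤ E * r)
    (hw' : h * ∑ n ∈ Finset.range L, ∑ j ∈ Finset.Icc (-J) J,
      (u (n + 1) (j + 1) - u n (j + 1)) ^ 2 ≤ E * r) :
    |∑ n ∈ Finset.range (L + 1), ∑ j ∈ Finset.Icc (-J) J,
        (η n j * (ea (n + 1) j - ea n j) + q n j * (eb n (j + 1) - eb n j))|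
      ≤ C * (3 + 4 * (β + M ^ 2 + A) * (1 + ι)) * (S * (4 * E + 2 * (K * T))
          + √(45 * (4 * E + K * T)) * (√h * D)) + 2 * C * √(2 * R) * (√h * D) := by
  have hh := hu.h_pos
  have hr := hu.r_pos
  have hA := hu.a_pos.le.trans hu.a_le
  have hC : 0 ≤ C := (abs_nonneg _).trans (hη.v_le 0 (Nat.succ_pos _) 0)
  have hS : 0 ≤ S := (abs_nonneg _).trans (hφ.bound 0 0)
  have hJr : (0 : ℝ) ≤ J := by exact_mod_cast hJ
  set I := Finset.Icc (-J) J with hI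
  set P := C * (3 + 4 * (β + M ^ 2 + A) * (1 + ι)) with hP
  have hP0 : 0 ≤ P := by positivity
  -- summation by parts
  set Y : ℕ → ℤ → ℝ := fun n j => -(η (n + 1) j - η n j) * ea (n + 1) j
    - (q n j - q n (j - 1)) * eb n j
        + (ψ n (j + 1) * v n (j + 1)
            * defectFlux f V β h r a κ (u n) (fun i => u (n + 1) i - u n i) j
          - ψ n j * v n j
            * defectFlux f V β h r a κ (u n) (fun i => u (n + 1) i - u n i) (j - 1)) with hY
  have hψ1 : ∀ n, ψ n (J + 1) = 0 := fun n =>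
    hφ.supp_ψ n _ ((by lia : J ≤ J + 1).trans (le_abs_self _))
  have hψ0 : ∀ n, ψ n (-J) = 0 := fun n => hφ.supp_ψ n _ (by rw [abs_neg]; exact le_abs_self _)
  have hb0 : ∀ n, eb n (-J) = 0 := fun n => hφ.supp_b n _ (by rw [abs_neg]; exact le_abs_self _)
  -- In time the boundary terms vanish because φ does at t = 0 and t = T. The flux sum has one level
  -- more than the sum of time increments, and level L is left over. The defect terms in Y telescope
  -- to zero.
  have parts : ∑ n ∈ Finset.range (L + 1), ∑ j ∈ I,
        (η n j * (ea (n + 1) j - ea n j) + q n j * (eb n (j + 1) - eb n j))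
      = (∑ n ∈ Finset.range L, ∑ j ∈ I, Y n j) + ∑ j ∈ I, q L j * (eb L (j + 1) - eb L j) := by
    have t1 : ∑ n ∈ Finset.range (L + 1), ∑ j ∈ I, η n j * (ea (n + 1) j - ea n j)
        = -∑ n ∈ Finset.range L, ∑ j ∈ I, (η (n + 1) j - η n j) * ea (n + 1) j := by
      rw [Finset.sum_comm, Finset.sum_comm (s := Finset.range L), ← Finset.sum_neg_distrib]
      refine Finset.sum_congr rfl fun j _ => ?_
      rw [sum_range_mul_sub (fun n => η n j) (fun n => ea n j), hφ.bot, hφ.top]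
      simp
    have t2 : ∀ n, ∑ j ∈ I, q n j * (eb n (j + 1) - eb n j)
        = -∑ j ∈ I, (q n j - q n (j - 1)) * eb n j := by
      intro n
      have := sum_Icc_telescope (fun j => q n (j - 1) * eb n j) (by lia : -J ≤ J)
      rw [hφ.supp_b_succ, hb0] at this
      rw [eq_neg_iff_add_eq_zero, ← Finset.sum_add_distrib]
      refine (Finset.sum_congr rfl fun j _ => ?_).trans (this.trans (by simp))
      simp only [add_sub_cancel_right]
      ring
    have t3 : ∀ n, ∑ j ∈ I, (ψ n (j + 1) * v n (j + 1)
            * defectFlux f V β h r a κ (u n) (fun i => u (n + 1) i - u n i) j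
          - ψ n j * v n j
            * defectFlux f V β h r a κ (u n) (fun i => u (n + 1) i - u n i) (j - 1)) = 0 := by
      intro n
      have := sum_Icc_telescope (fun j => ψ n j * v n j
        * defectFlux f V β h r a κ (u n) (fun i => u (n + 1) i - u n i) (j - 1))
        (by lia : -J ≤ J)
      simpa [hψ1, hψ0] using this
    have t4 : ∀ n, ∑ j ∈ I, Y n j = -∑ j ∈ I, (η (n + 1) j - η n j) * ea (n + 1) j
        + ∑ j ∈ I, q n j * (eb n (j + 1) - eb n j) := by
      intro n
      rw [hY]
      simp only []
      rw [Finset.sum_add_distrib, t3, Finset.sum_sub_distrib, t2 n, add_zero, sub_eq_add_neg]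
      simp only [neg_mul, Finset.sum_neg_distrib]
    simp only [Finset.sum_add_distrib, t4]
    rw [t1, Finset.sum_range_succ (fun n => ∑ j ∈ I, q n j * (eb n (j + 1) - eb n j)),
      Finset.sum_neg_distrib]
    ring
  have hα0 : ∀ n j, 0 ≤ α n j := fun n j => (abs_nonneg _).trans (hφ.edge_t n j)
  have hξ0 : ∀ n j, 0 ≤ ξ n j := fun n j => (abs_nonneg _).trans (hφ.edge_left n j)
  have hκ1 : ∀ j, |κ j - κ (j - 1)| ≤ 1 := fun j =>
    (abs_sub_le_two_mul (hu.κ_le _) (hu.κ_le _)).trans hu.M_le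
  have hΘ : ∑ n ∈ Finset.range L, ∑ j ∈ I, (α n j + ξ n j + ξ n (j + 1)) ^ 2
      ≤ 9 * (h * (r * h) * D ^ 2) := by
    have e : ∀ n j, (α n j + ξ n j + ξ n (j + 1)) ^ 2
        ≤ 3 * α n j ^ 2 + 3 * ξ n j ^ 2 + 3 * ξ n (j + 1) ^ 2 := fun n j => by
      linarith [sq_nonneg (α n j - ξ n j), sq_nonneg (α n j - ξ n (j + 1)),
        sq_nonneg (ξ n j - ξ n (j + 1))]
    refine (Finset.sum_le_sum fun n _ => Finset.sum_le_sum fun j _ => e n j).trans ?_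
    simp only [Finset.sum_add_distrib, ← Finset.mul_sum]
    have s1 := (sum_sum_mono_range (L := L) (A := I) (x := fun n j => α n j ^ 2)
      fun n j => sq_nonneg _).trans (hφ.sum_t I)
    have s2 := (sum_sum_mono_range (L := L) (A := I) (x := fun n j => ξ n j ^ 2)
      fun n j => sq_nonneg _).trans (hφ.sum_x I)
    -- The right neighbour ξ n (j + 1) needs the shifted index set; for this reason `sum_x` is
    -- available for every finite set.
    have s3 := (sum_sum_mono_range (L := L) (A := I.map (addRightEmbedding 1))
      (x := fun n j => ξ n j ^ 2) fun n j => sq_nonneg _).trans (hφ.sum_x _)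
    simp only [Finset.sum_map, addRightEmbedding_apply] at s3
    linarith
  have hbody : |∑ n ∈ Finset.range L, ∑ j ∈ I, Y n j|
      ≤ P * (S * (4 * E + 2 * (K * T)) + √(45 * (4 * E + K * T)) * (√h * D)) := by
    have hpt : ∀ n ∈ Finset.range L, ∀ j ∈ I, |Y n j|
        ≤ P * (S * (h * measureDensity r κ (u n) (fun i => u (n + 1) i - u n i) j)
            + dualDensity r κ (u n) (fun i => u (n + 1) i - u n i) j
              * (α n j + ξ n j + ξ n (j + 1))) := fun n hn j _ => by
      have hn' := Finset.mem_range.1 hn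
      exact production_density_le hf hβ hu hη hφ (by lia) hι0 (hι n hn') j
    have hdual := sum_sum_mul_le_sqrt
      (sum_sq_dualDensity_le hr hh hT hκ1 hK' hs hs' hw hw') hΘ
    have hmeas := sum_measureDensity_le hr hh hT hK hK' hs hs' hw hw'
    -- The squared dual densities sum to O(1/(rh)) and the squared test data to O(h · rh · D²). The
    -- factor rh cancels and √h D remains; 45 = 5 · 9.
    have hsq : √(5 * (4 * E + K * T) / (r * h) * (9 * (h * (r * h) * D ^ 2)))
        = √(45 * (4 * E + K * T)) * (√h * D) := by
      have e : 5 * (4 * E + K * T) / (r * h) * (9 * (h * (r * h) * D ^ 2))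
          = (45 * (4 * E + K * T)) * (h * D ^ 2) := by field_simp; ring
      have hE : 0 ≤ E := le_trans (mul_nonneg (by positivity) (Finset.sum_nonneg fun n _ =>
        Finset.sum_nonneg fun j _ => sq_nonneg _)) hs
      have hT0 : 0 ≤ T := le_trans (by positivity) hT
      rw [e, Real.sqrt_mul (by positivity), Real.sqrt_mul hh.le, Real.sqrt_sq hD]
    rw [hsq] at hdual
    calc |∑ n ∈ Finset.range L, ∑ j ∈ I, Y n j|
        ≤ ∑ n ∈ Finset.range L, ∑ j ∈ I, |Y n j| :=
          (Finset.abs_sum_le_sum_abs _ _).trans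
            (Finset.sum_le_sum fun n _ => Finset.abs_sum_le_sum_abs _ _)
      _ ≤ _ := Finset.sum_le_sum fun n hn => Finset.sum_le_sum fun j hj => hpt n hn j hj
      _ = P * (S * (h * ∑ n ∈ Finset.range L, ∑ j ∈ I,
            measureDensity r κ (u n) (fun i => u (n + 1) i - u n i) j)
          + ∑ n ∈ Finset.range L, ∑ j ∈ I,
            dualDensity r κ (u n) (fun i => u (n + 1) i - u n i) j
              * (α n j + ξ n j + ξ n (j + 1))) := by
          simp only [Finset.mul_sum, Finset.sum_add_distrib, mul_add]
      _ ≤ _ := mul_le_mul_of_nonneg_left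
          (add_le_add (mul_le_mul_of_nonneg_left hmeas hS) hdual) hP0
  -- The last level has no successor among the bounded levels, so the scheme cannot be used there. A
  -- single row of cells already yields √h: Cauchy–Schwarz over its 2J + 1 cells, with (2J + 1)h ≤ R
  -- and r ≤ 2.
  have hlast : |∑ j ∈ I, q L j * (eb L (j + 1) - eb L j)| ≤ 2 * C * √(2 * R) * (√h * D) := by
    have hpt : ∀ j ∈ I, |q L j * (eb L (j + 1) - eb L j)| ≤ 2 * C * (1 * ξ L j) := fun j _ => by
      rw [abs_mul]
      have e : eb L (j + 1) - eb L j
          = (eb L (j + 1) - r * h * ψ L j) - (eb L j - r * h * ψ L j) := by ring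
      have h1 : |eb L (j + 1) - eb L j| ≤ 2 * ξ L j := by
        rw [e]
        exact (abs_sub _ _).trans (by linarith [hφ.edge_right L j, hφ.edge_left L j])
      calc _ ≤ C * (2 * ξ L j) :=
            mul_le_mul (hη.q_le L (Nat.lt_succ_self L) j) h1 (abs_nonneg _) hC
        _ = _ := by ring
    have hξL : ∑ j ∈ I, ξ L j ^ 2 ≤ h * (r * h) * D ^ 2 := by
      refine le_trans ?_ (hφ.sum_x I)
      exact Finset.single_le_sum (f := fun n => ∑ j ∈ I, ξ n j ^ 2)
        (fun n _ => Finset.sum_nonneg fun j _ => sq_nonneg _) (Finset.self_mem_range_succ L)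
    have hcs : ∑ j ∈ I, 1 * ξ L j ≤ √(2 * R) * (√h * D) := by
      refine (Real.sum_mul_le_sqrt_mul_sqrt I (fun _ => 1) (fun j => ξ L j)).trans ?_
      have hR0 : 0 ≤ R := le_trans (by positivity) hR
      rw [← Real.sqrt_sq hD, ← Real.sqrt_mul hh.le, ← Real.sqrt_mul (Finset.sum_nonneg fun _ _ => by positivity),
        ← Real.sqrt_mul (by positivity : 0 ≤ 2 * R)]
      refine Real.sqrt_le_sqrt ?_
      rw [hI, one_pow, sum_Icc_const hJ, mul_one]
      calc (2 * J + 1) * ∑ j ∈ I, ξ L j ^ 2 ≤ (2 * J + 1) * (h * (r * h) * D ^ 2) :=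
            mul_le_mul_of_nonneg_left hξL (by positivity)
        _ = ((2 * J + 1) * h) * r * (h * D ^ 2) := by ring
        _ ≤ R * 2 * (h * D ^ 2) := by
            refine mul_le_mul_of_nonneg_right (mul_le_mul hR hu.r_le hr.le hR0) (by positivity)
        _ = _ := by ring
    calc _ ≤ ∑ j ∈ I, |q L j * (eb L (j + 1) - eb L j)| := Finset.abs_sum_le_sum_abs _ _
      _ ≤ ∑ j ∈ I, 2 * C * (1 * ξ L j) := Finset.sum_le_sum hpt
      _ = 2 * C * ∑ j ∈ I, 1 * ξ L j := by rw [Finset.mul_sum]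
      _ ≤ 2 * C * (√(2 * R) * (√h * D)) := mul_le_mul_of_nonneg_left hcs (by positivity)
      _ = _ := by ring
  rw [parts]
  exact (abs_add_le _ _).trans (add_le_add hbody hlast)

end

/-! ### A criterion for compactness in the dual of a Hilbert space -/

/-- Let g be the Riesz representative of Λ m and p its projection to the span E of the
representatives of s. Then g - p is annihilated by s, and ‖g - p‖² = Λ m (g - p) ≤ (ε/4)‖g - p‖. So
Λ m lies within ε/4 of a ball of a finite-dimensional space, which is compact; the finitely many m <
m₀ are added separately. -/
theorem totallyBounded_range_of_small_on_annihilator {H : Type*} [NormedAddCommGroup H]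
    [InnerProductSpace ℝ H] [CompleteSpace H] {Λ : ℕ → StrongDual ℝ H} {B : ℝ}
    (hB : ∀ m, ‖Λ m‖ ≤ B)
    (hΛ : ∀ ε > 0, ∃ (s : Finset (StrongDual ℝ H)) (m₀ : ℕ), ∀ m ≥ m₀, ∀ v : H,
      (∀ l ∈ s, l v = 0) → |Λ m v| ≤ ε * ‖v‖) :
    TotallyBounded (range Λ) := by
  rw [Metric.totallyBounded_iff]
  intro ε hε
  obtain ⟨s, m₀, hs⟩ := hΛ (ε / 4) (by linarith)
  set toD := InnerProductSpace.toDual ℝ H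
  set E : Submodule ℝ H := Submodule.span ℝ (toD.symm '' (s : Set (StrongDual ℝ H))) with hE
  have : FiniteDimensional ℝ E :=
    FiniteDimensional.span_of_finite ℝ (s.finite_toSet.image _)
  have hK : IsCompact ((fun x : E => toD (x : H)) '' Metric.closedBall (0 : E) B) :=
    (isCompact_closedBall _ _).image (toD.continuous.comp continuous_subtype_val)
  obtain ⟨t, ht, hcov⟩ := Metric.totallyBounded_iff.1 hK.totallyBounded (ε / 2) (by linarith)
  refine ⟨t ∪ Λ '' {m | m < m₀}, ht.union ((finite_lt_nat m₀).image _), ?_⟩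
  rintro _ ⟨m, rfl⟩
  rcases lt_or_ge m m₀ with hm | hm
  · exact mem_iUnion₂.2 ⟨Λ m, Or.inr ⟨m, hm, rfl⟩, Metric.mem_ball_self hε⟩
  set g := toD.symm (Λ m) with hg
  set p : H := E.starProjection g with hp
  have hgB : ‖g‖ ≤ B := by rw [hg, LinearIsometryEquiv.norm_map]; exact hB m
  have hpB : ‖E.orthogonalProjectionOnto g‖ ≤ B :=
    (E.norm_orthogonalProjectionOnto_apply_le g).trans hgB
  have hmem : toD p ∈ (fun x : E => toD (x : H)) '' Metric.closedBall (0 : E) B :=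
    ⟨E.orthogonalProjectionOnto g, by simpa using hpB, rfl⟩
  obtain ⟨y, hy, hyp⟩ := mem_iUnion₂.1 (hcov hmem)
  refine mem_iUnion₂.2 ⟨y, Or.inl hy, ?_⟩
  have horth : g - p ∈ Eᗮ := E.sub_starProjection_mem_orthogonal g
  have hsmall : |Λ m (g - p)| ≤ ε / 4 * ‖g - p‖ := by
    refine hs m hm _ fun l hl => ?_
    have h1 : toD.symm l ∈ E := Submodule.subset_span ⟨l, hl, rfl⟩
    have h2 := (Submodule.mem_orthogonal E _).1 horth _ h1
    rwa [InnerProductSpace.toDual_symm_apply] at h2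
  have hnorm : ‖g - p‖ ≤ ε / 4 := by
    have h1 : Λ m (g - p) = ‖g - p‖ ^ 2 := by
      have h2 : Λ m (g - p) = inner ℝ g (g - p) := by
        rw [hg, InnerProductSpace.toDual_symm_apply]
      have h3 : inner ℝ p (g - p) = 0 :=
        (Submodule.mem_orthogonal E _).1 horth _ (E.starProjection_apply_mem g)
      rw [h2, ← real_inner_self_eq_norm_sq, inner_sub_left, h3, sub_zero]
    rw [h1, abs_of_nonneg (sq_nonneg _), sq] at hsmall
    by_contra hcon
    push Not at hcon
    have : 0 < ‖g - p‖ := lt_trans (by linarith) hcon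
    exact absurd (le_of_mul_le_mul_right hsmall this) (not_le.2 hcon)
  have hd : dist (Λ m) (toD p) ≤ ε / 4 := by
    rw [← LinearIsometryEquiv.apply_symm_apply toD (Λ m), LinearIsometryEquiv.dist_map, dist_eq_norm]
    exact hnorm
  rw [Metric.mem_ball] at hyp ⊢
  linarith [dist_triangle (Λ m) (toD p) y]

/-! ### The smooth truncation `κ arctan (φ / κ)` -/

section

variable {φ : ℝ × ℝ → ℝ} {κ : ℝ}

/-- A smooth truncation of `φ` at the level `κ`. -/
noncomputable def truncation (κ : ℝ) (φ : ℝ × ℝ → ℝ) (p : ℝ × ℝ) : ℝ :=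
  κ * Real.arctan (φ p / κ)

theorem contDiff_truncation (κ : ℝ) {n : WithTop ℕ∞} (hφ : ContDiff ℝ n φ) :
    ContDiff ℝ n (truncation κ φ) :=
  contDiff_const.mul (Real.contDiff_arctan.comp (hφ.div_const κ))

theorem truncation_eq_zero {p : ℝ × ℝ} (h : φ p = 0) : truncation κ φ p = 0 := by
  simp [truncation, h]

theorem hasCompactSupport_truncation (κ : ℝ) (hφ : HasCompactSupport φ) :
    HasCompactSupport (truncation κ φ) :=
  hφ.mono fun _ hp h0 => hp (truncation_eq_zero h0)

theorem abs_truncation_le (hκ : 0 < κ) (p : ℝ × ℝ) : |truncation κ φ p| ≤ 2 * κ := by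
  rw [truncation, abs_mul, abs_of_pos hκ]
  have h1 : |Real.arctan (φ p / κ)| ≤ 2 := by
    rw [abs_le]
    constructor
    · linarith [Real.neg_pi_div_two_lt_arctan (φ p / κ), Real.pi_le_four]
    · linarith [Real.arctan_lt_pi_div_two (φ p / κ), Real.pi_le_four]
  nlinarith

theorem fderiv_truncation (hκ : 0 < κ) (hφ : ContDiff ℝ 1 φ) (p v : ℝ × ℝ) :
    fderiv ℝ (truncation κ φ) p v = fderiv ℝ φ p v / (1 + (φ p / κ) ^ 2) := by
  have h1 : HasFDerivAt φ (fderiv ℝ φ p) p := (hφ.differentiable one_ne_zero p).hasFDerivAt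
  have h2 : HasDerivAt (fun y => κ * Real.arctan (y / κ)) (1 / (1 + (φ p / κ) ^ 2)) (φ p) := by
    have := ((Real.hasDerivAt_arctan (φ p / κ)).comp (φ p)
      ((hasDerivAt_id (φ p)).div_const κ)).const_mul κ
    refine this.congr_deriv ?_
    field_simp
  have h3 : HasFDerivAt (truncation κ φ) _ p := h2.comp_hasFDerivAt p h1
  rw [h3.fderiv]
  simp [div_eq_inv_mul]

theorem abs_fderiv_truncation_le (hκ : 0 < κ) (hφ : ContDiff ℝ 1 φ) (p v : ℝ × ℝ) :
    |fderiv ℝ (truncation κ φ) p v| ≤ |fderiv ℝ φ p v| := by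
  rw [fderiv_truncation hκ hφ, abs_div, abs_of_pos (by positivity : 0 < 1 + (φ p / κ) ^ 2)]
  exact div_le_self (abs_nonneg _) (by linarith [sq_nonneg (φ p / κ)])

/-- The derivative of the truncation carries the factor 1/(1 + y²) with y = φ/κ, and 1 - 1/(1 + y²)
≤ |y|. -/
theorem abs_fderiv_sub_truncation_le (hκ : 0 < κ) (hφ : ContDiff ℝ 1 φ) (p v : ℝ × ℝ) :
    |fderiv ℝ φ p v - fderiv ℝ (truncation κ φ) p v| ≤ |fderiv ℝ φ p v| * (|φ p| / κ) := by
  rw [fderiv_truncation hκ hφ]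
  set y := φ p / κ with hy
  have hpos : 0 < 1 + y ^ 2 := by positivity
  have e : fderiv ℝ φ p v - fderiv ℝ φ p v / (1 + y ^ 2)
      = fderiv ℝ φ p v * (y ^ 2 / (1 + y ^ 2)) := by field_simp; ring
  rw [e, abs_mul, abs_of_nonneg (by positivity : 0 ≤ y ^ 2 / (1 + y ^ 2))]
  refine mul_le_mul_of_nonneg_left ?_ (abs_nonneg _)
  have e2 : |φ p| / κ = |y| := by rw [hy, abs_div, abs_of_pos hκ]
  rw [e2, div_le_iff₀ hpos, ← sq_abs]
  nlinarith [abs_nonneg y, sq_nonneg (|y| - 1)]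

/-- Testing with `φ` is estimated by testing with a truncation of `φ`. -/
theorem abs_integral_le_truncation {η q : ℝ × ℝ → ℝ} {s : Set (ℝ × ℝ)}
    (hη : AEStronglyMeasurable η (volume.restrict s))
    (hq : AEStronglyMeasurable q (volume.restrict s)) {C : ℝ}
    (hηC : ∀ᵐ p ∂volume.restrict s, |η p| ≤ C) (hqC : ∀ᵐ p ∂volume.restrict s, |q p| ≤ C)
    (hφ : ContDiff ℝ 1 φ) (hφc : HasCompactSupport φ) (hφs : tsupport φ ⊆ s) (hκ : 0 < κ)
    {θ D Z : ℝ} (hθ : 0 < θ) (hX : ∫ p, partialX φ p ^ 2 ≤ D ^ 2)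
    (hT : ∫ p, partialT φ p ^ 2 ≤ D ^ 2) (hZ : ∫ p, φ p ^ 2 ≤ Z ^ 2) (hC : 0 ≤ C) :
    |∫ p, (η p * partialT φ p + q p * partialX φ p)|
      ≤ |∫ p, (η p * partialT (truncation κ φ) p + q p * partialX (truncation κ φ) p)|
        + C * (θ * D ^ 2 + Z ^ 2 / (θ * κ ^ 2)) := by
  have hψ := contDiff_truncation κ hφ
  have hψc := hasCompactSupport_truncation κ hφc
  set ψ := truncation κ φ
  have hψs : tsupport ψ ⊆ s :=
    (closure_mono (Function.support_subset_iff'.2 fun p hp =>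
      truncation_eq_zero (Function.notMem_support.1 hp))).trans hφs
  have out : ∀ {χ : ℝ × ℝ → ℝ}, tsupport χ ⊆ s → ∀ p ∉ s, partialT χ p = 0 ∧ partialX χ p = 0 := by
    intro χ hχ p hp
    have : fderiv ℝ χ p = 0 := fderiv_of_notMem_tsupport ℝ fun h => hp (hχ h)
    simp [partialT, partialX, this]
  have int : ∀ {g χ : ℝ × ℝ → ℝ}, AEStronglyMeasurable g (volume.restrict s) →
      (∀ᵐ p ∂volume.restrict s, |g p| ≤ C) → Continuous χ → HasCompactSupport χ →
      IntegrableOn (fun p => g p * χ p) s := by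
    intro g χ hg hgC hχ hχc
    exact (hχ.integrable_of_hasCompactSupport hχc).integrableOn.bdd_mul hg
      (by simpa only [Real.norm_eq_abs] using hgC)
  have restr : ∀ {χ : ℝ × ℝ → ℝ}, tsupport χ ⊆ s →
      ∫ p, (η p * partialT χ p + q p * partialX χ p)
        = ∫ p in s, (η p * partialT χ p + q p * partialX χ p) := fun hχ =>
    (setIntegral_eq_integral_of_forall_compl_eq_zero fun p hp => by
      simp [(out hχ p hp).1, (out hχ p hp).2]).symm
  have i1 := int hη hηC (continuous_partialT hφ) (hasCompactSupport_partialT hφc)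
  have i2 := int hq hqC (continuous_partialX hφ) (hasCompactSupport_partialX hφc)
  have i3 := int hη hηC (continuous_partialT hψ) (hasCompactSupport_partialT hψc)
  have i4 := int hq hqC (continuous_partialX hψ) (hasCompactSupport_partialX hψc)
  rw [restr hφs, restr hψs]
  have sqi : ∀ {χ : ℝ × ℝ → ℝ}, Continuous χ → HasCompactSupport χ →
      Integrable fun p => χ p ^ 2 := fun hχ hχc =>
    (hχ.pow 2).integrable_of_hasCompactSupport (hχc.mono fun p hp h0 => hp (by simp [h0]))
  have j1 := sqi (continuous_partialT hφ) (hasCompactSupport_partialT hφc)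
  have j2 := sqi (continuous_partialX hφ) (hasCompactSupport_partialX hφc)
  have j3 := sqi hφ.continuous hφc
  have i12 : IntegrableOn (fun p => η p * partialT φ p + q p * partialX φ p) s := i1.add i2
  have i34 : IntegrableOn (fun p => η p * partialT ψ p + q p * partialX ψ p) s := i3.add i4
  have j12 : Integrable fun p => θ / 2 * (partialT φ p ^ 2 + partialX φ p ^ 2) :=
    (j1.add j2).const_mul _
  have j : Integrable fun p =>
      C * (θ / 2 * (partialT φ p ^ 2 + partialX φ p ^ 2) + φ p ^ 2 / (θ * κ ^ 2)) :=
    (j12.add (j3.div_const _)).const_mul _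
  have hdiff : |(∫ p in s, (η p * partialT φ p + q p * partialX φ p))
      - ∫ p in s, (η p * partialT ψ p + q p * partialX ψ p)|
      ≤ ∫ p in s, C * (θ / 2 * (partialT φ p ^ 2 + partialX φ p ^ 2) + φ p ^ 2 / (θ * κ ^ 2)) := by
    rw [← integral_sub i12 i34]
    refine (Real.norm_eq_abs _).symm.trans_le
      (norm_integral_le_of_norm_le (Integrable.integrableOn (s := s) j) ?_)
    filter_upwards [hηC, hqC] with p h1 h2
    have d1 : |partialT φ p - partialT ψ p| ≤ |partialT φ p| * (|φ p| / κ) :=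
      abs_fderiv_sub_truncation_le hκ hφ p _
    have d2 : |partialX φ p - partialX ψ p| ≤ |partialX φ p| * (|φ p| / κ) :=
      abs_fderiv_sub_truncation_le hκ hφ p _
    -- Young's inequality with the free weight θ separates the gradient from φ; θ and κ are chosen
    -- only when compactness is proved.
    have young : ∀ x : ℝ, |x| * (|φ p| / κ) ≤ θ / 2 * x ^ 2 + φ p ^ 2 / (θ * κ ^ 2) / 2 := by
      intro x
      have e : φ p ^ 2 / (θ * κ ^ 2) = θ * (|φ p| / κ / θ) ^ 2 := by
        rw [div_pow, div_pow, sq_abs]; field_simp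
      have e2 : |x| * (|φ p| / κ) = θ * (|x| * (|φ p| / κ / θ)) := by field_simp
      rw [e, e2, ← sq_abs x]
      nlinarith [mul_nonneg hθ.le (sq_nonneg (|x| - |φ p| / κ / θ))]
    have e3 : η p * partialT φ p + q p * partialX φ p - (η p * partialT ψ p + q p * partialX ψ p)
        = η p * (partialT φ p - partialT ψ p) + q p * (partialX φ p - partialX ψ p) := by ring
    rw [Real.norm_eq_abs, e3]
    refine (abs_add_le _ _).trans ?_
    rw [abs_mul, abs_mul]
    have b1 := mul_le_mul h1 (d1.trans (young (partialT φ p))) (abs_nonneg _) hC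
    have b2 := mul_le_mul h2 (d2.trans (young (partialX φ p))) (abs_nonneg _) hC
    linarith
  have hle : ∫ p in s, C * (θ / 2 * (partialT φ p ^ 2 + partialX φ p ^ 2) + φ p ^ 2 / (θ * κ ^ 2))
      ≤ C * (θ * D ^ 2 + Z ^ 2 / (θ * κ ^ 2)) := by
    refine (setIntegral_le_integral j (Eventually.of_forall fun p => by
      simp only [Pi.zero_apply]; positivity)).trans ?_
    rw [integral_const_mul]
    refine mul_le_mul_of_nonneg_left ?_ hC
    rw [integral_add j12 (j3.div_const _), integral_const_mul, integral_div, integral_add j1 j2]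
    refine add_le_add (by nlinarith) ?_
    gcongr
  have := abs_sub_abs_le_abs_sub (∫ p in s, (η p * partialT φ p + q p * partialX φ p))
    (∫ p in s, (η p * partialT ψ p + q p * partialX ψ p))
  linarith

end

/-! ### The space `H¹₀` -/

theorem exists_mem_cell {h τ R : ℝ} (hh : 0 < h) (hτ : 0 < τ) {N : ℕ} {J : ℤ}
    (hJ : R ≤ ((J : ℝ) - 1 / 2) * h) {p : ℝ × ℝ} (hx : |p.1| < R) (ht : 0 < p.2)
    (ht' : p.2 < N * τ) : ∃ n < N, ∃ j ∈ Finset.Icc (-J) J, p ∈ cell h τ n j := by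
  refine ⟨_, ?_, _, ?_, mem_cell_floor hh hτ ht.le⟩
  · rw [Nat.floor_lt (div_nonneg ht.le hτ.le), div_lt_iff₀ hτ]
    exact ht'
  · obtain ⟨h1, h2⟩ := abs_lt.1 (hx.trans_le hJ)
    rw [Finset.mem_Icc]
    constructor
    · rw [Int.le_floor]
      have : -((J : ℝ) - 1 / 2) < p.1 / h := by rw [lt_div_iff₀ hh]; linarith
      push_cast
      linarith
    · have : p.1 / h < (J : ℝ) - 1 / 2 := by rwa [div_lt_iff₀ hh]
      refine Int.le_of_lt_add_one (Int.floor_lt.2 ?_)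
      push_cast
      linarith

section

variable {Ω : Opens (ℝ × ℝ)}

theorem lineDerivOp_x_apply (φ : 𝓓(Ω, ℝ)) (p : ℝ × ℝ) :
    (∂_{((1 : ℝ), (0 : ℝ))} φ : 𝓓(Ω, ℝ)) p = partialX φ p := by
  rw [TestFunction.lineDerivOp_eq_lineDerivCLM ℝ, TestFunction.lineDerivCLM_eq_fderivCLM,
    TestFunction.fderivCLM_apply_of_le _ (by simp)]
  rfl

theorem lineDerivOp_t_apply (φ : 𝓓(Ω, ℝ)) (p : ℝ × ℝ) :
    (∂_{((0 : ℝ), (1 : ℝ))} φ : 𝓓(Ω, ℝ)) p = partialT φ p := by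
  rw [TestFunction.lineDerivOp_eq_lineDerivCLM ℝ, TestFunction.lineDerivCLM_eq_fderivCLM,
    TestFunction.fderivCLM_apply_of_le _ (by simp)]
  rfl

theorem jetFun_eq (φ : 𝓓(Ω, ℝ)) (p : ℝ × ℝ) :
    jetFun φ p = !₂[φ p, partialX φ p, partialT φ p] := by
  rw [jetFun, lineDerivOp_x_apply, lineDerivOp_t_apply]

theorem contDiff_one (φ : 𝓓(Ω, ℝ)) : ContDiff ℝ 1 φ :=
  φ.contDiff.of_le (by simp)

theorem integrable_sq_of_compactSupport {g : ℝ × ℝ → ℝ} (hg : Continuous g)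
    (hgs : HasCompactSupport g) : Integrable fun p => g p ^ 2 :=
  (hg.pow 2).integrable_of_hasCompactSupport (hgs.mono fun _ hp h0 => hp (by simp [h0]))

theorem norm_jet_sq (φ : 𝓓(Ω, ℝ)) :
    ‖jet Ω φ‖ ^ 2 = (∫ p, φ p ^ 2) + (∫ p, partialX φ p ^ 2) + ∫ p, partialT φ p ^ 2 := by
  have i1 := integrable_sq_of_compactSupport φ.continuous φ.hasCompactSupport
  have i2 := integrable_sq_of_compactSupport (continuous_partialX (contDiff_one φ))
    (hasCompactSupport_partialX φ.hasCompactSupport)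
  have i3 := integrable_sq_of_compactSupport (continuous_partialT (contDiff_one φ))
    (hasCompactSupport_partialT φ.hasCompactSupport)
  have i12 : Integrable fun p => φ p ^ 2 + partialX φ p ^ 2 := i1.add i2
  rw [← real_inner_self_eq_norm_sq, L2.inner_def, ← integral_add i1 i2, ← integral_add i12 i3]
  refine integral_congr_ae ?_
  filter_upwards [(memLp_jetFun φ).coeFn_toLp] with p hp
  change inner ℝ ((memLp_jetFun φ).toLp (jetFun φ) p) ((memLp_jetFun φ).toLp (jetFun φ) p) = _
  rw [hp, real_inner_self_eq_norm_sq, EuclideanSpace.norm_sq_eq, jetFun_eq, Fin.sum_univ_three]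
  simp

theorem inner_toLp_jet {w : ℝ × ℝ → EuclideanSpace ℝ (Fin 3)} (hw : MemLp w 2 volume)
    (φ : 𝓓(Ω, ℝ)) :
    inner ℝ (hw.toLp w) (jet Ω φ)
      = ∫ p, (w p 0 * φ p + w p 1 * partialX φ p + w p 2 * partialT φ p) := by
  rw [L2.inner_def]
  refine integral_congr_ae ?_
  filter_upwards [(memLp_jetFun φ).coeFn_toLp, hw.coeFn_toLp] with p hp hp'
  change inner ℝ (hw.toLp w p) ((memLp_jetFun φ).toLp (jetFun φ) p) = _
  rw [hp, hp', jetFun_eq, PiLp.inner_apply, Fin.sum_univ_three]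
  simp [mul_comm]

/-- The projection of a jet to the function itself. -/
noncomputable def fstComponent :
    Lp (EuclideanSpace ℝ (Fin 3)) 2 (volume : Measure (ℝ × ℝ)) →L[ℝ]
      Lp ℝ 2 (volume : Measure (ℝ × ℝ)) :=
  (EuclideanSpace.proj (0 : Fin 3) : EuclideanSpace ℝ (Fin 3) →L[ℝ] ℝ).compLpL 2 volume

theorem norm_fstComponent_jet_sq (φ : 𝓓(Ω, ℝ)) :
    ‖fstComponent (jet Ω φ)‖ ^ 2 = ∫ p, φ p ^ 2 := by
  rw [← real_inner_self_eq_norm_sq, L2.inner_def]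
  refine integral_congr_ae ?_
  filter_upwards [(memLp_jetFun φ).coeFn_toLp, ContinuousLinearMap.coeFn_compLpL
    (EuclideanSpace.proj (0 : Fin 3) : EuclideanSpace ℝ (Fin 3) →L[ℝ] ℝ) (jet Ω φ)] with p hp hp'
  rw [fstComponent, hp']
  change inner ℝ (((memLp_jetFun φ).toLp (jetFun φ) p) 0) (((memLp_jetFun φ).toLp (jetFun φ) p) 0) = _
  rw [hp, jetFun_eq]
  simp [sq]

instance : CompleteSpace (H10 Ω) :=
  (Submodule.isClosed_topologicalClosure _).completeSpace_coe

/-- Test functions are dense in H¹₀, so closed conditions need checking on them only. -/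
theorem H10_induction {P : Lp (EuclideanSpace ℝ (Fin 3)) 2 (volume : Measure (ℝ × ℝ)) → Prop}
    (hP : IsClosed {w | P w}) (h : ∀ φ : 𝓓(Ω, ℝ), P (jet Ω φ)) (v : H10 Ω) : P v := by
  have h1 : ((LinearMap.range (jet Ω)).topologicalClosure : Set _) ⊆ {w | P w} := by
    rw [Submodule.topologicalClosure_coe]
    refine closure_minimal ?_ hP
    rintro _ ⟨φ, rfl⟩
    exact h φ
  exact h1 v.2

/-- Rellich's theorem, in the form: the `L²` norm is small compared to the `H¹₀` norm on the
annihilator of a suitable finite set of functionals. -/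
theorem exists_finset_norm_fstComponent_le {T : ℝ} (hT : 0 < T)
    (hΩ : Bornology.IsBounded (Ω : Set (ℝ × ℝ))) (hΩT : Ω ≤ strip T) {ε : ℝ} (hε : 0 < ε) :
    ∃ s : Finset (StrongDual ℝ (H10 Ω)), ∀ v : H10 Ω, (∀ l ∈ s, l v = 0) →
      ‖fstComponent (v : Lp (EuclideanSpace ℝ (Fin 3)) 2 (volume : Measure (ℝ × ℝ)))‖ ^ 2
        ≤ ε * ‖v‖ ^ 2 := by
  classical
  obtain ⟨R, hR⟩ := hΩ.subset_ball 0
  -- The lower bound forces 3τ² ≤ ε for the side τ = T/N of the squares; the summand 1 gives N > 1,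
  -- so that N² ≥ N.
  obtain ⟨N, hN⟩ := exists_nat_gt (3 * T ^ 2 / ε + 1)
  have hN1 : (1 : ℝ) < N := lt_of_le_of_lt (by linarith [(by positivity : 0 ≤ 3 * T ^ 2 / ε)]) hN
  have hN0 : (0 : ℝ) < N := by linarith
  set τ := T / N with hτdef
  have hτ : 0 < τ := by positivity
  have hNτ : N * τ = T := by rw [hτdef]; field_simp
  have hτε : 3 * τ ^ 2 ≤ ε := by
    have h1 : 3 * T ^ 2 / ε < N := by linarith
    rw [div_lt_iff₀ hε] at h1
    rw [hτdef, div_pow, ← mul_div_assoc, div_le_iff₀ (by positivity)]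
    nlinarith [mul_pos hε hN0]
  obtain ⟨J, hJ⟩ := exists_int_gt (R / τ + 1 / 2)
  have hJ' : R ≤ ((J : ℝ) - 1 / 2) * τ := by
    rw [← div_le_iff₀ hτ]
    linarith
  have hfin : ∀ i : ℕ × ℤ, (volume : Measure (ℝ × ℝ)) (cell τ τ i.1 i.2) ≠ ⊤ := fun i => by
    rw [cell, Measure.volume_eq_prod, Measure.prod_prod]
    simp [ENNReal.mul_eq_top]
  -- The functionals are the integrals of the function component over the squares of a grid that
  -- covers Ω.
  set W : ℕ × ℤ → Lp (EuclideanSpace ℝ (Fin 3)) 2 (volume : Measure (ℝ × ℝ)) := fun i =>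
    indicatorConstLp 2 (measurableSet_cell τ τ i.1 i.2) (hfin i)
      (EuclideanSpace.single (0 : Fin 3) (1 : ℝ)) with hW
  have hWjet : ∀ i, ∀ φ : 𝓓(Ω, ℝ), inner ℝ (W i) (jet Ω φ) = ∫ p in cell τ τ i.1 i.2, φ p := by
    intro i φ
    rw [hW]
    simp only []
    rw [L2.inner_indicatorConstLp_eq_setIntegral_inner]
    refine integral_congr_ae (ae_restrict_of_ae ?_)
    filter_upwards [(memLp_jetFun φ).coeFn_toLp] with p hp
    change inner ℝ _ ((memLp_jetFun φ).toLp (jetFun φ) p) = _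
    rw [hp, jetFun_eq, EuclideanSpace.inner_single_left]
    simp
  set I : Finset (ℕ × ℤ) := Finset.range N ×ˢ Finset.Icc (-J) J with hI
  refine ⟨I.image fun i => (innerSL ℝ (W i)).comp (H10 Ω).subtypeL, fun v hv => ?_⟩
  -- Test functions that approximate v need not satisfy the annihilator condition. The inequality is
  -- therefore proved with the squared cell integrals as an additional term, which passes to the
  -- limit and vanishes for v.
  have key := H10_induction (Ω := Ω)
    (P := fun w => ‖fstComponent w‖ ^ 2
      ≤ ε * ‖w‖ ^ 2 + 3 / (τ * τ) * ∑ i ∈ I, inner ℝ (W i) w ^ 2)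
    (isClosed_le (by fun_prop) (by fun_prop)) (fun φ => ?_) v
  · have h0 : ∑ i ∈ I, inner ℝ (W i) (v : Lp (EuclideanSpace ℝ (Fin 3)) 2 volume) ^ 2 = 0 := by
      refine Finset.sum_eq_zero fun i hi => ?_
      have := hv _ (Finset.mem_image_of_mem _ hi)
      have h1 : inner ℝ (W i) (v : Lp (EuclideanSpace ℝ (Fin 3)) 2 volume) = 0 := this
      rw [h1]; ring
    rw [h0, mul_zero, add_zero] at key
    exact key
  · rw [norm_fstComponent_jet_sq, norm_jet_sq]
    have hc := contDiff_one φ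
    have i1 := integrable_sq_of_compactSupport φ.continuous φ.hasCompactSupport
    have i2 := integrable_sq_of_compactSupport (continuous_partialX hc)
      (hasCompactSupport_partialX φ.hasCompactSupport)
    have i3 := integrable_sq_of_compactSupport (continuous_partialT hc)
      (hasCompactSupport_partialT φ.hasCompactSupport)
    have hsplit := integral_eq_sum_cell hτ hτ (N := N) (A := Finset.Icc (-J) J)
      (g := fun p => φ p ^ 2) (fun n j => i1.integrableOn) fun p hp => by
        have hpΩ : p ∈ Ω := φ.tsupport_subset (subset_tsupport _ fun h0 => hp (by simp [h0]))
        have hp1 : p ∈ strip T := hΩT hpΩ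
        have hp2 := hR hpΩ
        rw [mem_ball_zero_iff] at hp2
        exact exists_mem_cell hτ hτ hJ' ((norm_fst_le p).trans_lt hp2) hp1.2.1
          (by rw [hNτ]; exact hp1.2.2)
    have hpoin : ∀ n j, ∫ p in cell τ τ n j, φ p ^ 2
        ≤ 3 * (τ ^ 2 * (∫ p in cell τ τ n j, partialX φ p ^ 2)
        + τ ^ 2 * (∫ p in cell τ τ n j, partialT φ p ^ 2)
        + (∫ p in cell τ τ n j, φ p) ^ 2 / (τ * τ)) := by
      intro n j
      have := poincare_rect hc (x₀ := ((j : ℝ) - 1 / 2) * τ) (x₁ := ((j : ℝ) + 1 / 2) * τ)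
        (t₀ := n * τ) (t₁ := ((n : ℝ) + 1) * τ) (by nlinarith) (by nlinarith)
      rwa [show ((j : ℝ) + 1 / 2) * τ - ((j : ℝ) - 1 / 2) * τ = τ by ring,
        show ((n : ℝ) + 1) * τ - n * τ = τ by ring] at this
    have s2 := sum_cell_le_integral hτ hτ N (Finset.Icc (-J) J) i2 fun p => sq_nonneg _
    have s3 := sum_cell_le_integral hτ hτ N (Finset.Icc (-J) J) i3 fun p => sq_nonneg _
    have hle : ∫ p, φ p ^ 2 ≤ 3 * τ ^ 2 * ((∫ p, partialX φ p ^ 2) + ∫ p, partialT φ p ^ 2)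
        + 3 / (τ * τ) * ∑ i ∈ I, inner ℝ (W i) (jet Ω φ) ^ 2 := by
      rw [hsplit]
      refine (Finset.sum_le_sum fun n _ => Finset.sum_le_sum fun j _ => hpoin n j).trans ?_
      simp only [hWjet, hI, Finset.sum_product, ← Finset.mul_sum, Finset.sum_add_distrib,
        ← Finset.sum_div]
      have e := mul_le_mul_of_nonneg_left (add_le_add s2 s3) (by positivity : 0 ≤ 3 * τ ^ 2)
      linear_combination e
    refine hle.trans (add_le_add ?_ le_rfl)
    have p1 : 0 ≤ ∫ p, φ p ^ 2 := integral_nonneg fun p => sq_nonneg _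
    have p2 : 0 ≤ ∫ p, partialX φ p ^ 2 := integral_nonneg fun p => sq_nonneg _
    have p3 : 0 ≤ ∫ p, partialT φ p ^ 2 := integral_nonneg fun p => sq_nonneg _
    refine mul_le_mul hτε (by linarith) (by positivity) hε.le

end

/-! ### A compactness criterion in `H⁻¹_loc` -/

theorem locallyIntegrableOn_of_bound {g : ℝ × ℝ → ℝ} {s : Set (ℝ × ℝ)}
    (hg : AEStronglyMeasurable g (volume.restrict s)) {C : ℝ}
    (hC : ∀ᵐ p ∂volume.restrict s, |g p| ≤ C) : LocallyIntegrableOn g s volume := by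
  refine locallyIntegrableOn_of_locallyIntegrable_restrict fun x =>
    ⟨Metric.ball x 1, Metric.ball_mem_nhds x one_pos, ?_⟩
  refine IntegrableOn.of_bound ?_ hg.restrict C (ae_restrict_of_ae ?_)
  · exact lt_of_le_of_lt (Measure.restrict_le_self _) Metric.isBounded_ball.measure_lt_top
  · exact hC

theorem norm_toLp_indicator_le {E : Type*} [NormedAddCommGroup E] {w : ℝ × ℝ → E}
    {s : Set (ℝ × ℝ)} (hs : MeasurableSet s) (hsf : volume s ≠ ⊤) {C : ℝ}
    (hC : ∀ᵐ p ∂volume.restrict s, ‖w p‖ ≤ C) (hw : MemLp (s.indicator w) 2 volume) :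
    ‖hw.toLp (s.indicator w)‖
      ≤ (volume s ^ (2 : ENNReal).toReal⁻¹ * ENNReal.ofReal C).toReal := by
  rw [Lp.norm_toLp]
  refine ENNReal.toReal_mono (ENNReal.mul_ne_top (by finiteness) ENNReal.ofReal_ne_top) ?_
  rw [eLpNorm_indicator_eq_eLpNorm_restrict hs]
  refine (eLpNorm_le_of_ae_bound hC).trans ?_
  rw [Measure.restrict_apply_univ]

section

variable {Ω : Opens (ℝ × ℝ)}

theorem partial_eq_zero_of_notMem {φ : ℝ × ℝ → ℝ} {p : ℝ × ℝ} (hp : p ∉ tsupport φ) :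
    partialX φ p = 0 ∧ partialT φ p = 0 := by
  have h : fderiv ℝ φ p = 0 := by
    by_contra h0
    exact hp (support_fderiv_subset ℝ h0)
  simp [partialX, partialT, h]

/-- The extension of the distribution `η_t + q_x` on `Ω` to `H¹₀(Ω)`, with a bound of its norm. -/
theorem exists_extension_entropyProduction {Ω₀ : Opens (ℝ × ℝ)} {η q : ℕ → ℝ × ℝ → ℝ}
    (hη : ∀ m, AEStronglyMeasurable (η m) (volume.restrict (Ω₀ : Set (ℝ × ℝ))))
    (hq : ∀ m, AEStronglyMeasurable (q m) (volume.restrict (Ω₀ : Set (ℝ × ℝ)))) {C : ℝ}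
    (hηC : ∀ m, ∀ᵐ p ∂volume.restrict (Ω₀ : Set (ℝ × ℝ)), |η m p| ≤ C)
    (hqC : ∀ m, ∀ᵐ p ∂volume.restrict (Ω₀ : Set (ℝ × ℝ)), |q m p| ≤ C)
    (hC : 0 ≤ C) (hΩ : Bornology.IsBounded (Ω : Set (ℝ × ℝ))) (hle : Ω ≤ Ω₀) :
    ∃ (Λ : ℕ → StrongDual ℝ (H10 Ω)) (B : ℝ), (∀ m, ‖Λ m‖ ≤ B) ∧
      (∀ m, ∀ φ : 𝓓(Ω, ℝ),
        Λ m (toH10 φ) = entropyProduction Ω₀ (η m) (q m) (TestFunction.monoCLM ℝ φ)) ∧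
      ∀ m, ∀ φ : 𝓓(Ω, ℝ),
        Λ m (toH10 φ) = -∫ p, (η m p * partialT φ p + q m p * partialX φ p) := by
  have hsf : volume (Ω : Set (ℝ × ℝ)) ≠ ⊤ := hΩ.measure_lt_top.ne
  have hms : MeasurableSet (Ω : Set (ℝ × ℝ)) := Ω.isOpen.measurableSet
  have hres : volume.restrict (Ω : Set (ℝ × ℝ)) ≤ volume.restrict (Ω₀ : Set (ℝ × ℝ)) :=
    Measure.restrict_mono hle le_rfl
  -- Pairing the jet with this field, cut off to Ω, gives the functional, so its norm is at most the
  -- L² norm of the field.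
  set w : ℕ → ℝ × ℝ → EuclideanSpace ℝ (Fin 3) := fun m p => !₂[0, -q m p, -η m p] with hw
  have hwC : ∀ m, ∀ᵐ p ∂volume.restrict (Ω : Set (ℝ × ℝ)), ‖w m p‖ ≤ 2 * C := by
    intro m
    filter_upwards [ae_mono hres (hηC m), ae_mono hres (hqC m)] with p h1 h2
    refine le_of_sq_le_sq ?_ (by positivity)
    rw [EuclideanSpace.norm_sq_eq, Fin.sum_univ_three]
    simp only [hw, Real.norm_eq_abs, sq_abs]
    have e1 := sq_le_sq' (abs_le.1 h1).1 (abs_le.1 h1).2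
    have e2 := sq_le_sq' (abs_le.1 h2).1 (abs_le.1 h2).2
    simp
    nlinarith
  have hwm : ∀ m, MemLp ((Ω : Set (ℝ × ℝ)).indicator (w m)) 2 volume := by
    intro m
    rw [memLp_indicator_iff_restrict hms]
    have : IsFiniteMeasure (volume.restrict (Ω : Set (ℝ × ℝ))) := ⟨by
      rw [Measure.restrict_apply_univ]; exact hΩ.measure_lt_top⟩
    rw [memLp_piLp_iff]
    intro i
    fin_cases i
    · exact MemLp.zero
    · exact MemLp.of_bound ((hq m).mono_measure hres).neg C (by
        filter_upwards [ae_mono hres (hqC m)] with p h2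
        simpa [hw] using h2)
    · exact MemLp.of_bound ((hη m).mono_measure hres).neg C (by
        filter_upwards [ae_mono hres (hηC m)] with p h2
        simpa [hw] using h2)
  have hval : ∀ m, ∀ φ : 𝓓(Ω, ℝ),
      ((innerSL ℝ ((hwm m).toLp _)).comp (H10 Ω).subtypeL) (toH10 φ)
        = -∫ p, (η m p * partialT φ p + q m p * partialX φ p) := by
    intro m φ
    change inner ℝ ((hwm m).toLp _) (jet Ω φ) = _
    rw [inner_toLp_jet, ← integral_neg]
    refine integral_congr_ae (ae_of_all _ fun p => ?_)
    by_cases hp : p ∈ (Ω : Set (ℝ × ℝ))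
    · simp only [indicator_of_mem hp, hw]
      simp
    · obtain ⟨e1, e2⟩ := partial_eq_zero_of_notMem fun h => hp (φ.tsupport_subset h)
      simp [indicator_of_notMem hp, e1, e2]
  refine ⟨fun m => (innerSL ℝ ((hwm m).toLp _)).comp (H10 Ω).subtypeL,
    (volume (Ω : Set (ℝ × ℝ)) ^ (2 : ENNReal).toReal⁻¹ * ENNReal.ofReal (2 * C)).toReal, fun m => ?_,
    fun m φ => ?_, hval⟩
  · refine (ContinuousLinearMap.opNorm_comp_le _ _).trans ?_
    refine (mul_le_of_le_one_right (norm_nonneg _) (Submodule.norm_subtypeL_le _)).trans ?_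
    rw [innerSL_apply_norm]
    exact norm_toLp_indicator_le hms hsf (hwC m) (hwm m)
  · rw [hval, entropyProduction_apply (locallyIntegrableOn_of_bound (hη m) (hηC m))
      (locallyIntegrableOn_of_bound (hq m) (hqC m))]
    simp only [lineDerivOp_x_apply, lineDerivOp_t_apply]
    rw [TestFunction.monoCLM_apply, if_pos ⟨le_rfl, hle⟩]

end

/-- Bounded entropy productions that split into a part which is small in `H⁻¹` and a part which is
bounded as a measure lie in a compact subset of `H⁻¹_loc`. -/
theorem isCompactInHNegOneLoc_of_bound {T : ℝ} (hT : 0 < T) {η q : ℕ → ℝ × ℝ → ℝ}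
    (hη : ∀ m, AEStronglyMeasurable (η m) (volume.restrict (strip T : Set (ℝ × ℝ))))
    (hq : ∀ m, AEStronglyMeasurable (q m) (volume.restrict (strip T : Set (ℝ × ℝ)))) {C : ℝ}
    (hηC : ∀ m, ∀ᵐ p ∂volume.restrict (strip T : Set (ℝ × ℝ)), |η m p| ≤ C)
    (hqC : ∀ m, ∀ᵐ p ∂volume.restrict (strip T : Set (ℝ × ℝ)), |q m p| ≤ C)
    (hC : 0 ≤ C)
    (hbound : ∀ R : ℝ, 0 < R → ∃ (C' : ℝ) (α : ℕ → ℝ), 0 ≤ C' ∧ Tendsto α atTop (𝓝 0) ∧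
      ∀ m, ∀ φ : ℝ × ℝ → ℝ, ContDiff ℝ 1 φ → HasCompactSupport φ →
        (∀ p ∈ tsupport φ, |p.1| < R ∧ 0 < p.2 ∧ p.2 < T) →
        ∀ D S : ℝ, 0 ≤ D → ∫ p, partialX φ p ^ 2 ≤ D ^ 2 → ∫ p, partialT φ p ^ 2 ≤ D ^ 2 →
          (∀ p, |φ p| ≤ S) →
          |∫ p, (η m p * partialT φ p + q m p * partialX φ p)| ≤ α m * D + C' * S) :
    IsCompactInHNegOneLoc (strip T) fun m => entropyProduction (strip T) (η m) (q m) := by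
  intro Ω hΩ hle
  obtain ⟨Λ, B, hB, hΛL, hΛ⟩ := exists_extension_entropyProduction hη hq hηC hqC hC hΩ hle
  obtain ⟨R₀, hR₀⟩ := hΩ.subset_ball 0
  obtain ⟨C', α, hC', hα, hbd⟩ := hbound (max R₀ 1) (by positivity)
  refine ⟨closure (range Λ), ?_, fun m => ⟨Λ m, subset_closure (mem_range_self m), hΛL m⟩⟩
  refine isCompact_iff_totallyBounded_isComplete.2 ⟨?_, isClosed_closure.isComplete⟩
  refine (totallyBounded_range_of_small_on_annihilator hB fun ε hε => ?_).closure
  -- the basic estimate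
  have key : ∀ m, ∀ κ θ : ℝ, 0 < κ → 0 < θ → ∀ v : H10 Ω,
      |Λ m v| ≤ |α m| * ‖v‖ + C' * (2 * κ) + C * (θ * ‖v‖ ^ 2
        + ‖fstComponent (v : Lp (EuclideanSpace ℝ (Fin 3)) 2 (volume : Measure (ℝ × ℝ)))‖ ^ 2
          / (θ * κ ^ 2)) := by
    intro m κ θ hκ hθ
    have hcl : IsClosed {v : H10 Ω | |Λ m v| ≤ |α m| * ‖v‖ + C' * (2 * κ) + C * (θ * ‖v‖ ^ 2
        + ‖fstComponent (v : Lp (EuclideanSpace ℝ (Fin 3)) 2 (volume : Measure (ℝ × ℝ)))‖ ^ 2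
          / (θ * κ ^ 2))} :=
      isClosed_le (by fun_prop) (by fun_prop)
    have htest : ∀ φ : 𝓓(Ω, ℝ), toH10 φ ∈ {v : H10 Ω | |Λ m v| ≤ |α m| * ‖v‖ + C' * (2 * κ)
        + C * (θ * ‖v‖ ^ 2
        + ‖fstComponent (v : Lp (EuclideanSpace ℝ (Fin 3)) 2 (volume : Measure (ℝ × ℝ)))‖ ^ 2
          / (θ * κ ^ 2))} := by
      intro φ
      have hφ := contDiff_one φ
      have hφc := φ.hasCompactSupport
      have hn : ‖toH10 φ‖ = ‖jet Ω φ‖ := rfl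
      have i2 := integrable_sq_of_compactSupport (continuous_partialX hφ)
        (hasCompactSupport_partialX hφc)
      have i3 := integrable_sq_of_compactSupport (continuous_partialT hφ)
        (hasCompactSupport_partialT hφc)
      have p1 : 0 ≤ ∫ p, φ p ^ 2 := integral_nonneg fun p => sq_nonneg _
      have p2 : 0 ≤ ∫ p, partialX φ p ^ 2 := integral_nonneg fun p => sq_nonneg _
      have p3 : 0 ≤ ∫ p, partialT φ p ^ 2 := integral_nonneg fun p => sq_nonneg _
      have hj := norm_jet_sq φ
      have hX : ∫ p, partialX φ p ^ 2 ≤ ‖jet Ω φ‖ ^ 2 := by linarith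
      have hTT : ∫ p, partialT φ p ^ 2 ≤ ‖jet Ω φ‖ ^ 2 := by linarith
      have hZ : ∫ p, φ p ^ 2 ≤ ‖fstComponent (jet Ω φ)‖ ^ 2 := (norm_fstComponent_jet_sq φ).ge
      have t := abs_integral_le_truncation (hη m) (hq m) (hηC m) (hqC m) hφ hφc
        (φ.tsupport_subset.trans hle) hκ hθ hX hTT hZ hC
      have hψ := contDiff_truncation κ hφ
      have hψc := hasCompactSupport_truncation κ hφc
      have b := hbd m (truncation κ φ) hψ hψc (fun p hp => by
          have hpΩ : p ∈ Ω := φ.tsupport_subset (closure_mono (Function.support_subset_iff'.2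
            fun p hp => truncation_eq_zero (Function.notMem_support.1 hp)) hp)
          have h1 := hR₀ hpΩ
          rw [mem_ball_zero_iff] at h1
          exact ⟨((norm_fst_le p).trans_lt h1).trans_le (le_max_left _ _), (hle hpΩ).2⟩)
        ‖jet Ω φ‖ (2 * κ) (norm_nonneg _)
        ((integral_mono (integrable_sq_of_compactSupport (continuous_partialX hψ)
          (hasCompactSupport_partialX hψc)) i2 fun p =>
            sq_le_sq.2 (abs_fderiv_truncation_le hκ hφ p _)).trans hX)
        ((integral_mono (integrable_sq_of_compactSupport (continuous_partialT hψ)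
          (hasCompactSupport_partialT hψc)) i3 fun p =>
            sq_le_sq.2 (abs_fderiv_truncation_le hκ hφ p _)).trans hTT)
        (abs_truncation_le hκ)
      have hab := mul_le_mul_of_nonneg_right (le_abs_self (α m)) (norm_nonneg (jet Ω φ))
      rw [mem_ofPred_eq, hΛ, abs_neg, hn]
      change _ ≤ _ + C * (θ * ‖jet Ω φ‖ ^ 2 + ‖fstComponent (jet Ω φ)‖ ^ 2 / (θ * κ ^ 2))
      linarith
    intro v
    have hv : (v : Lp (EuclideanSpace ℝ (Fin 3)) 2 (volume : Measure (ℝ × ℝ)))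
        ∈ closure (LinearMap.range (jet Ω) : Set _) := by
      have : (v : Lp (EuclideanSpace ℝ (Fin 3)) 2 (volume : Measure (ℝ × ℝ)))
        ∈ (LinearMap.range (jet Ω)).topologicalClosure := v.2
      rwa [← SetLike.mem_coe, Submodule.topologicalClosure_coe] at this
    have hv' : v ∈ closure (range (toH10 : 𝓓(Ω, ℝ) → H10 Ω)) := by
      rw [Topology.IsInducing.subtypeVal.closure_eq_preimage_closure_image]
      refine closure_mono ?_ hv
      rintro _ ⟨φ, rfl⟩
      exact ⟨toH10 φ, mem_range_self φ, rfl⟩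
    exact closure_minimal (range_subset_iff.2 htest) hcl hv'
  set e := ε / (1 + 2 * C' + 2 * C) with he
  have hden : 0 < 1 + 2 * C' + 2 * C := by positivity
  have he0 : 0 < e := by positivity
  have hee : e * (1 + 2 * C' + 2 * C) = ε := by rw [he]; field_simp
  obtain ⟨s, hs⟩ := exists_finset_norm_fstComponent_le hT hΩ hle (ε := e ^ 4) (by positivity)
  obtain ⟨m₀, hm₀⟩ := (Metric.tendsto_atTop.1 hα) e he0
  refine ⟨s, m₀, fun m hm v hv => ?_⟩
  have hαm : |α m| ≤ e := by
    have := hm₀ m hm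
    rw [Real.dist_eq, sub_zero] at this
    exact this.le
  rcases eq_or_ne v 0 with rfl | hv0
  · simp
  have hvp : 0 < ‖v‖ := norm_pos_iff.2 hv0
  -- Truncation level and Young weight are scaled by ‖v‖ so that every term becomes a multiple of
  -- e‖v‖. In the last one, ‖v‖₂² ≤ e⁴‖v‖² is divided by θκ² = e³‖v‖, which explains the fourth
  -- power above.
  have k := key m (e * ‖v‖) (e / ‖v‖) (by positivity) (by positivity) v
  have hf := hs v hv
  have e1 : e / ‖v‖ * ‖v‖ ^ 2 = e * ‖v‖ := by field_simp
  have e2 : ‖fstComponent (v : Lp (EuclideanSpace ℝ (Fin 3)) 2 (volume : Measure (ℝ × ℝ)))‖ ^ 2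
      / (e / ‖v‖ * (e * ‖v‖) ^ 2) ≤ e * ‖v‖ := by
    rw [div_le_iff₀ (by positivity)]
    refine hf.trans (le_of_eq ?_)
    field_simp
  rw [e1] at k
  calc |Λ m v| ≤ _ := k
    _ ≤ e * ‖v‖ + C' * (2 * (e * ‖v‖)) + C * (e * ‖v‖ + e * ‖v‖) := by gcongr
    _ = ε * ‖v‖ := by rw [← hee]; ring

/-! ### The discretized coefficient -/

section

variable {k : ℝ → ℝ}

theorem intervalIntegrable_of_memLp_top (hk : MemLp k ⊤ volume) (x y : ℝ) :
    IntervalIntegrable k volume x y :=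
  ((hk.locallyIntegrable (by simp)).integrableOn_isCompact isCompact_uIcc).intervalIntegrable

theorem abs_coeffAvg_sub_le (hk : MemLp k ⊤ volume) {h : ℝ} (hh : 0 < h) (j : ℤ) {c ε : ℝ}
    (hε : ∀ᵐ x, x ∈ Icc ((j : ℝ) * h) (((j : ℝ) + 1) * h) → |k x - c| ≤ ε) :
    |coeffAvg k h j - c| ≤ ε := by
  have hle : (j : ℝ) * h ≤ ((j : ℝ) + 1) * h := by nlinarith
  have h1 : coeffAvg k h j - c
      = (1 / h) * ∫ x in ((j : ℝ) * h)..(((j : ℝ) + 1) * h), (k x - c) := by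
    rw [intervalIntegral.integral_sub (intervalIntegrable_of_memLp_top hk _ _)
      intervalIntegrable_const, intervalIntegral.integral_const, coeffAvg, smul_eq_mul]
    field_simp
    ring
  have h2 : ‖∫ x in ((j : ℝ) * h)..(((j : ℝ) + 1) * h), (k x - c)‖
      ≤ ε * |((j : ℝ) + 1) * h - (j : ℝ) * h| := by
    refine intervalIntegral.norm_integral_le_of_norm_le_const_ae ?_
    filter_upwards [hε] with x hx hx'
    rw [uIoc_of_le hle] at hx'
    exact hx (Ioc_subset_Icc_self hx')
  rw [show ((j : ℝ) + 1) * h - (j : ℝ) * h = h by ring, abs_of_pos hh, Real.norm_eq_abs] at h2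
  rw [h1, abs_mul, abs_of_pos (by positivity : 0 < 1 / h), one_div, inv_mul_le_iff₀ hh]
  linarith

theorem abs_le_eLpNorm_top (hk : MemLp k ⊤ volume) :
    ∀ᵐ x, |k x| ≤ (eLpNorm k ⊤ volume).toReal := by
  filter_upwards [ae_le_eLpNormEssSup (f := k) (μ := volume)] with x hx
  rw [← eLpNorm_exponent_top] at hx
  have := ENNReal.toReal_mono hk.2.ne hx
  simpa using this

theorem abs_coeffAvg_le (hk : MemLp k ⊤ volume) {h : ℝ} (hh : 0 < h) (j : ℤ) :
    |coeffAvg k h j| ≤ (eLpNorm k ⊤ volume).toReal := by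
  have := abs_coeffAvg_sub_le hk hh j (c := 0) (ε := (eLpNorm k ⊤ volume).toReal) (by
    filter_upwards [abs_le_eLpNorm_top hk] with x hx _
    simpa using hx)
  simpa using this

/-- The variation of a `BV_loc` coefficient dominates its discretization errors. -/
theorem exists_monotone_variation (hk : MemLp k ⊤ volume) (hkBV : IsBVLoc k) :
    ∃ G : ℝ → ℝ, Monotone G ∧ ∀ h, 0 < h → ∀ j : ℤ,
      |coeffAvg k h (j + 1) - coeffAvg k h j| ≤ G (((j : ℝ) + 2) * h) - G ((j : ℝ) * h) ∧
      ∀ᵐ x, x ∈ Ico (((j : ℝ) - 1 / 2) * h) (((j : ℝ) + 1 / 2) * h) →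
        |k x - coeffAvg k h j| ≤ G (((j : ℝ) + 1) * h) - G (((j : ℝ) - 1) * h) := by
  obtain ⟨k', hk', hkk'⟩ := hkBV
  obtain ⟨p, q, hp, hq, hpq⟩ := hk'.exists_monotoneOn_sub_monotoneOn
  rw [monotoneOn_univ] at hp hq
  -- The good representative is k' = p - q with p, q monotone, and p + q dominates its oscillation
  -- on every interval.
  refine ⟨fun x => p x + q x, hp.add hq, fun h hh j => ?_⟩
  have osc : ∀ {x y l r : ℝ}, x ∈ Icc l r → y ∈ Icc l r →
      |k' x - k' y| ≤ (p r + q r) - (p l + q l) := by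
    intro x y l r hx hy
    have e : ∀ z, k' z = p z - q z := fun z => by rw [hpq]; rfl
    rw [e, e, abs_le]
    constructor <;> linarith [hp hx.1, hp hx.2, hp hy.1, hp hy.2, hq hx.1, hq hx.2, hq hy.1, hq hy.2]
  have avg : ∀ (i : ℤ) {y l r : ℝ}, l ≤ (i : ℝ) * h → ((i : ℝ) + 1) * h ≤ r → y ∈ Icc l r →
      |coeffAvg k h i - k' y| ≤ (p r + q r) - (p l + q l) := by
    intro i y l r hl hr hy
    refine abs_coeffAvg_sub_le hk hh i ?_
    filter_upwards [hkk'] with x hx hx'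
    rw [hx]
    exact osc ⟨hl.trans hx'.1, hx'.2.trans hr⟩ hy
  constructor
  · refine abs_coeffAvg_sub_le hk hh (j + 1) ?_
    filter_upwards [hkk'] with x hx hx'
    push_cast at hx'
    rw [hx, abs_sub_comm]
    exact avg j le_rfl (by nlinarith) ⟨by nlinarith [hx'.1], by nlinarith [hx'.2]⟩
  -- Both the cell around x_j and the averaging interval [x_j, x_{j+1}] lie in [x_{j-1}, x_{j+1}].
  · filter_upwards [hkk'] with x hx hx'
    rw [hx, abs_sub_comm]
    exact avg j (by nlinarith) le_rfl ⟨by nlinarith [hx'.1], by nlinarith [hx'.2]⟩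

end

/-- A two-step difference is the one-step difference of G(j) + G(j + 1), so the sum telescopes and
the total increase counts twice. The shift s covers forward windows (s = 0) and centred ones (s =
-1). -/
theorem sum_two_step_telescope_le {G : ℝ → ℝ} (hG : Monotone G) {h ρ : ℝ} (hh : 0 < h) {J : ℤ}
    (hJ : 0 ≤ J) (hρ : ((J : ℝ) + 2) * h ≤ ρ) {s : ℝ} (hs : -1 ≤ s) (hs' : s ≤ 0) :
    ∑ j ∈ Finset.Icc (-J) J, (G (((j : ℝ) + 2 + s) * h) - G (((j : ℝ) + s) * h))
      ≤ 2 * (G ρ - G (-ρ)) := by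
  have e := sum_Icc_telescope (fun j : ℤ => G (((j : ℝ) + s) * h) + G (((j : ℝ) + 1 + s) * h))
    (by lia : -J ≤ J)
  have hJ0 : (0 : ℝ) ≤ J := by exact_mod_cast hJ
  refine (le_of_eq (Eq.trans (Finset.sum_congr rfl fun j _ => ?_) e)).trans ?_
  · push_cast
    rw [show (j : ℝ) + 1 + 1 + s = j + 2 + s by ring]
    ring
  · push_cast
    have u1 : G (((J : ℝ) + 1 + s) * h) ≤ G ρ := hG (by nlinarith)
    have u2 : G (((J : ℝ) + 1 + 1 + s) * h) ≤ G ρ := hG (by nlinarith)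
    have l1 : G (-ρ) ≤ G ((-(J : ℝ) + s) * h) := hG (by nlinarith)
    have l2 : G (-ρ) ≤ G ((-(J : ℝ) + 1 + s) * h) := hG (by nlinarith)
    linarith

/-! ### The flux function -/

/-- `g` is a Lipschitz continuous derivative of `f` on `[a, b]`. -/
structure HasLipschitzDeriv (f g : ℝ → ℝ) (L a b : ℝ) : Prop where
  lip : ∀ s ∈ Icc a b, ∀ t ∈ Icc a b, |g s - g t| ≤ L * |s - t|
  integral : ∀ s ∈ Icc a b, ∀ t ∈ Icc a b, ∫ θ in s..t, g θ = f t - f s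

theorem exists_hasLipschitzDeriv {f : ℝ → ℝ} {a b : ℝ} (hab : a ≤ b)
    (hf : ContDiffOn ℝ 2 f (Icc a b)) :
    ∃ L, 0 ≤ L ∧ HasLipschitzDeriv f (derivWithin f (Icc a b)) L a b := by
  rcases hab.eq_or_lt with rfl | hlt
  · refine ⟨0, le_rfl, fun s hs t ht => ?_, fun s hs t ht => ?_⟩ <;>
    · rw [Icc_self, mem_singleton_iff] at hs ht
      subst hs ht
      simp
  · have hu := uniqueDiffOn_Icc hlt
    have hg : ContDiffOn ℝ 1 (derivWithin f (Icc a b)) (Icc a b) :=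
      hf.derivWithin hu (by norm_num)
    have hgd := hg.differentiableOn one_ne_zero
    obtain ⟨L, hL⟩ := isCompact_Icc.exists_bound_of_continuousOn
      (hg.continuousOn_derivWithin hu le_rfl)
    refine ⟨L, (norm_nonneg _).trans (hL a (left_mem_Icc.2 hab)), fun s hs t ht => ?_,
      fun s hs t ht => ?_⟩
    · exact (convex_Icc a b).norm_image_sub_le_of_norm_derivWithin_le hgd hL ht hs
    · have hsub : uIcc s t ⊆ Icc a b := ordConnected_Icc.uIcc_subset hs ht
      refine intervalIntegral.integral_eq_sub_of_hasDeriv_right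
        (hf.continuousOn.mono hsub) (fun x hx => ?_)
        (hg.continuousOn.mono hsub).intervalIntegrable
      have hx' : x ∈ Ioo a b := by
        constructor
        · exact lt_of_le_of_lt (le_min hs.1 ht.1) hx.1
        · exact lt_of_lt_of_le hx.2 (max_le hs.2 ht.2)
      have := ((hf.differentiableOn two_ne_zero) x (Ioo_subset_Icc_self hx')).hasDerivWithinAt
      exact (this.hasDerivAt (Icc_mem_nhds hx'.1 hx'.2)).hasDerivWithinAt

section

variable {f g : ℝ → ℝ} {L a b : ℝ}

theorem HasLipschitzDeriv.mono (h : HasLipschitzDeriv f g L a b) {a' b' : ℝ}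
    (hab : Icc a' b' ⊆ Icc a b) : HasLipschitzDeriv f g L a' b' :=
  ⟨fun s hs t ht => h.lip s (hab hs) t (hab ht),
    fun s hs t ht => h.integral s (hab hs) t (hab ht)⟩

theorem HasLipschitzDeriv.continuousOn (h : HasLipschitzDeriv f g L a b) :
    ContinuousOn g (Icc a b) := by
  have : LipschitzOnWith L.toNNReal g (Icc a b) :=
    LipschitzOnWith.of_dist_le_mul fun s hs t ht => by
      rw [Real.dist_eq, Real.dist_eq]
      exact (h.lip s hs t ht).trans
        (mul_le_mul_of_nonneg_right (Real.le_coe_toNNReal L) (abs_nonneg _))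
  exact this.continuousOn

theorem uIcc_subset_of_mem {s t : ℝ} (hs : s ∈ Icc a b) (ht : t ∈ Icc a b) :
    uIcc s t ⊆ Icc a b := ordConnected_Icc.uIcc_subset hs ht

theorem intervalIntegrable_of_mem {w : ℝ → ℝ} (hw : ContinuousOn w (Icc a b)) {s t : ℝ}
    (hs : s ∈ Icc a b) (ht : t ∈ Icc a b) : IntervalIntegrable w volume s t :=
  (hw.mono (uIcc_subset_of_mem hs ht)).intervalIntegrable

theorem abs_integral_le_of_mem {w : ℝ → ℝ} {M s t : ℝ}
    (hM : ∀ θ ∈ uIcc s t, |w θ| ≤ M) : |∫ θ in s..t, w θ| ≤ M * |s - t| := by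
  rw [abs_sub_comm]
  exact intervalIntegral.norm_integral_le_of_norm_le_const (f := w) (C := M) fun θ hθ =>
    hM θ (uIoc_subset_uIcc hθ)

theorem HasLipschitzDeriv.f_sub (h : HasLipschitzDeriv f g L a b) {M : ℝ}
    (hM : ∀ s ∈ Icc a b, |g s| ≤ M) {s t : ℝ} (hs : s ∈ Icc a b) (ht : t ∈ Icc a b) :
    |f s - f t| ≤ M * |s - t| := by
  rw [abs_sub_comm, ← h.integral s hs t ht]
  exact abs_integral_le_of_mem fun θ hθ => hM θ (uIcc_subset_of_mem hs ht hθ)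

theorem HasLipschitzDeriv.continuousOn_f (h : HasLipschitzDeriv f g L a b) :
    ContinuousOn f (Icc a b) := by
  obtain ⟨M, hM⟩ := isCompact_Icc.exists_bound_of_continuousOn h.continuousOn
  have : LipschitzOnWith M.toNNReal f (Icc a b) :=
    LipschitzOnWith.of_dist_le_mul fun s hs t ht => by
      rw [Real.dist_eq, Real.dist_eq]
      exact (h.f_sub hM hs ht).trans
        (mul_le_mul_of_nonneg_right (Real.le_coe_toNNReal M) (abs_nonneg _))
  exact this.continuousOn

theorem abs_sub_le_of_mem_uIcc {s t θ : ℝ} (hθ : θ ∈ uIcc s t) : |θ - s| ≤ |s - t| := by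
  rw [abs_sub_comm s t]
  exact abs_sub_left_of_mem_uIcc hθ

theorem abs_sub_le_of_mem_uIcc' {s t θ : ℝ} (hθ : θ ∈ uIcc s t) : |θ - t| ≤ |s - t| := by
  rw [abs_sub_comm θ t, abs_sub_comm s t]
  rw [uIcc_comm] at hθ
  have := abs_sub_left_of_mem_uIcc hθ
  rwa [abs_sub_comm, abs_sub_comm s t] at this

theorem HasLipschitzDeriv.taylor (h : HasLipschitzDeriv f g L a b) (hL : 0 ≤ L) {s t : ℝ}
    (hs : s ∈ Icc a b) (ht : t ∈ Icc a b) :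
    |f t - f s - g s * (t - s)| ≤ L * (t - s) ^ 2 := by
  have e : f t - f s - g s * (t - s) = ∫ θ in s..t, (g θ - g s) := by
    rw [intervalIntegral.integral_sub (intervalIntegrable_of_mem h.continuousOn hs ht)
      intervalIntegrable_const, h.integral s hs t ht, intervalIntegral.integral_const, smul_eq_mul]
    ring
  rw [e]
  refine (abs_integral_le_of_mem (M := L * |s - t|) fun θ hθ => ?_).trans (le_of_eq ?_)
  · exact (h.lip θ (uIcc_subset_of_mem hs ht hθ) s hs).trans
      (mul_le_mul_of_nonneg_left (abs_sub_le_of_mem_uIcc hθ) hL)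
  · rw [mul_assoc, abs_mul_abs_self]; ring

/-- The trapezoidal rule, with the error estimated by the total variation. -/
theorem HasLipschitzDeriv.trapezoid (h : HasLipschitzDeriv f g L a b) {s t : ℝ}
    (hs : s ∈ Icc a b) (ht : t ∈ Icc a b) :
    |(∫ θ in s..t, f θ) - 1 / 2 * (f s + f t) * (t - s)|
      ≤ 1 / 2 * (∫ θ in s..t, |g θ|) * (t - s) := by
  wlog hst : s ≤ t generalizing s t
  · have := this ht hs (le_of_not_ge hst)
    rw [intervalIntegral.integral_symm t s, intervalIntegral.integral_symm t s]
    rw [← abs_neg]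
    convert this using 1
    · congr 1; ring
    · ring
  have hc := h.continuousOn
  have e : (∫ θ in s..t, f θ) - 1 / 2 * (f s + f t) * (t - s)
      = ∫ θ in s..t, (f θ - 1 / 2 * (f s + f t)) := by
    rw [intervalIntegral.integral_sub (intervalIntegrable_of_mem h.continuousOn_f hs ht)
      intervalIntegrable_const, intervalIntegral.integral_const, smul_eq_mul]
    ring
  rw [e]
  refine (abs_integral_le_of_mem (M := 1 / 2 * ∫ θ in s..t, |g θ|) fun θ hθ => ?_).trans
    (le_of_eq ?_)
  · have hθ' := uIcc_subset_of_mem hs ht hθ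
    rw [uIcc_of_le hst] at hθ
    have v1 : |f θ - f s| ≤ ∫ x in s..θ, |g x| := by
      rw [← h.integral s hs θ hθ']
      exact intervalIntegral.abs_integral_le_integral_abs hθ.1
    have v2 : |f t - f θ| ≤ ∫ x in θ..t, |g x| := by
      rw [← h.integral θ hθ' t ht]
      exact intervalIntegral.abs_integral_le_integral_abs hθ.2
    rw [← intervalIntegral.integral_add_adjacent_intervals
      (intervalIntegrable_of_mem hc.abs hs hθ') (intervalIntegrable_of_mem hc.abs hθ' ht)]
    rw [abs_le] at v1 v2 ⊢
    constructor <;> linarith [v1.1, v1.2, v2.1, v2.2]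
  · rw [abs_of_nonpos (by linarith : s - t ≤ 0)]; ring

theorem HasLipschitzDeriv.fluxBounds (h : HasLipschitzDeriv f g L a b) (hab : a ≤ b) {M : ℝ}
    (hfM : ∀ s ∈ Icc a b, |f s| ≤ M) (hgM : ∀ s ∈ Icc a b, |g s| ≤ M) :
    FluxBounds f (fun s => ∫ θ in a..s, |g θ|) (fun s => ∫ θ in a..s, f θ) M
      (|a| + |b| + M * (b - a)) a b := by
  have ha := left_mem_Icc.2 hab
  have hM := (abs_nonneg _).trans (hfM a ha)
  have hV : ∀ s ∈ Icc a b, ∀ t ∈ Icc a b,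
      (∫ θ in a..t, |g θ|) - (∫ θ in a..s, |g θ|) = ∫ θ in s..t, |g θ| := fun s hs t ht =>
    intervalIntegral.integral_interval_sub_left (intervalIntegrable_of_mem h.continuousOn.abs ha ht)
      (intervalIntegrable_of_mem h.continuousOn.abs ha hs)
  have hF : ∀ s ∈ Icc a b, ∀ t ∈ Icc a b,
      (∫ θ in a..t, f θ) - (∫ θ in a..s, f θ) = ∫ θ in s..t, f θ := fun s hs t ht =>
    intervalIntegral.integral_interval_sub_left (intervalIntegrable_of_mem h.continuousOn_f ha ht)
      (intervalIntegrable_of_mem h.continuousOn_f ha hs)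
  refine ⟨hfM, fun s hs t ht => h.f_sub hgM hs ht, fun s hs t ht => ?_, fun s hs t ht c => ?_,
    fun s hs => ?_, fun s hs => ?_⟩
  · rw [abs_sub_comm, hV s hs t ht]
    refine abs_integral_le_of_mem fun θ hθ => ?_
    rw [abs_abs]
    exact hgM θ (uIcc_subset_of_mem hs ht hθ)
  · rw [hV s hs t ht, hF s hs t ht]
    -- The trapezoidal error is dominated by the numerical viscosity; multiplication by |c| makes
    -- this work for both signs of c.
    have key := mul_le_mul_of_nonneg_left (h.trapezoid hs ht) (abs_nonneg c)
    rw [← abs_mul] at key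
    have := (neg_le_abs _).trans key
    linarith
  · have h1 := neg_abs_le a
    have h2 := le_abs_self b
    have h3 : 0 ≤ M * (b - a) := mul_nonneg hM (by linarith)
    rw [abs_le]
    constructor <;> linarith [hs.1, hs.2, abs_nonneg a, abs_nonneg b]
  · refine (abs_integral_le_of_mem fun θ hθ => hfM θ (uIcc_subset_of_mem ha hs hθ)).trans ?_
    have : M * |a - s| ≤ M * (b - a) := by
      refine mul_le_mul_of_nonneg_left ?_ hM
      rw [abs_le]
      constructor <;> linarith [hs.1, hs.2]
    linarith [abs_nonneg a, abs_nonneg b]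

/-- Transposing the arguments of the Engquist–Osher flux changes only the sign of its viscous part,
so both cases of the definition become one formula with |κ|. -/
theorem HasLipschitzDeriv.numFlux_eq (h : HasLipschitzDeriv f g L a b) (hab : a ≤ b) {k : ℝ → ℝ}
    {d : ℝ} {v : ℤ → ℝ} (hv : ∀ j, v j ∈ Icc a b) (j : ℤ) :
    numFlux f g k d v j = eoFlux f (fun s => ∫ θ in a..s, |g θ|) (coeffAvg k d) v j := by
  have ha := left_mem_Icc.2 hab
  have hV : (∫ θ in a..v (j + 1), |g θ|) - (∫ θ in a..v j, |g θ|)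
      = ∫ θ in (v j)..(v (j + 1)), |g θ| :=
    intervalIntegral.integral_interval_sub_left
      (intervalIntegrable_of_mem h.continuousOn.abs ha (hv _))
      (intervalIntegrable_of_mem h.continuousOn.abs ha (hv _))
  rw [numFlux, eoFlux]
  simp only [hV, engquistOsher]
  split_ifs with hk
  · rw [abs_of_nonneg hk]; ring
  · rw [abs_of_neg (not_le.1 hk), intervalIntegral.integral_symm (v j)]
    ring

end

/-! ### The discrete entropy pairs -/

section

variable {f : ℝ → ℝ} {M L c lo hi : ℝ} {κ : ℤ → ℝ} {N : ℕ} {u : ℕ → ℤ → ℝ}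

theorem abs_mul_le_of_le {x y X Y : ℝ} (hx : |x| ≤ X) (hy : |y| ≤ Y) : |x * y| ≤ X * Y := by
  rw [abs_mul]
  exact mul_le_mul hx hy (abs_nonneg _) ((abs_nonneg _).trans hx)

/-- For this pair v = 1. The entropy has no Taylor remainder, and the flux deviates from κ f(u) only
by -f(c) times the jump of κ. -/
theorem isEntropyPair_identity (hM : 0 ≤ M) (hfM : ∀ s ∈ Icc lo hi, |f s| ≤ M)
    (hfs : ∀ s ∈ Icc lo hi, ∀ t ∈ Icc lo hi, |f s - f t| ≤ M * |s - t|)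
    (hκ : ∀ j, |κ j| ≤ M) (hu : ∀ n < N, ∀ j, u n j ∈ Icc lo hi) (hc : |f c| ≤ L) {C : ℝ}
    (hC : 1 + M + L + M * M + M * L ≤ C) :
    IsEntropyPair f C κ N u (fun _ _ => 1) (fun n j => u n j - c)
      (fun n j => κ j * (f (u n j) - f c)) := by
  have hL := (abs_nonneg _).trans hc
  have p1 : 0 ≤ M * M := by positivity
  have p2 : 0 ≤ M * L := by positivity
  have hC0 : 0 ≤ C := by linarith
  refine ⟨fun n hn j => ?_, fun n hn j => ?_, fun n hn j => ?_, fun n hn j => ?_, fun n hn j => ?_,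
    fun n hn j => ?_, fun n hn j => ?_⟩
  · rw [abs_one]; linarith
  · rw [sub_self, abs_zero]; positivity
  · rw [sub_sub_sub_cancel_right]
    exact le_mul_of_one_le_left (abs_nonneg _) (by linarith)
  · rw [show u (n + 1) j - c - (u n j - c) - 1 * (u (n + 1) j - u n j) = 0 by ring, abs_zero]
    positivity
  · have := abs_mul_le_of_le (hκ j) ((abs_sub (f (u n j)) (f c)).trans
      (add_le_add (hfM _ (hu n hn j)) hc))
    linarith
  · have h1 := abs_mul_le_of_le (hκ j) (hfs _ (hu n hn j) _ (hu n hn (j - 1)))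
    have h2 := abs_mul_le_of_le (le_refl |κ j - κ (j - 1)|)
      ((abs_sub (f (u n (j - 1))) (f c)).trans (add_le_add (hfM _ (hu n hn (j - 1))) hc))
    have e : κ j * (f (u n j) - f c) - κ (j - 1) * (f (u n (j - 1)) - f c)
        = κ j * (f (u n j) - f (u n (j - 1)))
          + (κ j - κ (j - 1)) * (f (u n (j - 1)) - f c) := by ring
    rw [e]
    refine (abs_add_le _ _).trans ((add_le_add h1 h2).trans ?_)
    have b1 := mul_le_mul_of_nonneg_right (by linarith : M * M ≤ C)
      (abs_nonneg (u n j - u n (j - 1)))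
    have b2 := mul_le_mul_of_nonneg_right (by linarith : M + L ≤ C) (abs_nonneg (κ j - κ (j - 1)))
    linarith
  · have e : κ j * (f (u n j) - f c) - κ (j - 1) * (f (u n (j - 1)) - f c)
        - 1 * (κ j * f (u n j) - κ (j - 1) * f (u n (j - 1)))
          = -(f c * (κ j - κ (j - 1))) := by ring
    rw [e, abs_neg, abs_mul]
    have b := mul_le_mul_of_nonneg_right (by linarith : |f c| ≤ C) (abs_nonneg (κ j - κ (j - 1)))
    have b' : 0 ≤ C * (u n j - u n (j - 1)) ^ 2 := by positivity
    linarith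

/-- Here v = κ f'(u). The coefficient is independent of time, so the time remainder is that of f. In
space the increment of κ²G is compared with κ f'(u) times the increment of κ f(u): with κ frozen the
remainder is quadratic in the jump of u, and all other terms contain the jump of κ. -/
theorem isEntropyPair_flux {g G : ℝ → ℝ} (hM : 0 ≤ M) (hL : 0 ≤ L)
    (hfM : ∀ s ∈ Icc lo hi, |f s| ≤ M) (hgM : ∀ s ∈ Icc lo hi, |g s| ≤ M)
    (hfs : ∀ s ∈ Icc lo hi, ∀ t ∈ Icc lo hi, |f s - f t| ≤ M * |s - t|)
    (hgs : ∀ s ∈ Icc lo hi, ∀ t ∈ Icc lo hi, |g s - g t| ≤ L * |s - t|)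
    (hft : ∀ s ∈ Icc lo hi, ∀ t ∈ Icc lo hi, |f t - f s - g s * (t - s)| ≤ L * (t - s) ^ 2)
    (hGL : ∀ s ∈ Icc lo hi, |G s| ≤ L)
    (hGs : ∀ s ∈ Icc lo hi, ∀ t ∈ Icc lo hi, |G s - G t| ≤ M * M * |s - t|)
    (hGt : ∀ s ∈ Icc lo hi, ∀ t ∈ Icc lo hi,
      |G t - G s - g t * (f t - f s)| ≤ M * L * (t - s) ^ 2)
    (hκ : ∀ j, |κ j| ≤ M) (hu : ∀ n < N, ∀ j, u n j ∈ Icc lo hi) {C : ℝ}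
    (hC : M + M * M + M * L + 2 * (M * L) + M * (M * M) + M * M * L + M * M * (M * M)
      + M * M * (M * L) ≤ C) :
    IsEntropyPair f C κ N u (fun n j => κ j * g (u n j)) (fun n j => κ j * (f (u n j) - f c))
      (fun n j => κ j ^ 2 * G (u n j)) := by
  have p1 : 0 ≤ M * M := by positivity
  have p2 : 0 ≤ M * L := by positivity
  have p3 : 0 ≤ M * (M * M) := by positivity
  have p4 : 0 ≤ M * M * L := by positivity
  have p5 : 0 ≤ M * M * (M * M) := by positivity
  have p6 : 0 ≤ M * M * (M * L) := by positivity
  have hC0 : 0 ≤ C := by linarith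
  have hκ2 : ∀ j, |κ j ^ 2| ≤ M * M := fun j => by
    rw [sq]; exact abs_mul_le_of_le (hκ j) (hκ j)
  have hκd : ∀ j, |κ j ^ 2 - κ (j - 1) ^ 2| ≤ 2 * M * |κ j - κ (j - 1)| := fun j => by
    rw [sq_sub_sq]
    exact abs_mul_le_of_le ((abs_add_le _ _).trans (by linarith [hκ j, hκ (j - 1)])) le_rfl
  refine ⟨fun n hn j => ?_, fun n hn j => ?_, fun n hn j => ?_, fun n hn j => ?_, fun n hn j => ?_,
    fun n hn j => ?_, fun n hn j => ?_⟩
  · exact (abs_mul_le_of_le (hκ j) (hgM _ (hu n hn j))).trans (by linarith)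
  · have h1 := abs_mul_le_of_le (hκ j) (hgs _ (hu n hn (j + 1)) _ (hu n hn j))
    have h2 := abs_mul_le_of_le (le_refl |κ (j + 1) - κ j|) (hgM _ (hu n hn (j + 1)))
    have e : κ (j + 1) * g (u n (j + 1)) - κ j * g (u n j)
        = κ j * (g (u n (j + 1)) - g (u n j)) + (κ (j + 1) - κ j) * g (u n (j + 1)) := by ring
    rw [e]
    refine (abs_add_le _ _).trans ((add_le_add h1 h2).trans ?_)
    have b1 := mul_le_mul_of_nonneg_right (by linarith : M * L ≤ C)
      (abs_nonneg (u n (j + 1) - u n j))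
    have b2 := mul_le_mul_of_nonneg_right (by linarith : M ≤ C) (abs_nonneg (κ (j + 1) - κ j))
    linarith
  · have h1 := abs_mul_le_of_le (hκ j) (hfs _ (hu (n + 1) hn j) _ (hu n (by lia) j))
    rw [← mul_sub, sub_sub_sub_cancel_right]
    have b1 := mul_le_mul_of_nonneg_right (by linarith : M * M ≤ C)
      (abs_nonneg (u (n + 1) j - u n j))
    linarith
  · have h1 := abs_mul_le_of_le (hκ j) (hft _ (hu n (by lia) j) _ (hu (n + 1) hn j))
    have e : κ j * (f (u (n + 1) j) - f c) - κ j * (f (u n j) - f c)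
        - κ j * g (u n j) * (u (n + 1) j - u n j)
          = κ j * (f (u (n + 1) j) - f (u n j) - g (u n j) * (u (n + 1) j - u n j)) := by ring
    rw [e]
    have b1 := mul_le_mul_of_nonneg_right (by linarith : M * L ≤ C)
      (sq_nonneg (u (n + 1) j - u n j))
    linarith
  · exact (abs_mul_le_of_le (hκ2 j) (hGL _ (hu n hn j))).trans (by linarith)
  · have h1 := abs_mul_le_of_le (hκ2 j) (hGs _ (hu n hn j) _ (hu n hn (j - 1)))
    have h2 := abs_mul_le_of_le (hκd j) (hGL _ (hu n hn (j - 1)))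
    have e : κ j ^ 2 * G (u n j) - κ (j - 1) ^ 2 * G (u n (j - 1))
        = κ j ^ 2 * (G (u n j) - G (u n (j - 1)))
          + (κ j ^ 2 - κ (j - 1) ^ 2) * G (u n (j - 1)) := by ring
    rw [e]
    refine (abs_add_le _ _).trans ((add_le_add h1 h2).trans ?_)
    have b1 := mul_le_mul_of_nonneg_right (by linarith : M * M * (M * M) ≤ C)
      (abs_nonneg (u n j - u n (j - 1)))
    have b2 := mul_le_mul_of_nonneg_right (by linarith : 2 * (M * L) ≤ C)
      (abs_nonneg (κ j - κ (j - 1)))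
    linarith
  · have h1 := abs_mul_le_of_le (hκ2 j) (hGt _ (hu n hn (j - 1)) _ (hu n hn j))
    have h2 := abs_mul_le_of_le (hκd j) (hGL _ (hu n hn (j - 1)))
    have h3 := abs_mul_le_of_le (abs_mul_le_of_le (hκ j) (hgM _ (hu n hn j)))
      (abs_mul_le_of_le (le_refl |κ j - κ (j - 1)|) (hfM _ (hu n hn (j - 1))))
    have e : κ j ^ 2 * G (u n j) - κ (j - 1) ^ 2 * G (u n (j - 1))
        - κ j * g (u n j) * (κ j * f (u n j) - κ (j - 1) * f (u n (j - 1)))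
        = κ j ^ 2 * (G (u n j) - G (u n (j - 1)) - g (u n j) * (f (u n j) - f (u n (j - 1))))
          + ((κ j ^ 2 - κ (j - 1) ^ 2) * G (u n (j - 1))
          - κ j * g (u n j) * ((κ j - κ (j - 1)) * f (u n (j - 1)))) := by ring
    rw [e]
    refine (abs_add_le _ _).trans ((add_le_add h1 ((abs_sub _ _).trans (add_le_add h2 h3))).trans ?_)
    have b1 := mul_le_mul_of_nonneg_right (by linarith : M * M * (M * L) ≤ C)
      (sq_nonneg (u n j - u n (j - 1)))
    have b2 := mul_le_mul_of_nonneg_right (by linarith : 2 * (M * L) + M * (M * M) ≤ C)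
      (abs_nonneg (κ j - κ (j - 1)))
    linarith

end

/-! ### The entropy flux belonging to the entropy f -/

section

variable {f g : ℝ → ℝ} {L a b : ℝ}

/-- The entropy flux `∫_c^s f'(θ)² dθ` belongs to the entropy `f`. -/
theorem HasLipschitzDeriv.abs_entropyFlux_sub_le (h : HasLipschitzDeriv f g L a b) {c M : ℝ}
    (hc : c ∈ Icc a b) {a' b' : ℝ} (hab : Icc a' b' ⊆ Icc a b) (hgM : ∀ s ∈ Icc a' b', |g s| ≤ M)
    {s t : ℝ} (hs : s ∈ Icc a' b') (ht : t ∈ Icc a' b') :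
    |(∫ θ in c..s, g θ ^ 2) - ∫ θ in c..t, g θ ^ 2| ≤ M * M * |s - t| := by
  have hc2 : ContinuousOn (fun θ => g θ ^ 2) (Icc a b) := h.continuousOn.pow 2
  rw [intervalIntegral.integral_interval_sub_left (intervalIntegrable_of_mem hc2 hc (hab hs))
    (intervalIntegrable_of_mem hc2 hc (hab ht)), abs_sub_comm s t]
  refine abs_integral_le_of_mem fun θ hθ => ?_
  have := hgM θ (uIcc_subset_of_mem ht hs hθ)
  rw [sq]
  exact abs_mul_le_of_le this this

/-- The left side is the integral of g (g - g(t)) over the interval from s to t, and the second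
factor is at most L|s - t|. The slope is taken at the endpoint t, to match the backward differences
of the flux. -/
theorem HasLipschitzDeriv.abs_entropyFlux_taylor_le (h : HasLipschitzDeriv f g L a b)
    (hL : 0 ≤ L) {c M : ℝ}
    (hc : c ∈ Icc a b) {a' b' : ℝ} (hab : Icc a' b' ⊆ Icc a b) (hgM : ∀ s ∈ Icc a' b', |g s| ≤ M)
    {s t : ℝ} (hs : s ∈ Icc a' b') (ht : t ∈ Icc a' b') :
    |(∫ θ in c..t, g θ ^ 2) - (∫ θ in c..s, g θ ^ 2) - g t * (f t - f s)|
      ≤ M * L * (t - s) ^ 2 := by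
  have hc2 : ContinuousOn (fun θ => g θ ^ 2) (Icc a b) := h.continuousOn.pow 2
  have hM := (abs_nonneg _).trans (hgM s hs)
  have e : (∫ θ in c..t, g θ ^ 2) - (∫ θ in c..s, g θ ^ 2) - g t * (f t - f s)
      = ∫ θ in s..t, (g θ ^ 2 - g t * g θ) := by
    rw [intervalIntegral.integral_interval_sub_left (intervalIntegrable_of_mem hc2 hc (hab ht))
      (intervalIntegrable_of_mem hc2 hc (hab hs)), ← h.integral s (hab hs) t (hab ht),
      intervalIntegral.integral_sub (intervalIntegrable_of_mem hc2 (hab hs) (hab ht))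
      ((intervalIntegrable_of_mem h.continuousOn (hab hs) (hab ht)).const_mul _),
      intervalIntegral.integral_const_mul]
  rw [e]
  refine (abs_integral_le_of_mem (M := M * (L * |s - t|)) fun θ hθ => ?_).trans (le_of_eq ?_)
  · have hθ' := uIcc_subset_of_mem hs ht hθ
    rw [show g θ ^ 2 - g t * g θ = g θ * (g θ - g t) by ring]
    exact abs_mul_le_of_le (hgM θ hθ') ((h.lip θ (hab hθ') t (hab ht)).trans
      (mul_le_mul_of_nonneg_left (abs_sub_le_of_mem_uIcc' hθ) hL))
  · rw [mul_assoc, mul_assoc, abs_mul_abs_self]; ring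

end

theorem entropyFlux₂_eq (g : ℝ → ℝ) (c κ s : ℝ) :
    entropyFlux₂ g c κ s = κ ^ 2 * ∫ θ in c..s, g θ ^ 2 := by
  simp only [entropyFlux₂, mul_pow, intervalIntegral.integral_const_mul]

/-! ### The scheme in undivided form -/

/-- Every cell has positive measure, so a bound almost everywhere holds at some point of the cell,
hence for its value. Level N is excluded because its cells lie in t ≥ T. -/
theorem mem_Icc_of_ae_gridFun {h τ T lo hi : ℝ} (hh : 0 < h) (hτ : 0 < τ) {N : ℕ}
    (hN : (N : ℝ) * τ = T) {u : ℕ → ℤ → ℝ}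
    (hu : ∀ᵐ p : ℝ × ℝ, p ∈ univ ×ˢ Icc 0 T → lo ≤ gridFun h τ u p ∧ gridFun h τ u p ≤ hi)
    {n : ℕ} (hn : n < N) (j : ℤ) : u n j ∈ Icc lo hi := by
  have hpos : (volume : Measure (ℝ × ℝ)) (cell h τ n j) ≠ 0 := fun h0 => by
    have := measureReal_cell hh hτ n j
    rw [measureReal_def, h0, ENNReal.toReal_zero] at this
    exact (mul_pos hh hτ).ne this
  have hfr : ∃ᵐ p ∂(volume : Measure (ℝ × ℝ)), p ∈ cell h τ n j :=
    frequently_ae_mem_iff.2 hpos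
  obtain ⟨p, hp, hp'⟩ := (hfr.and_eventually hu).exists
  rw [gridFun_eq hh hτ u n j hp] at hp'
  refine hp' ⟨mem_univ _, ?_, ?_⟩
  · exact le_trans (by positivity) hp.2.1
  · have hn' : ((n : ℝ) + 1) ≤ N := by exact_mod_cast hn
    have := mul_le_mul_of_nonneg_right hn' hτ.le
    linarith [hp.2.2]

/-- With a = γμ/h² the second CFL expression is (r/2)(1 + β/a); the first one yields r ≤ 2, 2M ≤ 1
and 2M ≤ β. -/
theorem IsSchemeSolution.isFlow {f g k u₀ : ℝ → ℝ} {L M β γ δ μ h τ A lo hi : ℝ} {N : ℕ}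
    {u : ℕ → ℤ → ℝ} (hu : IsSchemeSolution f g k u₀ β γ μ h τ N u)
    (hf : HasLipschitzDeriv f g L lo hi) (hlo : lo ≤ hi) (hk : MemLp k ⊤ volume)
    (hkM : (eLpNorm k ⊤ volume).toReal ≤ M) (hh : 0 < h) (hτ : 0 < τ) (hγ : 0 < γ) (hμ : 0 < μ)
    (hA : γ * μ / h ^ 2 ≤ A) (hδ : 0 < δ) (hCFL : CFL M β γ δ μ h τ)
    (hmem : ∀ n < N, ∀ j, u n j ∈ Icc lo hi) :
    IsFlow f (fun s => ∫ θ in lo..s, |g θ|) M β δ A lo hi (coeffAvg k h) h (τ / h)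
      (γ * μ / h ^ 2) N u := by
  obtain ⟨h1, h2⟩ := max_le_iff.1 hCFL
  have h1a := h1.trans (min_le_left _ _)
  have h1b := h1.trans (min_le_right _ _)
  have h2a := h2.trans (min_le_left _ _)
  have hr : 0 < τ / h := by positivity
  have hM : 0 ≤ M := ENNReal.toReal_nonneg.trans hkM
  refine ⟨hh, hr, by positivity, hA, fun j => (abs_coeffAvg_le hk hh j).trans hkM, hmem,
    fun n hn j => ?_, ?_, by linarith, by linarith, by linarith⟩
  · have e := hu.step n (by lia) j
    have hf' := hf.numFlux_eq hlo (k := k) (d := h) (hmem n (by lia))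
    simp only [dTime, dMinus, dPlus, hf', add_sub_cancel_right] at e
    field_simp at e ⊢
    linear_combination e
  · refine le_trans (le_of_eq ?_) h2a
    rw [div_div_eq_mul_div]

/-! ### The entropy production of the approximate solutions -/

/-- The trapezoidal weight which equals one where `(J - |j|) h ≥ 1`. -/
noncomputable def trapezoidWeight (h : ℝ) (J j : ℤ) : ℝ := min 1 (h * max 0 ((J : ℝ) - |(j : ℝ)|))

theorem isCutoff_trapezoidWeight {h : ℝ} (hh : 0 < h) {J : ℤ} (hJ : 0 ≤ J) :
    IsCutoff h J (trapezoidWeight h J) := by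
  refine ⟨hJ, fun j => ?_, fun j => min_le_left _ _, fun j => ?_, fun j hj => ?_⟩
  · exact le_min zero_le_one (mul_nonneg hh.le (le_max_left _ _))
  · have h1 : abs (|((j + 1 : ℤ) : ℝ)| - |(j : ℝ)|) ≤ 1 := by
      refine (abs_abs_sub_abs_le_abs_sub _ _).trans ?_
      push_cast
      simp
    have h2 : ∀ x y : ℝ, |max 0 x - max 0 y| ≤ |x - y| := fun x y => by
      simpa using abs_max_sub_max_le_max 0 x 0 y
    have h3 : ∀ x y : ℝ, |min 1 x - min 1 y| ≤ |x - y| := fun x y => by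
      simpa using abs_min_sub_min_le_max 1 x 1 y
    refine (h3 _ _).trans ?_
    rw [← mul_sub, abs_mul, abs_of_pos hh]
    refine mul_le_of_le_one_right hh.le ((h2 _ _).trans ?_)
    rwa [sub_sub_sub_cancel_left, abs_sub_comm]
  · have : (J : ℝ) - |(j : ℝ)| ≤ 0 := by
      have : (J : ℝ) ≤ |(j : ℝ)| := by exact_mod_cast hj
      linarith
    rw [trapezoidWeight, max_eq_left this, mul_zero, min_eq_right zero_le_one]

theorem trapezoidWeight_eq_one {h : ℝ} (hh : 0 < h) {J j : ℤ} (hj : 1 ≤ h * ((J : ℝ) - |(j : ℝ)|)) :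
    trapezoidWeight h J j = 1 :=
  min_eq_left (hj.trans (mul_le_mul_of_nonneg_left (le_max_right _ _) hh.le))

/-- Removes the weight: it equals one on a range with one index to spare at each end, which leaves
room for a shift by at most one. -/
theorem sum_shift_le_sum_weight {J J' : ℤ} {φ g : ℤ → ℝ} (hφ0 : ∀ j, 0 ≤ φ j)
    (hφ1 : ∀ j, |j| ≤ J + 1 → φ j = 1) (hg : ∀ j, 0 ≤ g j) (hJ : J + 1 ≤ J') {i : ℤ}
    (hi : |i| ≤ 1) :
    ∑ j ∈ Finset.Icc (-J) J, g (j + i) ≤ ∑ j ∈ Finset.Icc (-J') J', φ j * g j := by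
  obtain ⟨i1, i2⟩ := abs_le.1 hi
  have e : ∑ j ∈ Finset.Icc (-J) J, g (j + i)
      = ∑ j ∈ (Finset.Icc (-J) J).map (addRightEmbedding i), φ j * g j := by
    rw [Finset.sum_map]
    refine Finset.sum_congr rfl fun j hj => ?_
    rw [Finset.mem_Icc] at hj
    rw [addRightEmbedding_apply, hφ1 _ (by rw [abs_le]; constructor <;> lia), one_mul]
  rw [e]
  refine Finset.sum_le_sum_of_subset_of_nonneg (fun j hj => ?_) fun j _ _ =>
    mul_nonneg (hφ0 j) (hg j)
  rw [Finset.mem_map] at hj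
  obtain ⟨l, hl, rfl⟩ := hj
  rw [Finset.mem_Icc] at hl ⊢
  rw [addRightEmbedding_apply]
  constructor <;> lia

/-- Freezes η and q on a cell. They vary there only because k(x) differs from the averaged
coefficient. -/
theorem abs_setIntegral_sub_le {s : Set (ℝ × ℝ)} {η q φ₁ φ₂ : ℝ × ℝ → ℝ} {η₀ q₀ ε : ℝ}
    (hi : IntegrableOn (fun p => η p * φ₁ p + q p * φ₂ p) s) (h1 : IntegrableOn φ₁ s)
    (h2 : IntegrableOn φ₂ s)
    (hε : ∀ᵐ p ∂volume.restrict s, |η p - η₀| ≤ ε ∧ |q p - q₀| ≤ ε) :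
    |(∫ p in s, (η p * φ₁ p + q p * φ₂ p)) - (η₀ * (∫ p in s, φ₁ p) + q₀ * ∫ p in s, φ₂ p)|
      ≤ ε * ((∫ p in s, |φ₁ p|) + ∫ p in s, |φ₂ p|) := by
  have i0 : IntegrableOn (fun p => η₀ * φ₁ p + q₀ * φ₂ p) s :=
    (h1.const_mul η₀).add (h2.const_mul q₀)
  have e1 : η₀ * (∫ p in s, φ₁ p) + q₀ * (∫ p in s, φ₂ p)
      = ∫ p in s, (η₀ * φ₁ p + q₀ * φ₂ p) := by
    rw [integral_add (h1.const_mul η₀) (h2.const_mul q₀), integral_const_mul, integral_const_mul]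
  have e2 : ε * ((∫ p in s, |φ₁ p|) + ∫ p in s, |φ₂ p|)
      = ∫ p in s, ε * (|φ₁ p| + |φ₂ p|) := by
    rw [integral_const_mul, integral_add h1.abs h2.abs]
  rw [e1, ← integral_sub hi i0, e2]
  refine (Real.norm_eq_abs _).symm.trans_le
    (norm_integral_le_of_norm_le ((h1.abs.add h2.abs).const_mul ε) ?_)
  filter_upwards [hε] with p hp
  rw [Real.norm_eq_abs, show η p * φ₁ p + q p * φ₂ p - (η₀ * φ₁ p + q₀ * φ₂ p)
    = (η p - η₀) * φ₁ p + (q p - q₀) * φ₂ p by ring]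
  refine (abs_add_le _ _).trans ?_
  rw [abs_mul, abs_mul]
  change _ ≤ ε * (|φ₁ p| + |φ₂ p|)
  rw [mul_add]
  exact add_le_add (mul_le_mul_of_nonneg_right hp.1 (abs_nonneg _))
    (mul_le_mul_of_nonneg_right hp.2 (abs_nonneg _))

theorem integrable_pairing {η q φ : ℝ × ℝ → ℝ} {s : Set (ℝ × ℝ)}
    (hη : AEStronglyMeasurable η (volume.restrict s))
    (hq : AEStronglyMeasurable q (volume.restrict s)) {C : ℝ}
    (hηC : ∀ᵐ p ∂volume.restrict s, |η p| ≤ C) (hqC : ∀ᵐ p ∂volume.restrict s, |q p| ≤ C)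
    (hφ : ContDiff ℝ 1 φ) (hφc : HasCompactSupport φ) (hφs : tsupport φ ⊆ s) :
    Integrable fun p => η p * partialT φ p + q p * partialX φ p := by
  have int : ∀ {g χ : ℝ × ℝ → ℝ}, AEStronglyMeasurable g (volume.restrict s) →
      (∀ᵐ p ∂volume.restrict s, |g p| ≤ C) → Continuous χ → HasCompactSupport χ →
      IntegrableOn (fun p => g p * χ p) s := fun hg hgC hχ hχc =>
    (hχ.integrable_of_hasCompactSupport hχc).integrableOn.bdd_mul hg
      (by simpa only [Real.norm_eq_abs] using hgC)
  have i : IntegrableOn (fun p => η p * partialT φ p + q p * partialX φ p) s :=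
    (int hη hηC (continuous_partialT hφ) (hasCompactSupport_partialT hφc)).add
      (int hq hqC (continuous_partialX hφ) (hasCompactSupport_partialX hφc))
  refine (integrableOn_iff_integrable_of_support_subset (Function.support_subset_iff'.2
    fun p hp => ?_)).1 i
  obtain ⟨e1, e2⟩ := partial_eq_zero_of_notMem fun h => hp (hφs h)
  rw [e1, e2]
  ring

/-- The error e is bounded by 2M and by the local variation d, so the sum of e² over j is at most
2MK. Cauchy–Schwarz against the gradient data, together with Nτ = T, gives √h D. -/
theorem sum_discretization_error_le {N : ℕ} {J : ℤ} {h τ T D M K : ℝ} (hh : 0 ≤ h) (hτ : 0 ≤ τ)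
    (hD : 0 ≤ D) (hM : 0 ≤ M) (hK : 0 ≤ K) (hT : (N : ℝ) * τ = T) {e d : ℤ → ℝ} {α ξ : ℕ → ℤ → ℝ}
    (he0 : ∀ j, 0 ≤ e j) (he : ∀ j, e j ≤ 2 * M) (hed : ∀ j, e j ≤ d j)
    (hd : ∑ j ∈ Finset.Icc (-J) J, d j ≤ K)
    (hα : ∑ n ∈ Finset.range N, ∑ j ∈ Finset.Icc (-J) J, α n j ^ 2 ≤ h * τ * D ^ 2)
    (hξ : ∑ n ∈ Finset.range N, ∑ j ∈ Finset.Icc (-J) J, ξ n j ^ 2 ≤ h * τ * D ^ 2) :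
    ∑ n ∈ Finset.range N, ∑ j ∈ Finset.Icc (-J) J, e j * (α n j + ξ n j)
      ≤ √(8 * M * K * T) * (√h * D) := by
  rw [← Finset.sum_product' (f := fun n j => e j * (α n j + ξ n j))]
  refine (Real.sum_mul_le_sqrt_mul_sqrt _ (fun i : ℕ × ℤ => e i.2) _).trans ?_
  have h1 : ∑ i ∈ Finset.range N ×ˢ Finset.Icc (-J) J, e i.2 ^ 2 ≤ N * (2 * M * K) := by
    rw [Finset.sum_product]
    have : ∑ j ∈ Finset.Icc (-J) J, e j ^ 2 ≤ 2 * M * K := by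
      refine le_trans (Finset.sum_le_sum fun j _ => ?_)
        ((Finset.mul_sum _ _ _).symm.trans_le (mul_le_mul_of_nonneg_left hd (by positivity)))
      rw [sq]
      exact mul_le_mul (he j) (hed j) (he0 j) (by positivity)
    simpa using mul_le_mul_of_nonneg_left this (Nat.cast_nonneg N)
  have h2 : ∑ i ∈ Finset.range N ×ˢ Finset.Icc (-J) J, (α i.1 i.2 + ξ i.1 i.2) ^ 2
      ≤ 4 * (h * τ * D ^ 2) := by
    rw [Finset.sum_product]
    have : ∀ x y : ℝ, (x + y) ^ 2 ≤ 2 * x ^ 2 + 2 * y ^ 2 := fun x y => by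
      nlinarith [sq_nonneg (x - y)]
    refine (Finset.sum_le_sum fun n _ => Finset.sum_le_sum fun j _ => this _ _).trans ?_
    simp only [Finset.sum_add_distrib, ← Finset.mul_sum]
    linarith
  refine (mul_le_mul (Real.sqrt_le_sqrt h1) (Real.sqrt_le_sqrt h2) (Real.sqrt_nonneg _)
    (Real.sqrt_nonneg _)).trans (le_of_eq ?_)
  have e1 : (N : ℝ) * (2 * M * K) * (4 * (h * τ * D ^ 2)) = 8 * M * K * T * h * D ^ 2 := by
    rw [← hT]; ring
  have hT0 : 0 ≤ T := hT ▸ by positivity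
  rw [← Real.sqrt_mul (by positivity), e1, Real.sqrt_mul (by positivity), Real.sqrt_sq hD,
    Real.sqrt_mul (by positivity), mul_assoc]

/-- The energy estimate on an unweighted range, together with its translates. -/
theorem exists_sum_sq_le {f V F : ℝ → ℝ} {M B β δ A lo hi : ℝ} (hf : FluxBounds f V F M B lo hi)
    (hβ : 0 < β) (hδ : 0 < δ) (hlo : lo ≤ hi) (hA : 0 ≤ A) {k : ℝ → ℝ} {G : ℝ → ℝ}
    (hG : Monotone G)
    (hGk : ∀ h, 0 < h → ∀ j : ℤ,
      |coeffAvg k h (j + 1) - coeffAvg k h j| ≤ G (((j : ℝ) + 2) * h) - G ((j : ℝ) * h))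
    {R H T : ℝ} (hR : 0 ≤ R) (hH : 0 ≤ H) (hT : 0 ≤ T) :
    ∃ E K, 0 ≤ E ∧ 0 ≤ K ∧ ∀ (h r a : ℝ) (L : ℕ) (u : ℕ → ℤ → ℝ),
      IsFlow f V M β δ A lo hi (coeffAvg k h) h r a (L + 1) u → ((L : ℝ) + 1) * (r * h) = T →
      h ≤ H → ∃ J : ℤ, 0 ≤ J ∧ R ≤ ((J : ℝ) - 1 / 2) * h ∧ (2 * J + 1) * h ≤ 2 * (R + 1 + 6 * H) ∧
        ∑ j ∈ Finset.Icc (-J) J, |coeffAvg k h (j + 1) - coeffAvg k h j| ≤ K ∧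
        ∑ j ∈ Finset.Icc (-J) J, |coeffAvg k h j - coeffAvg k h (j - 1)| ≤ K ∧
        ∑ j ∈ Finset.Icc (-J) J, (G (((j : ℝ) + 1) * h) - G (((j : ℝ) - 1) * h)) ≤ K ∧
        r * h * ∑ n ∈ Finset.range L, ∑ j ∈ Finset.Icc (-J) J,
          (u n (j + 1) - u n j) ^ 2 ≤ E ∧
        r * h * ∑ n ∈ Finset.range L, ∑ j ∈ Finset.Icc (-J) J,
          (u n j - u n (j - 1)) ^ 2 ≤ E ∧
        h * ∑ n ∈ Finset.range L, ∑ j ∈ Finset.Icc (-J) J,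
          (u (n + 1) j - u n j) ^ 2 ≤ E * r ∧
        h * ∑ n ∈ Finset.range L, ∑ j ∈ Finset.Icc (-J) J,
          (u (n + 1) (j + 1) - u n (j + 1)) ^ 2 ≤ E * r := by
  set ρ := R + 1 + 6 * H with hρ
  have hρ0 : 0 ≤ ρ := by positivity
  set K := 2 * (G ρ - G (-ρ)) with hK
  have hK0 : 0 ≤ K := by have := hG (by linarith : -ρ ≤ ρ); linarith
  obtain ⟨E, hE0, hE⟩ := energy_estimate hf hβ hδ hlo hA (R := 2 * ρ) (by positivity) hK0 hT
  refine ⟨E, K, hE0, hK0, fun h r a L u hu hLT hhH => ?_⟩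
  have hh := hu.h_pos
  have hr := hu.r_pos
  -- J covers the support |x| < R. J' adds one index for the shifts and ⌈1/h⌉ for the ramp of the
  -- trapezoidal weight. Then (J' + 2)h ≤ R + 1 + 6h, which is where ρ comes from.
  set J : ℤ := ⌈R / h⌉ + 1 with hJ
  set J' : ℤ := J + 1 + ⌈1 / h⌉ with hJ'
  have c1 : R ≤ ⌈R / h⌉ * h := (div_le_iff₀ hh).1 (Int.le_ceil _)
  have c2 : ⌈R / h⌉ * h ≤ R + h := by
    have := mul_le_mul_of_nonneg_right (Int.ceil_lt_add_one (R / h)).le hh.le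
    rwa [add_mul, one_mul, div_mul_cancel₀ _ hh.ne'] at this
  have c3 : 1 ≤ ⌈1 / h⌉ * h := (div_le_iff₀ hh).1 (Int.le_ceil _)
  have c4 : ⌈1 / h⌉ * h ≤ 1 + h := by
    have := mul_le_mul_of_nonneg_right (Int.ceil_lt_add_one (1 / h)).le hh.le
    rwa [add_mul, one_mul, div_mul_cancel₀ _ hh.ne'] at this
  have z1 : 0 ≤ ⌈R / h⌉ := Int.ceil_nonneg (by positivity)
  have z2 : 0 ≤ ⌈1 / h⌉ := Int.ceil_nonneg (by positivity)
  have eJ : (J : ℝ) = ⌈R / h⌉ + 1 := by rw [hJ]; push_cast; ring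
  have eJ' : (J' : ℝ) = J + 1 + ⌈1 / h⌉ := by rw [hJ']; push_cast; ring
  have hJ0 : 0 ≤ J := by lia
  have hJJ' : J + 1 ≤ J' := by lia
  have hJρ' : ((J' : ℝ) + 2) * h ≤ ρ := by rw [eJ', eJ]; linarith
  have hJρ : ((J : ℝ) + 2) * h ≤ ρ := by rw [eJ]; linarith
  -- total variation of the coefficient
  have tv : ∀ I : ℤ, 0 ≤ I → ((I : ℝ) + 2) * h ≤ ρ →
      ∑ j ∈ Finset.Icc (-I) I, |coeffAvg k h (j + 1) - coeffAvg k h j| ≤ K := fun I hI hIρ => by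
    refine le_trans (Finset.sum_le_sum fun j _ => hGk h hh j) ?_
    have := sum_two_step_telescope_le hG hh hI hIρ (s := 0) (by norm_num) le_rfl
    simpa only [add_zero] using this
  have shift : ∀ I : ℤ, 0 ≤ I → ((I : ℝ) + 2) * h ≤ ρ →
      ∑ j ∈ Finset.Icc (-I) I, (G (((j : ℝ) + 1) * h) - G (((j : ℝ) - 1) * h)) ≤ K :=
    fun I hI hIρ => by
      have := sum_two_step_telescope_le hG hh hI hIρ (s := -1) le_rfl (by norm_num)
      refine le_trans (le_of_eq (Finset.sum_congr rfl fun j _ => ?_)) this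
      rw [show (j : ℝ) + 2 + -1 = j + 1 by ring, sub_eq_add_neg (j : ℝ)]
  have tv' : ∀ I : ℤ, 0 ≤ I → ((I : ℝ) + 2) * h ≤ ρ →
      ∑ j ∈ Finset.Icc (-I) I, |coeffAvg k h j - coeffAvg k h (j - 1)| ≤ K := fun I hI hIρ => by
    refine le_trans (Finset.sum_le_sum fun j _ => ?_) (shift I hI hIρ)
    have := hGk h hh (j - 1)
    rw [sub_add_cancel] at this
    push_cast at this
    rwa [show (j : ℝ) - 1 + 2 = j + 1 by ring] at this
  have hcut := isCutoff_trapezoidWeight hh (by lia : 0 ≤ J')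
  have hone : ∀ j : ℤ, |j| ≤ J + 1 → trapezoidWeight h J' j = 1 := fun j hj => by
    have hj' : |(j : ℝ)| ≤ J + 1 := by exact_mod_cast hj
    refine trapezoidWeight_eq_one hh ?_
    rw [eJ']
    nlinarith
  obtain ⟨e1, e2⟩ := hE J' h r a _ _ (L + 1) u hcut hu (by linarith)
    (by push_cast; linarith) (tv J' (by lia) hJρ') (tv' J' (by lia) hJρ')
  rw [Nat.add_sub_cancel] at e1 e2
  have low : ∀ (g : ℕ → ℤ → ℝ) (i : ℤ), |i| ≤ 1 →
      ∑ n ∈ Finset.range L, ∑ j ∈ Finset.Icc (-J) J, g n (j + i) ^ 2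
        ≤ ∑ n ∈ Finset.range L, ∑ j ∈ Finset.Icc (-J') J', trapezoidWeight h J' j * g n j ^ 2 :=
    fun g i hi => Finset.sum_le_sum fun n _ =>
      sum_shift_le_sum_weight hcut.nonneg hone (fun j => sq_nonneg (g n j)) hJJ' hi
  have x0 := low (fun n j => u n (j + 1) - u n j) 0 (by norm_num)
  have x1 := low (fun n j => u n (j + 1) - u n j) (-1) (by norm_num)
  have w0 := low (fun n j => u (n + 1) j - u n j) 0 (by norm_num)
  have w1 := low (fun n j => u (n + 1) j - u n j) 1 (by norm_num)
  simp only [add_zero, ← sub_eq_add_neg, sub_add_cancel] at x0 x1 w0 w1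
  refine ⟨J, hJ0, ?_, by linarith, tv J hJ0 hJρ, tv' J hJ0 hJρ, shift J hJ0 hJρ, ?_, ?_, ?_, ?_⟩
  · rw [eJ]; linarith
  · exact (mul_le_mul_of_nonneg_left x0 (by positivity)).trans e1
  · exact (mul_le_mul_of_nonneg_left x1 (by positivity)).trans e1
  · exact (mul_le_mul_of_nonneg_left w0 hh.le).trans e2
  · exact (mul_le_mul_of_nonneg_left w1 hh.le).trans e2

set_option maxHeartbeats 1000000 in
/-- The entropy production of the approximate solutions is the sum of a term which is small in
`H⁻¹` and a term which is bounded as a measure. -/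
theorem exists_entropyProduction_bound {f V F : ℝ → ℝ} {M B β δ A lo hi : ℝ}
    (hf : FluxBounds f V F M B lo hi) (hβ : 0 < β) (hδ : 0 < δ) (hlo : lo ≤ hi) (hA : 0 ≤ A)
    {k : ℝ → ℝ} (hk : MemLp k ⊤ volume) (hkM : (eLpNorm k ⊤ volume).toReal ≤ M)
    (hkBV : IsBVLoc k) {R H T C Cb : ℝ} (hR : 0 ≤ R) (hH : 0 ≤ H) (hT : 0 ≤ T) (hC : 0 ≤ C) :
    ∃ C', 0 ≤ C' ∧ ∀ (h r a : ℝ) (L : ℕ) (u v ηg qg : ℕ → ℤ → ℝ) (η q : ℝ × ℝ → ℝ),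
      IsFlow f V M β δ A lo hi (coeffAvg k h) h r a (L + 1) u → ((L : ℝ) + 1) * (r * h) = T →
      h ≤ H → IsEntropyPair f C (coeffAvg k h) (L + 1) u v ηg qg →
      (∀ n < L + 1, ∀ j : ℤ, ∀ᵐ p ∂volume.restrict (cell h (r * h) n j),
        |η p - ηg n j| ≤ C * |k p.1 - coeffAvg k h j| ∧
        |q p - qg n j| ≤ C * |k p.1 - coeffAvg k h j|) →
      AEStronglyMeasurable η (volume.restrict (strip T : Set (ℝ × ℝ))) →
      AEStronglyMeasurable q (volume.restrict (strip T : Set (ℝ × ℝ))) →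
      (∀ᵐ p ∂volume.restrict (strip T : Set (ℝ × ℝ)), |η p| ≤ Cb) →
      (∀ᵐ p ∂volume.restrict (strip T : Set (ℝ × ℝ)), |q p| ≤ Cb) →
      ∀ φ : ℝ × ℝ → ℝ, ContDiff ℝ 1 φ → HasCompactSupport φ →
        (∀ p ∈ tsupport φ, |p.1| < R ∧ 0 < p.2 ∧ p.2 < T) →
        ∀ D S : ℝ, 0 ≤ D → ∫ p, partialX φ p ^ 2 ≤ D ^ 2 → ∫ p, partialT φ p ^ 2 ≤ D ^ 2 →
          (∀ p, |φ p| ≤ S) →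
          |∫ p, (η p * partialT φ p + q p * partialX φ p)| ≤ C' * √h * D + C' * S := by
  obtain ⟨G, hG, hGk⟩ := exists_monotone_variation hk hkBV
  obtain ⟨E, K, hE0, hK0, hE⟩ := exists_sum_sq_le hf hβ hδ hlo hA hG
    (fun h hh j => (hGk h hh j).1) hR hH hT
  have hmem : lo ∈ Icc lo hi := left_mem_Icc.2 hlo
  have hM := hf.M_nonneg hmem
  have hB := hf.B_nonneg hmem
  set ι := 4 * β * B + 2 * (M ^ 2 * (1 + 2 * B)) with hι
  have hι0 : 0 ≤ ι := by positivity
  set P := C * (3 + 4 * (β + M ^ 2 + A) * (1 + ι)) with hP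
  have hP0 : 0 ≤ P := by positivity
  set Q1 := P * (4 * E + 2 * (K * T)) with hQ1
  set Q2 := P * √(45 * (4 * E + K * T)) with hQ2
  set Q3 := 2 * C * √(2 * (2 * (R + 1 + 6 * H))) with hQ3
  set Q4 := C * √(8 * M * K * T) with hQ4
  have q1 : 0 ≤ Q1 := by positivity
  have q2 : 0 ≤ Q2 := by positivity
  have q3 : 0 ≤ Q3 := by positivity
  have q4 : 0 ≤ Q4 := by positivity
  refine ⟨Q1 + Q2 + Q3 + Q4, by positivity, ?_⟩
  intro h r a L u v ηg qg η q hu hLT hhH hpair hcell hη hq hηC hqC φ hφ hφc hφs D S hD hX hTT hS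
  obtain ⟨J, hJ0, hJR, hJρ, hK, hK', hd, hs, hs', hw, hw'⟩ := hE h r a L u hu hLT hhH
  have hh := hu.h_pos
  have hr := hu.r_pos
  have hτ : 0 < r * h := by positivity
  have hNT : ((L + 1 : ℕ) : ℝ) * (r * h) = T := by push_cast; exact hLT
  have hgrid := isGridTest hφ hφc hh hτ (N := L + 1) (J := J) (R := R) (D := D) (S := S)
    (fun p hp => by rw [hNT]; exact hφs p (subset_tsupport _ hp)) hJR hX hTT hS
  have hbd := production_bound hf hβ.le hu hpair hgrid hι0
    (fun n hn j => hu.abs_increment_le hf hβ.le (by lia) j) hJ0 hD hK0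
    (by linarith : r * h * L ≤ T) hJρ hK hK' hs hs' hw hw'
  have hint := integrable_pairing hη hq hηC hqC hφ hφc
    (fun p hp => ⟨mem_univ _, (hφs p hp).2⟩)
  have hsplit := integral_eq_sum_cell hh hτ (N := L + 1) (A := Finset.Icc (-J) J)
    (g := fun p => η p * partialT φ p + q p * partialX φ p)
    (fun n j => hint.integrableOn) (fun p hp => by
      have hp' : p ∈ tsupport φ := by
        by_contra h0
        obtain ⟨e1, e2⟩ := partial_eq_zero_of_notMem h0
        exact hp (by simp only [e1, e2, mul_zero, add_zero])
      obtain ⟨b1, b2, b3⟩ := hφs p hp'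
      exact exists_mem_cell hh hτ hJR b1 b2 (by rw [hNT]; exact b3))
  set d : ℤ → ℝ := fun j => G (((j : ℝ) + 1) * h) - G (((j : ℝ) - 1) * h) with hdd
  have hd0 : ∀ j, 0 ≤ d j := fun j => sub_nonneg.2 (hG (by nlinarith))
  -- Both bounds are needed: d is summable over j, and 2M turns the squares into first powers of d.
  set e : ℤ → ℝ := fun j => min (d j) (2 * M) with he
  have hke : ∀ n, ∀ j, ∀ᵐ p ∂volume.restrict (cell h (r * h) n j),
      |k p.1 - coeffAvg k h j| ≤ e j := by
    intro n j
    have h1 : ∀ᵐ p : ℝ × ℝ, p.1 ∈ Ico (((j : ℝ) - 1 / 2) * h) (((j : ℝ) + 1 / 2) * h) →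
        |k p.1 - coeffAvg k h j| ≤ d j :=
      Measure.quasiMeasurePreserving_fst.ae (hGk h hh j).2
    have h2 : ∀ᵐ p : ℝ × ℝ, |k p.1| ≤ (eLpNorm k ⊤ volume).toReal :=
      Measure.quasiMeasurePreserving_fst.ae (abs_le_eLpNorm_top hk)
    filter_upwards [ae_restrict_of_ae h1, ae_restrict_of_ae h2,
      ae_restrict_mem (measurableSet_cell _ _ _ _)] with p p1 p2 p3
    exact le_min (p1 p3.1) (abs_sub_le_two_mul (p2.trans hkM) (hu.κ_le j))
  have herr : ∀ n < L + 1, ∀ j,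
      |(∫ p in cell h (r * h) n j, (η p * partialT φ p + q p * partialX φ p))
        - (ηg n j * (edgeT h (r * h) φ (n + 1) j - edgeT h (r * h) φ n j)
          + qg n j * (edgeX h (r * h) φ n (j + 1) - edgeX h (r * h) φ n j))|
      ≤ C * (e j * ((∫ p in cell h (r * h) n j, |partialT φ p|)
          + ∫ p in cell h (r * h) n j, |partialX φ p|)) := by
    intro n hn j
    rw [← setIntegral_cell_partialT hφ hh hτ, ← setIntegral_cell_partialX hφ hh hτ, ← mul_assoc]
    refine abs_setIntegral_sub_le hint.integrableOn (integrableOn_cell (continuous_partialT hφ) n j)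
      (integrableOn_cell (continuous_partialX hφ) n j) ?_
    filter_upwards [hcell n hn j, hke n j] with p p1 p2
    exact ⟨p1.1.trans (mul_le_mul_of_nonneg_left p2 hC),
      p1.2.trans (mul_le_mul_of_nonneg_left p2 hC)⟩
  have hsum := sum_discretization_error_le hh.le hτ.le hD hM hK0 hNT
    (fun j => le_min (hd0 j) (by positivity)) (fun j => min_le_right _ _)
    (fun j => min_le_left (d j) (2 * M)) hd (hgrid.sum_t _) (hgrid.sum_x _)
  have htot : |(∫ p, (η p * partialT φ p + q p * partialX φ p))
      - ∑ n ∈ Finset.range (L + 1), ∑ j ∈ Finset.Icc (-J) J,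
        (ηg n j * (edgeT h (r * h) φ (n + 1) j - edgeT h (r * h) φ n j)
          + qg n j * (edgeX h (r * h) φ n (j + 1) - edgeX h (r * h) φ n j))|
      ≤ C * (√(8 * M * K * T) * (√h * D)) := by
    rw [hsplit, ← Finset.sum_sub_distrib]
    refine le_trans ?_ (mul_le_mul_of_nonneg_left hsum hC)
    rw [Finset.mul_sum]
    refine (Finset.abs_sum_le_sum_abs _ _).trans (Finset.sum_le_sum fun n hn => ?_)
    rw [← Finset.sum_sub_distrib, Finset.mul_sum]
    exact (Finset.abs_sum_le_sum_abs _ _).trans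
      (Finset.sum_le_sum fun j _ => herr n (Finset.mem_range.1 hn) j)
  have hS0 : 0 ≤ S := (abs_nonneg _).trans (hS 0)
  have hX0 : 0 ≤ √h * D := by positivity
  have fin := (abs_sub_abs_le_abs_sub _ _).trans htot
  have m1 : 0 ≤ (Q2 + Q3 + Q4) * S := by positivity
  have m2 : 0 ≤ Q1 * (√h * D) := by positivity
  have expand : P * (S * (4 * E + 2 * (K * T)) + √(45 * (4 * E + K * T)) * (√h * D))
      = Q1 * S + Q2 * (√h * D) := by rw [hQ1, hQ2]; ring
  rw [← hP, expand] at hbd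
  have e4 : C * (√(8 * M * K * T) * (√h * D)) = Q4 * (√h * D) := by rw [hQ4]; ring
  rw [e4] at fin
  linarith

/-- The production bound holds with one constant for all meshes, because the mesh sizes are bounded
as a convergent sequence; the small factor is C'√h, which tends to zero. The number of levels is
written as L + 1 with L the number of usable time steps. -/
theorem isCompactInHNegOneLoc_of_isEntropyPair {f V F : ℝ → ℝ} {M B β δ A lo hi : ℝ}
    (hf : FluxBounds f V F M B lo hi) (hβ : 0 < β) (hδ : 0 < δ) (hlo : lo ≤ hi) (hA : 0 ≤ A)
    {k : ℝ → ℝ} (hk : MemLp k ⊤ volume) (hkM : (eLpNorm k ⊤ volume).toReal ≤ M)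
    (hkBV : IsBVLoc k) {T : ℝ} (hT : 0 < T) {h : ℕ → ℝ} (hh : ∀ m, 0 < h m)
    (hh0 : Tendsto h atTop (𝓝 0)) {N : ℕ → ℕ} (hN : ∀ m, 0 < N m) {u : ℕ → ℕ → ℤ → ℝ} {a : ℕ → ℝ}
    (hu : ∀ m, IsFlow f V M β δ A lo hi (coeffAvg k (h m)) (h m) (T / N m / h m) (a m) (N m) (u m))
    {C Cb : ℝ} (hC : 0 ≤ C) (hCb : 0 ≤ Cb) {v ηg qg : ℕ → ℕ → ℤ → ℝ}
    (hpair : ∀ m, IsEntropyPair f C (coeffAvg k (h m)) (N m) (u m) (v m) (ηg m) (qg m))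
    {η q : ℕ → ℝ × ℝ → ℝ}
    (hcell : ∀ m, ∀ n < N m, ∀ j : ℤ, ∀ᵐ p ∂volume.restrict (cell (h m) (T / N m) n j),
        |η m p - ηg m n j| ≤ C * |k p.1 - coeffAvg k (h m) j| ∧
        |q m p - qg m n j| ≤ C * |k p.1 - coeffAvg k (h m) j|)
    (hη : ∀ m, AEStronglyMeasurable (η m) (volume.restrict (strip T : Set (ℝ × ℝ))))
    (hq : ∀ m, AEStronglyMeasurable (q m) (volume.restrict (strip T : Set (ℝ × ℝ))))
    (hηC : ∀ m, ∀ᵐ p ∂volume.restrict (strip T : Set (ℝ × ℝ)), |η m p| ≤ Cb)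
    (hqC : ∀ m, ∀ᵐ p ∂volume.restrict (strip T : Set (ℝ × ℝ)), |q m p| ≤ Cb) :
    IsCompactInHNegOneLoc (strip T) fun m => entropyProduction (strip T) (η m) (q m) := by
  refine isCompactInHNegOneLoc_of_bound hT hη hq hηC hqC hCb fun R hR => ?_
  obtain ⟨H, hH⟩ := hh0.bddAbove_range
  have hH' : ∀ m, h m ≤ H := fun m => hH (mem_range_self m)
  obtain ⟨C', hC', hbd⟩ := exists_entropyProduction_bound hf hβ hδ hlo hA hk hkM hkBV (R := R)
    (H := H) (T := T) (Cb := Cb) hR.le ((hh 0).le.trans (hH' 0)) hT.le hC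
  refine ⟨C', fun m => C' * √(h m), hC', ?_, fun m φ hφ hφc hφs D S hD hX hTT hS => ?_⟩
  · simpa using (Real.continuous_sqrt.tendsto 0 |>.comp hh0).const_mul C'
  · have hNe : N m - 1 + 1 = N m := Nat.sub_add_cancel (hN m)
    have hN0 : ((N m : ℕ) : ℝ) ≠ 0 := by have := hN m; positivity
    have hNc : ((N m - 1 : ℕ) : ℝ) + 1 = N m := by exact_mod_cast hNe
    have hτ : T / N m / h m * h m = T / N m := div_mul_cancel₀ _ (hh m).ne'
    refine hbd (h m) (T / N m / h m) (a m) (N m - 1) (u m) (v m) (ηg m) (qg m) (η m) (q m)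
      (by rw [hNe]; exact hu m) (by rw [hτ, hNc]; field_simp) (hH' m) (by rw [hNe]; exact hpair m)
      (fun n hn j => ?_) (hη m) (hq m) (hηC m) (hqC m) φ hφ hφc hφs D S hD hX hTT hS
    rw [hτ]
    exact hcell m n (by lia) j

/-- The grid function factors through the countable set of cell indices, so w may be any function.
-/
theorem measurable_comp_gridFun (h τ : ℝ) (u : ℕ → ℤ → ℝ) (w : ℝ → ℝ) :
    Measurable fun p => w (gridFun h τ u p) := by
  have h1 : Measurable fun p : ℝ × ℝ => (⌊p.2 / τ⌋₊, ⌊p.1 / h + 1 / 2⌋) :=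
    (Nat.measurable_floor.comp (measurable_snd.div_const τ)).prodMk
      (Int.measurable_floor.comp ((measurable_fst.div_const h).add_const _))
  have h2 : Measurable fun i : ℕ × ℤ => w (u i.1 i.2) := measurable_of_countable _
  have h3 : (fun p => w (gridFun h τ u p))
      = fun p : ℝ × ℝ => if 0 ≤ p.2 then w (u ⌊p.2 / τ⌋₊ ⌊p.1 / h + 1 / 2⌋) else w 0 := by
    funext p
    rw [gridFun, apply_ite w]
  rw [h3]
  exact Measurable.ite (measurableSet_le measurable_const measurable_snd) (h2.comp h1)
    measurable_const

theorem abs_le_supAbs {g : ℝ → ℝ} {a b s : ℝ} (hg : ContinuousOn g (Icc a b))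
    (hs : s ∈ Icc a b) : |g s| ≤ supAbs g a b :=
  le_csSup (isCompact_Icc.bddAbove_image hg.abs) (mem_image_of_mem _ hs)

/-- The order condition bounds the ratio for large m only; the finitely many remaining meshes are
absorbed in the constant. -/
theorem exists_bound_of_isBigO_sq {μ : ℝ → ℝ} (hμ : ∀ s, 0 < s → 0 < μ s)
    (hμO : μ =O[𝓝[>] 0] fun s => s ^ 2) {h : ℕ → ℝ} (hh : ∀ m, 0 < h m)
    (hh0 : Tendsto h atTop (𝓝 0)) {γ : ℝ} (hγ : 0 < γ) :
    ∃ A, 0 ≤ A ∧ ∀ m, γ * μ (h m) / h m ^ 2 ≤ A := by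
  obtain ⟨c, hc⟩ := hμO.bound
  have hh0' : Tendsto h atTop (𝓝[>] 0) :=
    tendsto_nhdsWithin_iff.2 ⟨hh0, Eventually.of_forall hh⟩
  have hev : ∀ᶠ m in atTop, γ * μ (h m) / h m ^ 2 ≤ γ * c := by
    filter_upwards [hh0'.eventually hc] with m hm
    have hp := hh m
    rw [Real.norm_eq_abs, Real.norm_eq_abs, abs_of_pos (hμ _ hp), abs_of_pos (by positivity)] at hm
    rw [div_le_iff₀ (by positivity), mul_assoc]
    exact mul_le_mul_of_nonneg_left hm hγ.le
  have hbdd : IsBoundedUnder (· ≤ ·) atTop fun m => γ * μ (h m) / h m ^ 2 := ⟨_, hev⟩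
  obtain ⟨A, hA⟩ := hbdd.bddAbove_range
  have hA' : ∀ m, γ * μ (h m) / h m ^ 2 ≤ A := fun m => hA (mem_range_self m)
  have h0 : 0 < γ * μ (h 0) / h 0 ^ 2 := by
    have := hμ _ (hh 0)
    have := hh 0
    positivity
  exact ⟨A, h0.le.trans (hA' 0), hA'⟩

end DDScheme

/-! ### The lemma: bounds and cell values of the two entropy pairs -/

theorem lemma5p1
    (T β γ δ a b a' b' c : ℝ) (hT : 0 < T) (hβ : 0 < β) (hγ : 0 < γ)
    (hδ : 0 < δ) (hδ' : δ < min 1 β)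
    -- the initial datum
    (u₀ : ℝ → ℝ) (hu₀ : MemLp u₀ 2 volume) (hu₀' : MemLp u₀ ⊤ volume)
    (hu₀ab : ∀ᵐ x, a ≤ u₀ x ∧ u₀ x ≤ b)
    -- the coefficient and the flux
    (k : ℝ → ℝ) (hk : MemLp k ⊤ volume) (hkBV : DDScheme.IsBVLoc k)
    (f : ℝ → ℝ) (hf : ContDiffOn ℝ 2 f (Icc a b))
    -- the size of the dispersion coefficient
    (μ : ℝ → ℝ) (hμ : ∀ s, 0 < s → 0 < μ s) (hμO : μ =O[𝓝[>] 0] fun s => s ^ 2)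
    -- the meshes, with time step T / N
    (h : ℕ → ℝ) (hh : ∀ m, 0 < h m) (hh0 : Tendsto h atTop (𝓝 0))
    (N : ℕ → ℕ) (hN : ∀ m, 0 < N m)
    (hCFL : ∀ m, DDScheme.CFL (DDScheme.dataBound f (derivWithin f (Icc a b)) k a' b')
      β γ δ (μ (h m)) (h m) (T / N m))
    -- the approximate solutions, uniformly bounded on ℝ × [0,T]
    (u : ℕ → ℕ → ℤ → ℝ)
    (hu : ∀ m, DDScheme.IsSchemeSolution f (derivWithin f (Icc a b)) k u₀
      β γ (μ (h m)) (h m) (T / N m) (N m) (u m))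
    (hab : Icc a' b' ⊆ Icc a b)
    (hbdd : ∀ m, ∀ᵐ p : ℝ × ℝ, p ∈ univ ×ˢ Icc 0 T →
      a' ≤ DDScheme.gridFun (h m) (T / N m) (u m) p ∧
        DDScheme.gridFun (h m) (T / N m) (u m) p ≤ b')
    (hc : c ∈ Icc a b) :
    let U : ℕ → ℝ × ℝ → ℝ := fun m => DDScheme.gridFun (h m) (T / N m) (u m)
    let η₁ : ℕ → ℝ × ℝ → ℝ := fun m p => DDScheme.entropy₁ c (U m p)
    let q₁ : ℕ → ℝ × ℝ → ℝ := fun m p => DDScheme.entropyFlux₁ f c (k p.1) (U m p)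
    let η₂ : ℕ → ℝ × ℝ → ℝ := fun m p => DDScheme.entropy₂ f c (k p.1) (U m p)
    let q₂ : ℕ → ℝ × ℝ → ℝ := fun m p =>
      DDScheme.entropyFlux₂ (derivWithin f (Icc a b)) c (k p.1) (U m p)
    -- the four functions define distributions on the strip
    (∀ m, ∀ g ∈ ({η₁ m, q₁ m, η₂ m, q₂ m} : Set (ℝ × ℝ → ℝ)),
      LocallyIntegrableOn g (DDScheme.strip T : Set (ℝ × ℝ)) volume) ∧
    DDScheme.IsCompactInHNegOneLoc (DDScheme.strip T)
      (fun m => DDScheme.entropyProduction (DDScheme.strip T) (η₁ m) (q₁ m)) ∧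
    DDScheme.IsCompactInHNegOneLoc (DDScheme.strip T)
      (fun m => DDScheme.entropyProduction (DDScheme.strip T) (η₂ m) (q₂ m)) := by
  intro U η₁ q₁ η₂ q₂
  have hab0 : a ≤ b := hc.1.trans hc.2
  have hτ : ∀ m, 0 < T / N m := fun m => div_pos hT (by exact_mod_cast hN m)
  have hNτ : ∀ m, (N m : ℝ) * (T / N m) = T := fun m => by
    have : (N m : ℝ) ≠ 0 := by exact_mod_cast (hN m).ne'
    field_simp
  have hmem : ∀ m, ∀ n < N m, ∀ j, u m n j ∈ Icc a' b' := fun m n hn j =>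
    DDScheme.mem_Icc_of_ae_gridFun (hh m) (hτ m) (hNτ m) (hbdd m) hn j
  have hlo : a' ≤ b' := (hmem 0 0 (hN 0) 0).1.trans (hmem 0 0 (hN 0) 0).2
  obtain ⟨L, hL, hfg⟩ := DDScheme.exists_hasLipschitzDeriv hab0 hf
  set g := derivWithin f (Icc a b)
  set M := DDScheme.dataBound f g k a' b' with hMdef
  have hfg' := hfg.mono hab
  have hfM : ∀ s ∈ Icc a' b', |f s| ≤ M := fun s hs =>
    (DDScheme.abs_le_supAbs hfg'.continuousOn_f hs).trans
      ((le_max_left _ _).trans (le_max_left _ _))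
  have hgM : ∀ s ∈ Icc a' b', |g s| ≤ M := fun s hs =>
    (DDScheme.abs_le_supAbs hfg'.continuousOn hs).trans
      ((le_max_right _ _).trans (le_max_left _ _))
  have hkM : (eLpNorm k ⊤ volume).toReal ≤ M := le_max_right _ _
  have hM : 0 ≤ M := ENNReal.toReal_nonneg.trans hkM
  have hFB := hfg'.fluxBounds hlo hfM hgM
  obtain ⟨A, hA, hAm⟩ := DDScheme.exists_bound_of_isBigO_sq hμ hμO hh hh0 hγ
  have hflow := fun m => (hu m).isFlow hfg' hlo hk hkM (hh m) (hτ m) hγ (hμ _ (hh m)) (hAm m) hδ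
    (hCFL m) (hmem m)
  -- Since c lies in [a, b] and possibly outside [a', b'], the constant M does not control f(c) or
  -- the integral from c. The separate constants are collected in L' below.
  obtain ⟨M₁, hM₁⟩ := isCompact_Icc.exists_bound_of_continuousOn hfg.continuousOn
  have hM₁0 : 0 ≤ M₁ := (norm_nonneg _).trans (hM₁ c hc)
  set G : ℝ → ℝ := fun s => ∫ θ in c..s, g θ ^ 2 with hG
  have hG₁ : ∀ s ∈ Icc a' b', |G s| ≤ M₁ * M₁ * (b - a) := fun s hs => by
    refine (DDScheme.abs_integral_le_of_mem fun θ hθ => ?_).trans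
      (mul_le_mul_of_nonneg_left (?_ : |c - s| ≤ b - a) (mul_nonneg hM₁0 hM₁0))
    · have := hM₁ θ (DDScheme.uIcc_subset_of_mem hc (hab hs) hθ)
      rw [sq]
      exact DDScheme.abs_mul_le_of_le this this
    · rw [abs_le]
      constructor <;> linarith [hc.1, hc.2, (hab hs).1, (hab hs).2]
  have hG₁0 : 0 ≤ M₁ * M₁ * (b - a) := mul_nonneg (mul_nonneg hM₁0 hM₁0) (by linarith)
  set L' := L + |f c| + M₁ * M₁ * (b - a) with hL'
  have hL'0 : 0 ≤ L' := by positivity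
  have hLL' : L ≤ L' := by linarith [abs_nonneg (f c)]
  have hfcL : |f c| ≤ L' := by linarith
  have hGL : ∀ s ∈ Icc a' b', |G s| ≤ L' := fun s hs =>
    (hG₁ s hs).trans (by linarith [abs_nonneg (f c)])
  have hfcM : ∀ s ∈ Icc a' b', |f s - f c| ≤ M + L' := fun s hs =>
    (abs_sub _ _).trans (add_le_add (hfM s hs) hfcL)
  -- measurability and bounds on the strip
  have hkm : AEStronglyMeasurable (fun p : ℝ × ℝ => k p.1) volume :=
    hk.1.comp_quasiMeasurePreserving Measure.quasiMeasurePreserving_fst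
  have hUm : ∀ (w : ℝ → ℝ) (m : ℕ), AEStronglyMeasurable (fun p : ℝ × ℝ => w (U m p)) volume :=
    fun w m => (DDScheme.measurable_comp_gridFun _ _ _ w).aestronglyMeasurable
  have hUb : ∀ m, ∀ᵐ p ∂volume.restrict (DDScheme.strip T : Set (ℝ × ℝ)),
      U m p ∈ Icc a' b' := fun m => by
    filter_upwards [ae_restrict_of_ae (hbdd m),
      ae_restrict_mem (DDScheme.strip T).isOpen.measurableSet] with p p1 p2
    exact p1 ⟨p2.1, Ioo_subset_Icc_self p2.2⟩
  have hkb : ∀ᵐ p : ℝ × ℝ ∂volume.restrict (DDScheme.strip T : Set (ℝ × ℝ)), |k p.1| ≤ M :=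
    ae_restrict_of_ae (Measure.quasiMeasurePreserving_fst.ae
      ((DDScheme.abs_le_eLpNorm_top hk).mono fun x hx => hx.trans hkM))
  have hq₂ : ∀ m, q₂ m = fun p => k p.1 ^ 2 * G (U m p) := fun m =>
    funext fun p => DDScheme.entropyFlux₂_eq _ _ _ _
  have hq₁ : ∀ m, q₁ m = fun p => k p.1 * (f (U m p) - f c) := fun m =>
    funext fun p => (mul_sub _ _ _).symm
  have mη₁ : ∀ m, AEStronglyMeasurable (η₁ m)
      (volume.restrict (DDScheme.strip T : Set (ℝ × ℝ))) := fun m =>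
    (hUm (fun s => s - c) m).restrict
  have mq₁ : ∀ m, AEStronglyMeasurable (q₁ m)
      (volume.restrict (DDScheme.strip T : Set (ℝ × ℝ))) := fun m => by
    rw [hq₁]
    exact (hkm.mul (hUm (fun s => f s - f c) m)).restrict
  have mq₂ : ∀ m, AEStronglyMeasurable (q₂ m)
      (volume.restrict (DDScheme.strip T : Set (ℝ × ℝ))) := fun m => by
    rw [hq₂]
    exact ((hkm.pow 2).mul (hUm G m)).restrict
  set Cb := |a'| + |b'| + |c| + M * (M + L') + M * M * L' with hCb
  have pb1 : 0 ≤ M * (M + L') := by positivity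
  have pb2 : 0 ≤ M * M * L' := by positivity
  have hCb0 : 0 ≤ Cb := by positivity
  have bη₁ : ∀ m, ∀ᵐ p ∂volume.restrict (DDScheme.strip T : Set (ℝ × ℝ)), |η₁ m p| ≤ Cb := by
    intro m
    filter_upwards [hUb m] with p hp
    refine (abs_sub _ _).trans ?_
    have h1 : |U m p| ≤ |a'| + |b'| := by
      rw [abs_le]
      constructor <;>
        linarith [hp.1, hp.2, neg_abs_le a', le_abs_self b', abs_nonneg a', abs_nonneg b']
    change |U m p| + |c| ≤ _
    linarith
  have bq₁ : ∀ m, ∀ᵐ p ∂volume.restrict (DDScheme.strip T : Set (ℝ × ℝ)), |q₁ m p| ≤ Cb := by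
    intro m
    filter_upwards [hUb m, hkb] with p hp hp'
    rw [hq₁]
    refine (DDScheme.abs_mul_le_of_le hp' (hfcM _ hp)).trans ?_
    linarith [abs_nonneg a', abs_nonneg b', abs_nonneg c]
  have bq₂ : ∀ m, ∀ᵐ p ∂volume.restrict (DDScheme.strip T : Set (ℝ × ℝ)), |q₂ m p| ≤ Cb := by
    intro m
    filter_upwards [hUb m, hkb] with p hp hp'
    rw [hq₂]
    have h2 : |k p.1 ^ 2| ≤ M * M := by rw [sq]; exact DDScheme.abs_mul_le_of_le hp' hp'
    refine (DDScheme.abs_mul_le_of_le h2 (hGL _ hp)).trans ?_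
    linarith [abs_nonneg a', abs_nonneg b', abs_nonneg c]
  have hκ : ∀ m j, |DDScheme.coeffAvg k (h m) j| ≤ M := fun m j => (hflow m).κ_le j
  refine ⟨fun m w hw => ?_, ?_, ?_⟩
  · rcases hw with rfl | rfl | rfl | rfl
    · exact DDScheme.locallyIntegrableOn_of_bound (mη₁ m) (bη₁ m)
    · exact DDScheme.locallyIntegrableOn_of_bound (mq₁ m) (bq₁ m)
    -- The second entropy and the first entropy flux are the same function by definition, so the
    -- facts about q₁ serve for both.
    · exact DDScheme.locallyIntegrableOn_of_bound (mq₁ m) (bq₁ m)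
    · exact DDScheme.locallyIntegrableOn_of_bound (mq₂ m) (bq₂ m)
  · refine DDScheme.isCompactInHNegOneLoc_of_isEntropyPair hFB hβ hδ hlo hA hk hkM hkBV hT hh hh0
      hN hflow (C := 1 + M + L' + M * M + M * L') (by positivity) hCb0
      (fun m => DDScheme.isEntropyPair_identity hM hfM hFB.f_sub (hκ m) (hmem m) hfcL le_rfl)
      (fun m n hn j => ?_) mη₁ mq₁ bη₁ bq₁
    filter_upwards [ae_restrict_mem (DDScheme.measurableSet_cell _ _ _ _)] with p hp
    have hU : U m p = u m n j := DDScheme.gridFun_eq (hh m) (hτ m) _ _ _ hp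
    have hum := hmem m n hn j
    constructor
    · change |U m p - c - (u m n j - c)| ≤ _
      rw [hU, sub_self, abs_zero]
      positivity
    · rw [hq₁]
      simp only [hU]
      rw [← sub_mul, abs_mul, mul_comm]
      refine mul_le_mul_of_nonneg_right ((hfcM _ hum).trans ?_) (abs_nonneg _)
      have : 0 ≤ 1 + M * M + M * L' := by positivity
      linarith
  · set C := M + M * M + M * L' + 2 * (M * L') + M * (M * M) + M * M * L' + M * M * (M * M)
      + M * M * (M * L') with hCdef
    have p1 : 0 ≤ M * M + M * (M * M) + M * M * L' + M * M * (M * M) + M * M * (M * L') := by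
      positivity
    have p2 : 0 ≤ M * L' := by positivity
    -- The summand L' serves the cell estimate below, where replacing k by its average in the
    -- entropy costs the factor M + L'.
    have hpair : ∀ m, DDScheme.IsEntropyPair f (C + L') (DDScheme.coeffAvg k (h m)) (N m) (u m)
        (fun n j => DDScheme.coeffAvg k (h m) j * g (u m n j))
        (fun n j => DDScheme.coeffAvg k (h m) j * (f (u m n j) - f c))
        (fun n j => DDScheme.coeffAvg k (h m) j ^ 2 * G (u m n j)) := fun m =>
      DDScheme.isEntropyPair_flux hM hL'0 hfM hgM hFB.f_sub
        (fun s hs t ht => (hfg'.lip s hs t ht).trans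
          (mul_le_mul_of_nonneg_right hLL' (abs_nonneg _)))
        (fun s hs t ht => (hfg'.taylor hL hs ht).trans
          (mul_le_mul_of_nonneg_right hLL' (sq_nonneg _)))
        hGL (fun s hs t ht => hfg.abs_entropyFlux_sub_le hc hab hgM hs ht)
        (fun s hs t ht => (hfg.abs_entropyFlux_taylor_le hL hc hab hgM hs ht).trans
          (mul_le_mul_of_nonneg_right (mul_le_mul_of_nonneg_left hLL' hM) (sq_nonneg _)))
        (hκ m) (hmem m) (le_add_of_nonneg_right hL'0)
    refine DDScheme.isCompactInHNegOneLoc_of_isEntropyPair hFB hβ hδ hlo hA hk hkM hkBV hT hh hh0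
      hN hflow (by positivity) hCb0 hpair (fun m n hn j => ?_) mq₁ mq₂ bq₁ bq₂
    filter_upwards [ae_restrict_mem (DDScheme.measurableSet_cell _ _ _ _),
      ae_restrict_of_ae (Measure.quasiMeasurePreserving_fst.ae (DDScheme.abs_le_eLpNorm_top hk))]
      with p hp hkp
    have hU : U m p = u m n j := DDScheme.gridFun_eq (hh m) (hτ m) _ _ _ hp
    have hum := hmem m n hn j
    constructor
    · change |q₁ m p - _| ≤ _
      rw [hq₁]
      simp only [hU]
      rw [← sub_mul, abs_mul, mul_comm]
      refine mul_le_mul_of_nonneg_right ((hfcM _ hum).trans ?_) (abs_nonneg _)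
      linarith
    · rw [hq₂]
      simp only [hU]
      rw [← sub_mul, sq_sub_sq, mul_right_comm]
      refine (DDScheme.abs_mul_le_of_le (DDScheme.abs_mul_le_of_le ((abs_add_le _ _).trans
        (add_le_add (hkp.trans hkM) (hκ m j))) (hGL _ hum)) le_rfl).trans ?_
      refine mul_le_mul_of_nonneg_right ?_ (abs_nonneg _)
      linarith
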